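/- **Setting.** Let $N\ge 1$ be an integer, $a\in\mathbb R$, $q\in L^2(0,1)$ real-valued, and let $k\in\mathbb Z$ be a representative of a class in $\mathbb Z_N=\mathbb Z/N\mathbb Z$. Put $s=e^{2\pi i/N}$, $s^{k}=e^{2\pi i k/N}$, $$c_k=\cos\Big(a+\frac{\pi k}{N}\Big),\quad s_k=\sin\Big(a+\frac{\pi k}{N}\Big),\quad c_{0k}=\cos\frac{\pi k}{N},\quad s_{0k}=\sin\frac{\pi k}{N}.$$ Let $\Gamma$ be the metric graph with edges $\Gamma_{n,j}\cong[0,1]$, $(n,j)\in\mathbb Z\times\{0,1,2\}$; a function on $\Gamma$ is a family $f=(f_{n,j})$ of functions on $[0,1]$. The *Kirchhoff conditions* are, for all $n\in\mathbb Z$, $$f_{n,0}(1)=f_{n,1}(0)=e^{ia}s^kf_{n,2}(1),\qquad f_{n+1,0}(0)=e^{ia}f_{n,1}(1)=f_{n,2}(0),$$ $$-f_{n,0}'(1)+f_{n,1}'(0)-e^{ia}s^kf_{n,2}'(1)=0,\qquad f_{n+1,0}'(0)-e^{ia}f_{n,1}'(1)+f_{n,2}'(0)=0 .$$ Let $H_k$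 be the self-adjoint operator $(H_kf)_{n,j}=-f_{n,j}''+qf_{n,j}$ in $L^2(\Gamma)=\bigoplus_{n,j}L^2(0,1)$, with domain the set of $f\in L^2(\Gamma)$ such that $f_{n,j}\in W^2(0,1)$ for all $(n,j)$, $f''\in L^2(\Gamma)$, and the Kirchhoff conditions hold. Let $\vartheta(t,\lambda),\varphi(t,\lambda)$ be the solutions of $-y''+qy=\lambda y$ on $[0,1]$ with $\vartheta(0)=\varphi'(0)=1$, $\vartheta'(0)=\varphi(0)=0$. Let $\sigma_D$ be the Dirichlet spectrum of $-y''+qy$ on $[0,1]$ (boundary conditions $y(0)=y(1)=0$), and put $$\Delta(\lambda)=\tfrac12\big(\varphi'(1,\lambda)+\vartheta(1,\lambda)\big),\qquad F=2\Delta^2+\tfrac14\,\varphi(1,\cdot)\,\vartheta'(1,\cdot)-1 .$$ For $\lambda\in\mathbb C\setminus\sigma_D$, *fundamental solutions* are solutions $\Theta_k,\Phi_k$ of $-f''+qf=\lambda f$ on every edge of $\Gamma$ that satisfy the Kirchhoff conditions and $\Theta_{k,(0,0)}(0)=\Phi_{k,(0,0)}'(0)=1$, $\Theta_{k,(0,0)}'(0)=\Phi_{k,(0,0)}(0)=0$.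 The monodromy matrix is $$\mathcal M_k(\lambda)=\begin{pmatrix}\Theta_{k,(1,0)}(0)&\Phi_{k,(1,0)}(0)\\ \Theta_{k,(1,0)}'(0)&\Phi_{k,(1,0)}'(0)\end{pmatrix}.$$ If $\tau_{k,+},\tau_{k,-}$ are its eigenvalues (with multiplicity), the *Lyapunov functions* are $F_{k,\pm}=\frac12\big(\tau_{k,\pm}+\tau_{k,\pm}^{-1}\big)$. For $c_k\ne0$ put $$T_k=\frac{c_{0k}}{c_k}\,(F+s_k^2),\qquad R_k=\frac{s_{0k}^2}{c_k^2}\Big(c_k^2-(F+s_k^2)^2\Big),$$ and let $F_k=T_k+\sqrt{R_k}$ be the corresponding two-valued analytic function of $\lambda\in\mathbb C$, that is, the function on the two-sheeted Riemann surface of $\sqrt{R_k}$ (for $k\equiv0 \bmod N$ one has $R_k\equiv0$ and $F_k=T_k$). A point $\lambda$ is a branch point of $F_k$ if $F_k$ has no single-valued analytic branch in a neighbourhood of $\lambda$. For a self-adjoint operator $H$, $\sigma_\infty(H)$ denotes the set of eigenvalues of $H$ of infinite multiplicity, and $\sigma_{ac}(H)$ the absolutely continuous spectrum, i.e. the spectrum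 of the restriction of $H$ to its absolutely continuous subspace. **Theorem.** Let $c_k\neq0$. Then: i) For every $\lambda\in\mathbb C\setminus\sigma_D$ fundamental solutions exist, the eigenvalues $\tau_{k,\pm}$ of $\mathcal M_k(\lambda)$ are non-zero, and $$F_{k,\pm}(\lambda)=T_k(\lambda)\pm\sqrt{R_k(\lambda)}$$ for a suitable choice of the square root. ii) $\sigma(H_k)=\sigma_\infty(H_k)\cup\sigma_{ac}(H_k)$, $\ \sigma_\infty(H_k)=\sigma_D$, and $\ \sigma_{ac}(H_k)=\{\lambda\in\mathbb R: F_k(\lambda)\in[-1,1]\}$. The last identity holds both when $F_k(\lambda)\in[-1,1]$ is required for at least one of the two values of $F_k$ at $\lambda$ and when it is required for both. iii) If $\lambda\in\mathbb R$ is not a branch point of $F_k$ and an analytic branch of $F_k$ near $\lambda$ satisfies $F_k(\lambda)\in(-1,1)$, then the derivative of this branch satisfies $F_k'(\lambda)\neq0$. -/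

import Mathlib

open MeasureTheory
open scoped Topology ENNReal

noncomputable section

namespace ZigzagGraph

/-! ### Ordinary differential equations on one edge, identified with `[0,1]` -/

/-- Lebesgue measure on the unit interval. -/
def edgeMeasure : Measure ℝ := volume.restrict (Set.Icc 0 1)

/-- `u` belongs to the Sobolev space `W²(0,1)`: it is `C¹` on `[0,1]` with derivative `u'`, and `u'`
is absolutely continuous with almost everywhere derivative `w ∈ L²(0,1)`; so `w = u''`. -/
structure IsW2 (u u' w : ℝ → ℂ) : Prop where
  deriv_eq : ∀ t ∈ Set.Icc (0 : ℝ) 1, HasDerivWithinAt u (u' t) (Set.Icc 0 1) t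
  memLp : MemLp w 2 edgeMeasure
  integral_eq : ∀ t ∈ Set.Icc (0 : ℝ) 1, u' t = u' 0 + ∫ x in (0 : ℝ)..t, w x

/-- `u` solves `-u'' + q u = lam u` on `[0,1]`, with derivative `u'`: `u` is `C¹`, and
`u'` is absolutely continuous with almost everywhere derivative `(q - lam) u`. -/
structure IsSolution (q : ℝ → ℝ) (lam : ℂ) (u u' : ℝ → ℂ) : Prop where
  deriv_eq : ∀ t ∈ Set.Icc (0 : ℝ) 1, HasDerivWithinAt u (u' t) (Set.Icc 0 1) t
  integral_eq : ∀ t ∈ Set.Icc (0 : ℝ) 1,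
    u' t = u' 0 + ∫ x in (0 : ℝ)..t, ((q x : ℂ) - lam) * u x

/-- The solution of the initial value problem `-u'' + q u = lam u`, `u 0 = α`, `u' 0 = β`,
together with its derivative. For `q ∈ L²(0,1)` it exists and is unique on `[0,1]`. -/
def ivp (q : ℝ → ℝ) (lam α β : ℂ) : (ℝ → ℂ) × (ℝ → ℂ) :=
  Classical.epsilon fun p => IsSolution q lam p.1 p.2 ∧ p.1 0 = α ∧ p.2 0 = β

/-- `ϑ(1, lam)`, where `ϑ(0) = 1`, `ϑ'(0) = 0`. -/
def theta1 (q : ℝ → ℝ) (lam : ℂ) : ℂ := (ivp q lam 1 0).1 1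

/-- `ϑ'(1, lam)`. -/
def theta1' (q : ℝ → ℝ) (lam : ℂ) : ℂ := (ivp q lam 1 0).2 1

/-- `φ(1, lam)`, where `φ(0) = 0`, `φ'(0) = 1`. -/
def phi1 (q : ℝ → ℝ) (lam : ℂ) : ℂ := (ivp q lam 0 1).1 1

/-- `φ'(1, lam)`. -/
def phi1' (q : ℝ → ℝ) (lam : ℂ) : ℂ := (ivp q lam 0 1).2 1

/-- The Dirichlet spectrum of `-y'' + q y` on `[0,1]`, as a set of complex numbers. -/
def dirichletSpectrum (q : ℝ → ℝ) : Set ℂ :=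
  {lam | ∃ u u' : ℝ → ℂ, IsSolution q lam u u' ∧ u 0 = 0 ∧ u 1 = 0 ∧
    ∃ t ∈ Set.Icc (0 : ℝ) 1, u t ≠ 0}

/-- The Hill discriminant `Δ = (φ'(1) + ϑ(1)) / 2`. -/
def hillDelta (q : ℝ → ℝ) (lam : ℂ) : ℂ := (phi1' q lam + theta1 q lam) / 2

/-- `F = 2 Δ² + φ(1) ϑ'(1) / 4 - 1`. -/
def bigF (q : ℝ → ℝ) (lam : ℂ) : ℂ :=
  2 * hillDelta q lam ^ 2 + phi1 q lam * theta1' q lam / 4 - 1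

/-! ### Trigonometric constants -/

/-- `c_k = cos (a + π k / N)`. -/
def cK (N : ℕ) (a : ℝ) (k : ℤ) : ℝ := Real.cos (a + Real.pi * k / N)

/-- `s_k = sin (a + π k / N)`. -/
def sK (N : ℕ) (a : ℝ) (k : ℤ) : ℝ := Real.sin (a + Real.pi * k / N)

/-- `c_{0k} = cos (π k / N)`. -/
def c0K (N : ℕ) (k : ℤ) : ℝ := Real.cos (Real.pi * k / N)

/-- `s_{0k} = sin (π k / N)`. -/
def s0K (N : ℕ) (k : ℤ) : ℝ := Real.sin (Real.pi * k / N)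

/-- `s^k`, where `s = exp (2 π i / N)`. -/
def sPow (N : ℕ) (k : ℤ) : ℂ := Complex.exp (2 * Real.pi * Complex.I / N) ^ k

/-- `T_k = (c_{0k} / c_k) (F + s_k²)`. -/
def TK (q : ℝ → ℝ) (N : ℕ) (a : ℝ) (k : ℤ) (lam : ℂ) : ℂ :=
  ((c0K N k : ℂ) / (cK N a k : ℂ)) * (bigF q lam + (sK N a k : ℂ) ^ 2)

/-- `R_k = (s_{0k}² / c_k²) (c_k² - (F + s_k²)²)`. -/
def RK (q : ℝ → ℝ) (N : ℕ) (a : ℝ) (k : ℤ) (lam : ℂ) : ℂ :=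
  ((s0K N k : ℂ) ^ 2 / (cK N a k : ℂ) ^ 2) *
    ((cK N a k : ℂ) ^ 2 - (bigF q lam + (sK N a k : ℂ) ^ 2) ^ 2)

/-! ### The graph, its Kirchhoff conditions and the monodromy matrix -/

/-- The edges `Γ_{n,j}` of the graph `Γ^{(1)}`; each edge is a copy of `[0,1]`. -/
abbrev Edge : Type := ℤ × Fin 3

/-- The Kirchhoff conditions at all vertices, for a function `u` on the graph with edgewise
derivative `u'`. -/
structure Kirchhoff (N : ℕ) (a : ℝ) (k : ℤ) (u u' : Edge → ℝ → ℂ) : Prop where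
  cont_lower : ∀ n : ℤ, u (n, 0) 1 = u (n, 1) 0
  cont_lower' : ∀ n : ℤ,
    u (n, 1) 0 = Complex.exp (Complex.I * a) * sPow N k * u (n, 2) 1
  cont_upper : ∀ n : ℤ, u (n + 1, 0) 0 = Complex.exp (Complex.I * a) * u (n, 1) 1
  cont_upper' : ∀ n : ℤ, Complex.exp (Complex.I * a) * u (n, 1) 1 = u (n, 2) 0
  flux_lower : ∀ n : ℤ,
    -u' (n, 0) 1 + u' (n, 1) 0 - Complex.exp (Complex.I * a) * sPow N k * u' (n, 2) 1 = 0
  flux_upper : ∀ n : ℤ,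
    u' (n + 1, 0) 0 - Complex.exp (Complex.I * a) * u' (n, 1) 1 + u' (n, 2) 0 = 0

/-- `u`, with edgewise derivative `u'`, solves `-u'' + q u = lam u` on every edge and satisfies the
Kirchhoff conditions (no growth condition is imposed). -/
structure IsGraphSolution (q : ℝ → ℝ) (N : ℕ) (a : ℝ) (k : ℤ) (lam : ℂ)
    (u u' : Edge → ℝ → ℂ) : Prop where
  solves : ∀ e, IsSolution q lam (u e) (u' e)
  kirchhoff : Kirchhoff N a k u u'

/-- `Θ`, `Φ` are fundamental solutions on the graph: solutions with
`Θ = Φ' = 1`, `Θ' = Φ = 0` at the initial point of the edge `(0,0)`. -/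
structure IsFundamentalPair (q : ℝ → ℝ) (N : ℕ) (a : ℝ) (k : ℤ) (lam : ℂ)
    (Θ Θ' Φ Φ' : Edge → ℝ → ℂ) : Prop where
  solTheta : IsGraphSolution q N a k lam Θ Θ'
  solPhi : IsGraphSolution q N a k lam Φ Φ'
  theta_init : Θ (0, 0) 0 = 1
  theta_init' : Θ' (0, 0) 0 = 0
  phi_init : Φ (0, 0) 0 = 0
  phi_init' : Φ' (0, 0) 0 = 1

/-- The monodromy matrix: Cauchy data of `Θ`, `Φ` at the initial point of the edge `(1,0)`. -/
def monodromy (Θ Θ' Φ Φ' : Edge → ℝ → ℂ) : Matrix (Fin 2) (Fin 2) ℂ :=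
  !![Θ (1, 0) 0, Φ (1, 0) 0; Θ' (1, 0) 0, Φ' (1, 0) 0]

/-! ### The Lyapunov function on its Riemann surface -/

/-- The values at `lam` of the two-valued function `F_k = T_k + √R_k`, i.e. its values at the
points over `lam` of the Riemann surface of `√R_k`. -/
def lyapunovValues (q : ℝ → ℝ) (N : ℕ) (a : ℝ) (k : ℤ) (lam : ℂ) : Set ℂ :=
  {z | (z - TK q N a k lam) ^ 2 = RK q N a k lam}

/-- `f` is (the germ at `lam` of) a single-valued analytic branch of `F_k = T_k + √R_k`. -/
def IsLyapunovBranchAt (q : ℝ → ℝ) (N : ℕ) (a : ℝ) (k : ℤ) (f : ℂ → ℂ) (lam : ℂ) : Prop :=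
  AnalyticAt ℂ f lam ∧ ∀ᶠ z in 𝓝 lam, f z ∈ lyapunovValues q N a k z

/-- `lam` is a branch point of `F_k`: near it `F_k` has no single-valued analytic branch. -/
def IsBranchPoint (q : ℝ → ℝ) (N : ℕ) (a : ℝ) (k : ℤ) (lam : ℂ) : Prop :=
  ¬ ∃ f : ℂ → ℂ, IsLyapunovBranchAt q N a k f lam

/-! ### The operator `H_k` -/

/-- The Hilbert space `L²(Γ^{(1)})`, the Hilbert sum of the spaces `L²(0,1)` over all edges. -/
abbrev L2Graph : Type := lp (fun _ : Edge => Lp ℂ 2 edgeMeasure) 2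

/-- `g = H_k f`: the function `f ∈ L²` is represented on every edge by a `W²` function `u`, whose
second derivatives form an element `h ∈ L²`; the Kirchhoff conditions hold; and
`g = -u'' + q u` almost everywhere on every edge. -/
def HRel (q : ℝ → ℝ) (N : ℕ) (a : ℝ) (k : ℤ) (f g : L2Graph) : Prop :=
  ∃ (u u' : Edge → ℝ → ℂ) (h : L2Graph),
    (∀ e, IsW2 (u e) (u' e) (h e)) ∧ Kirchhoff N a k u u' ∧
    (∀ e, f e =ᵐ[edgeMeasure] u e) ∧
    ∀ e, g e =ᵐ[edgeMeasure] fun t => -(h e t) + (q t : ℂ) * u e t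

theorem IsW2.congr {u u' w w₂ : ℝ → ℂ} (h : IsW2 u u' w) (hw : w =ᵐ[edgeMeasure] w₂) :
    IsW2 u u' w₂ := by
  refine ⟨h.deriv_eq, (memLp_congr_ae hw).1 h.memLp, fun t ht => ?_⟩
  rw [h.integral_eq t ht]
  congr 1
  apply intervalIntegral.integral_congr_ae
  have h1 := (ae_restrict_iff' measurableSet_Icc).1 hw
  filter_upwards [h1] with x hx hx2
  rw [Set.uIoc_of_le ht.1] at hx2
  exact hx ⟨hx2.1.le, hx2.2.trans ht.2⟩

theorem memLp_edgeIntervalIntegrable {w : ℝ → ℂ} (hw : MemLp w 2 edgeMeasure) {t : ℝ}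
    (ht : t ∈ Set.Icc (0 : ℝ) 1) : IntervalIntegrable w volume 0 t := by
  have : IsFiniteMeasure edgeMeasure := by
    unfold edgeMeasure
    infer_instance
  have h1 : IntegrableOn w (Set.Icc 0 1) volume := hw.integrable (by norm_num)
  rw [intervalIntegrable_iff, Set.uIoc_of_le ht.1]
  exact h1.mono_set fun x hx => ⟨hx.1.le, hx.2.trans ht.2⟩

theorem IsW2.add {u u' w v v' z : ℝ → ℂ} (h : IsW2 u u' w) (h₂ : IsW2 v v' z) :
    IsW2 (u + v) (u' + v') (w + z) := by
  refine ⟨fun t ht => (h.deriv_eq t ht).add (h₂.deriv_eq t ht), h.memLp.add h₂.memLp,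
    fun t ht => ?_⟩
  simp only [Pi.add_apply]
  rw [intervalIntegral.integral_add (memLp_edgeIntervalIntegrable h.memLp ht)
    (memLp_edgeIntervalIntegrable h₂.memLp ht), h.integral_eq t ht, h₂.integral_eq t ht]
  ring

theorem IsW2.smul {u u' w : ℝ → ℂ} (c : ℂ) (h : IsW2 u u' w) :
    IsW2 (c • u) (c • u') (c • w) := by
  refine ⟨fun t ht => (h.deriv_eq t ht).const_smul c, h.memLp.const_smul c, fun t ht => ?_⟩
  simp only [Pi.smul_apply]
  rw [intervalIntegral.integral_smul, h.integral_eq t ht, smul_add]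

/-- The graph of `H_k`, as a subspace of `L² × L²`. -/
def HGraph (q : ℝ → ℝ) (N : ℕ) (a : ℝ) (k : ℤ) : Submodule ℂ (L2Graph × L2Graph) where
  carrier := {p | HRel q N a k p.1 p.2}
  zero_mem' := by
    refine ⟨fun _ _ => 0, fun _ _ => 0, 0, fun e => ?_, ?_, fun e => ?_, fun e => ?_⟩
    · have h0 : IsW2 (fun _ => 0) (fun _ => 0) (fun _ => (0 : ℂ)) :=
        ⟨fun t _ => hasDerivWithinAt_const t _ _, MemLp.zero, fun t _ => by simp⟩
      exact h0.congr (Lp.coeFn_zero ℂ 2 edgeMeasure).symm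
    · constructor <;> simp
    · exact Lp.coeFn_zero ℂ 2 edgeMeasure
    · filter_upwards [Lp.coeFn_zero ℂ 2 edgeMeasure] with t ht
      have h1 : ((0 : L2Graph) e : ℝ → ℂ) t = 0 := ht
      change ((0 : L2Graph) e : ℝ → ℂ) t = -((0 : L2Graph) e : ℝ → ℂ) t + (q t : ℂ) * 0
      rw [h1]
      ring
  add_mem' := by
    rintro ⟨f, g⟩ ⟨f₂, g₂⟩ ⟨u, u', h, hW, hK, hf, hg⟩ ⟨v, v', h₂, hW₂, hK₂, hf₂, hg₂⟩
    have hadd : ∀ (x y : L2Graph) (e : Edge),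
        ((x + y) e : ℝ → ℂ) =ᵐ[edgeMeasure] (x e : ℝ → ℂ) + (y e : ℝ → ℂ) :=
      fun x y e => Lp.coeFn_add (x e) (y e)
    refine ⟨u + v, u' + v', h + h₂, fun e => ?_, ?_, fun e => ?_, fun e => ?_⟩
    · exact ((hW e).add (hW₂ e)).congr (hadd h h₂ e).symm
    · obtain ⟨a1, a2, a3, a4, a5, a6⟩ := hK
      obtain ⟨b1, b2, b3, b4, b5, b6⟩ := hK₂
      constructor <;> intro n <;> simp only [Pi.add_apply]
      · linear_combination a1 n + b1 n
      · linear_combination a2 n + b2 n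
      · linear_combination a3 n + b3 n
      · linear_combination a4 n + b4 n
      · linear_combination a5 n + b5 n
      · linear_combination a6 n + b6 n
    · filter_upwards [hadd f f₂ e, hf e, hf₂ e] with t h1 h2 h3
      change ((f + f₂) e : ℝ → ℂ) t = u e t + v e t
      rw [h1, Pi.add_apply, h2, h3]
    · filter_upwards [hadd g g₂ e, hadd h h₂ e, hg e, hg₂ e] with t h1 h2 h3 h4
      change ((g + g₂) e : ℝ → ℂ) t = -((h + h₂) e : ℝ → ℂ) t + (q t : ℂ) * (u e t + v e t)
      rw [h1, h2, Pi.add_apply, Pi.add_apply, h3, h4]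
      ring
  smul_mem' := by
    rintro c ⟨f, g⟩ ⟨u, u', h, hW, hK, hf, hg⟩
    have hsmul : ∀ (x : L2Graph) (e : Edge),
        ((c • x) e : ℝ → ℂ) =ᵐ[edgeMeasure] c • (x e : ℝ → ℂ) :=
      fun x e => Lp.coeFn_smul c (x e)
    refine ⟨c • u, c • u', c • h, fun e => ?_, ?_, fun e => ?_, fun e => ?_⟩
    · exact ((hW e).smul c).congr (hsmul h e).symm
    · obtain ⟨a1, a2, a3, a4, a5, a6⟩ := hK
      constructor <;> intro n <;> simp only [Pi.smul_apply, smul_eq_mul]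
      · linear_combination c * a1 n
      · linear_combination c * a2 n
      · linear_combination c * a3 n
      · linear_combination c * a4 n
      · linear_combination c * a5 n
      · linear_combination c * a6 n
    · filter_upwards [hsmul f e, hf e] with t h1 h2
      change ((c • f) e : ℝ → ℂ) t = c * u e t
      rw [h1, Pi.smul_apply, h2, smul_eq_mul]
    · filter_upwards [hsmul g e, hsmul h e, hg e] with t h1 h2 h3
      change ((c • g) e : ℝ → ℂ) t = -((c • h) e : ℝ → ℂ) t + (q t : ℂ) * (c * u e t)
      rw [h1, h2, Pi.smul_apply, Pi.smul_apply, h3, smul_eq_mul, smul_eq_mul]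
      ring

/-- A `W²` function that vanishes almost everywhere has vanishing second derivative. -/
theorem IsW2.eq_zero {u u' w : ℝ → ℂ} (h : IsW2 u u' w) (hu : u =ᵐ[edgeMeasure] 0) :
    (∀ t ∈ Set.Icc (0 : ℝ) 1, u t = 0) ∧ w =ᵐ[edgeMeasure] 0 := by
  have hc : ContinuousOn u (Set.Icc 0 1) := fun t ht => (h.deriv_eq t ht).continuousWithinAt
  have h0 : ∀ t ∈ Set.Icc (0 : ℝ) 1, u t = 0 := fun t ht =>
    Measure.eqOn_Icc_of_ae_eq volume (by norm_num) hu hc continuousOn_const ht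
  have h1 : ∀ t ∈ Set.Icc (0 : ℝ) 1, u' t = 0 := by
    intro t ht
    have hz : HasDerivWithinAt u 0 (Set.Icc 0 1) t :=
      (hasDerivWithinAt_const t (Set.Icc (0 : ℝ) 1) (0 : ℂ)).congr h0 (h0 t ht)
    exact (uniqueDiffOn_Icc (by norm_num) t ht).eq_deriv _ (h.deriv_eq t ht) hz
  refine ⟨h0, ?_⟩
  have h2 : ∀ t ∈ Set.Icc (0 : ℝ) 1, ∫ x in (0 : ℝ)..t, w x = 0 := by
    intro t ht
    have := h.integral_eq t ht
    rw [h1 t ht, h1 0 (by norm_num), zero_add] at this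
    exact this.symm
  have h3 := (memLp_edgeIntervalIntegrable h.memLp
    (Set.right_mem_Icc.2 zero_le_one)).ae_hasDerivAt_integral
  have hE : edgeMeasure = volume.restrict (Set.Ioo 0 1) :=
    (restrict_Ioo_eq_restrict_Icc (μ := volume)).symm
  rw [hE, Filter.EventuallyEq, ae_restrict_iff' measurableSet_Ioo]
  filter_upwards [h3] with x hx hx1
  have h4 := hx (by rw [Set.uIcc_of_le zero_le_one]; exact ⟨hx1.1.le, hx1.2.le⟩) 0
    (by rw [Set.uIcc_of_le zero_le_one]; exact ⟨le_rfl, zero_le_one⟩)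
  have h5 : (fun t => ∫ y in (0 : ℝ)..t, w y) =ᶠ[𝓝 x] fun _ => (0 : ℂ) := by
    filter_upwards [Ioo_mem_nhds hx1.1 hx1.2] with t ht
    exact h2 t ⟨ht.1.le, ht.2.le⟩
  exact h4.unique ((hasDerivAt_const x (0 : ℂ)).congr_of_eventuallyEq h5)

/-- `HGraph` is the graph of an operator. -/
theorem HGraph_functional (q : ℝ → ℝ) (N : ℕ) (a : ℝ) (k : ℤ) (x : L2Graph × L2Graph)
    (hx : x ∈ HGraph q N a k) (hx0 : x.1 = 0) : x.2 = 0 := by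
  obtain ⟨u, u', h, hW, hK, hf, hg⟩ := hx
  apply lp.ext
  funext e
  have hu : u e =ᵐ[edgeMeasure] 0 := by
    rw [hx0] at hf
    exact (hf e).symm.trans (Lp.coeFn_zero ℂ 2 edgeMeasure)
  obtain ⟨-, hw⟩ := (hW e).eq_zero hu
  change x.2 e = (0 : Lp ℂ 2 edgeMeasure)
  rw [Lp.eq_zero_iff_ae_eq_zero]
  filter_upwards [hg e, hu, hw] with t h1 h2 h3
  rw [h1, h2, h3]
  simp

/-- The operator `H_k f = -f'' + q f` in `L²(Γ^{(1)})`, with domain the functions `f ∈ L²` that are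
`W²` on the edges, have `f'' ∈ L²`, and satisfy the Kirchhoff conditions. -/
def opH (q : ℝ → ℝ) (N : ℕ) (a : ℝ) (k : ℤ) : L2Graph →ₗ.[ℂ] L2Graph :=
  (HGraph q N a k).toLinearPMap

/-- The graph of `opH` is `HGraph`. -/
theorem mem_graph_opH (q : ℝ → ℝ) (N : ℕ) (a : ℝ) (k : ℤ) (f g : L2Graph) :
    (f, g) ∈ (opH q N a k).graph ↔ HRel q N a k f g := by
  rw [opH, Submodule.toLinearPMap_graph_eq _ (HGraph_functional q N a k)]
  rfl

/-! ### Spectra of unbounded operators -/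

section Spectra

variable {E : Type*} [NormedAddCommGroup E] [InnerProductSpace ℂ E]

/-- For a closed subspace `S` reducing `T`: the point `lam` lies in the resolvent set of the
restriction of `T` to `S`, i.e. `T - lam` maps `dom T ∩ S` one-to-one onto `S` with bounded
inverse. -/
def InResolventOn (T : E →ₗ.[ℂ] E) (S : Set E) (lam : ℂ) : Prop :=
  ∃ C : ℝ, ∀ g ∈ S, ∃ f : T.domain,
    (f : E) ∈ S ∧ T f - lam • (f : E) = g ∧ ‖(f : E)‖ ≤ C * ‖g‖ ∧
      ∀ f₂ : T.domain, (f₂ : E) ∈ S → T f₂ - lam • (f₂ : E) = g → f₂ = f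

/-- The spectrum `σ(T)`. -/
def opSpectrum (T : E →ₗ.[ℂ] E) : Set ℂ := {lam | ¬ InResolventOn T Set.univ lam}

/-- The eigenspace `{f ∈ dom T : T f = lam f}`. -/
def eigenspace (T : E →ₗ.[ℂ] E) (lam : ℂ) : Submodule ℂ T.domain :=
  LinearMap.ker (T.toFun - lam • T.domain.subtype)

/-- `σ_∞(T)`: the eigenvalues of infinite multiplicity. -/
def infSpectrum (T : E →ₗ.[ℂ] E) : Set ℂ := {lam | ¬ FiniteDimensional ℂ (eigenspace T lam)}

/-- `μ` is the spectral measure of the vector `ψ` for the self-adjoint operator `T`: the finite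
Borel measure on `ℝ` with `⟨ψ, (T - z)⁻¹ ψ⟩ = ∫ (t - z)⁻¹ dμ(t)` for all non-real `z`. -/
def IsSpectralMeasure (T : E →ₗ.[ℂ] E) (ψ : E) (μ : Measure ℝ) : Prop :=
  IsFiniteMeasure μ ∧ ∀ z : ℂ, z.im ≠ 0 →
    ∃ f : T.domain, T f - z • (f : E) = ψ ∧
      inner ℂ ψ (f : E) = ∫ t : ℝ, ((t : ℂ) - z)⁻¹ ∂μ

/-- The absolutely continuous subspace: vectors whose spectral measure is absolutely continuous
with respect to Lebesgue measure. -/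
def acSubspace (T : E →ₗ.[ℂ] E) : Set E :=
  {ψ | ∃ μ : Measure ℝ, IsSpectralMeasure T ψ μ ∧ μ ≪ volume}

/-- `σ_ac(T)`: the spectrum of the restriction of `T` to its absolutely continuous subspace. -/
def acSpectrum (T : E →ₗ.[ℂ] E) : Set ℂ := {lam | ¬ InResolventOn T (acSubspace T) lam}

end Spectra

end ZigzagGraph

end

open ZigzagGraph

open MeasureTheory
open scoped Topology ENNReal

noncomputable section

namespace ZigzagGraph

section

/-! ### Integration operators on one edge -/

/-! Off the Dirichlet spectrum a solution on an edge is determined by its two end values, so the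
equation on the graph becomes a difference equation for the vertex values `x n` and `y n`, the
values at the two ends of the edge `(n, 0)`. With `κ = kap N a k = 2 c_k e^{iπk/N}`, `P = 2φ'(1) +
ϑ(1)` and `Q = 2ϑ(1) + φ'(1)` it reads `x n + κ x (n+1) = P y n`, `y (n+1) + κ̄ y n = Q x (n+1)`
(`kirchhoff_iff`). Eliminating either unknown leaves `κ τ² + (1 + |κ|² - P Q) τ + κ̄ = 0` for the
Floquet multiplier `τ`. The Wronskian identity gives `P Q = 4F + 5`, so with `σ = e^{iπk/N} τ` and
`w = (F + s_k²)/c_k` (`wK`) this is `σ + 1/σ = 2w` (`root_iff`). Everything is controlled by the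
single entire function `w`. If `w = cos θ`, the multipliers are `e^{-iπk/N ± iθ}`, and `T_k ± √R_k =
c_{0k} w ± s_{0k} √(1 - w²)` are the numbers `cos (θ ± πk/N)`; this is i). It also shows that for
real `w` one value of `F_k` lies in `[-1,1]` exactly when both do, and exactly when `|w| ≤ 1`.

Resolvent set. If `φ(1) ≠ 0` and `w ∉ [-1,1]`, no multiplier is unimodular, the vertex system is
uniquely solvable in `ℓ²(ℤ)`, and `H_k - λ` is a bijection (`exists_HRel`, `eq_zero_of_HRel`).
Non-real `λ` always qualify: a unimodular multiplier would produce a Bloch solution whose energy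
identity over one cell forces it to vanish (`wK_ne_of_im`). With symmetry, a telescoping Green
identity, this is self-adjointness (`isSelfAdj_opH`).

Eigenvalues of infinite multiplicity. At a Dirichlet point there are eigenfunctions supported on two
adjacent cells (`exists_loop_eigenvector`), and their translates are independent. Elsewhere an
eigenfunction is determined by two numbers (`finiteDimensional_eigenspace`).

Absolutely continuous spectrum. Away from the closed set `bands`, where `w ∈ [-1,1]`, only isolated
Dirichlet points can lie outside the resolvent set, and these carry no absolutely continuous measure
(`inResolventOn_acSubspace_of_punctured`). Inside an open band, Bloch solutions are superposed over
an arc of quasimomenta `θ` with `w (L θ) = cos θ`. By Parseval, `H_k` acts on the packet as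
multiplication by `L θ`, and its spectral measure is the image under `L` of a measure with positive
density (`exists_packet`). Points of the open bands are dense in `bands`.

Derivative. All preimages of `[-1,1]` under `w` are real (`BandFunction`). At a zero of order `n` of
`w - r` the preimages of real values leave in `2n` equally spaced directions, so `n = 1` if `|r| <
1` and `n ≤ 2` if `|r| = 1` (`deriv_ne_zero`, `order_le_two`). Part iii) follows by differentiating
`(f - c_{0k} w)² = s_{0k}² (1 - w²)` (`deriv_branch_ne_zero`). -/

/-- Continuous complex functions on an edge. -/
abbrev EdgeC : Type := C(Set.Icc (0 : ℝ) 1, ℂ)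

/-- Square integrable functions on an edge. -/
abbrev EdgeL2 : Type := Lp ℂ 2 edgeMeasure

/-- The extension of a continuous function on `[0,1]` to the real line. -/
def ext (u : EdgeC) : ℝ → ℂ := Set.IccExtend zero_le_one u

theorem continuous_ext (u : EdgeC) : Continuous (ext u) := u.continuous.Icc_extend'

theorem ext_of_mem (u : EdgeC) {t : ℝ} (ht : t ∈ Set.Icc (0 : ℝ) 1) : ext u t = u ⟨t, ht⟩ :=
  Set.IccExtend_of_mem _ _ ht

theorem norm_ext_le (u : EdgeC) (t : ℝ) : ‖ext u t‖ ≤ ‖u‖ := u.norm_coe_le_norm _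

instance : IsProbabilityMeasure edgeMeasure := by
  constructor
  simp [edgeMeasure]

theorem ae_edge_iff {p : ℝ → Prop} :
    (∀ᵐ t ∂edgeMeasure, p t) ↔ ∀ᵐ t : ℝ, t ∈ Set.Icc (0 : ℝ) 1 → p t :=
  ae_restrict_iff' measurableSet_Icc

theorem ae_mem_Icc : ∀ᵐ t ∂edgeMeasure, t ∈ Set.Icc (0 : ℝ) 1 :=
  ae_restrict_mem measurableSet_Icc

theorem integral_edge (f : ℝ → ℂ) : ∫ t, f t ∂edgeMeasure = ∫ t in (0 : ℝ)..1, f t := by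
  rw [edgeMeasure, integral_Icc_eq_integral_Ioc, intervalIntegral.integral_of_le zero_le_one]

theorem integral_congr_edge {f g : ℝ → ℂ} (h : f =ᵐ[edgeMeasure] g) {t : ℝ}
    (ht : t ∈ Set.Icc (0 : ℝ) 1) : ∫ x in (0 : ℝ)..t, f x = ∫ x in (0 : ℝ)..t, g x := by
  apply intervalIntegral.integral_congr_ae
  filter_upwards [ae_edge_iff.1 h] with x hx hx2
  rw [Set.uIoc_of_le ht.1] at hx2
  exact hx ⟨hx2.1.le, hx2.2.trans ht.2⟩

theorem norm_primitive_le {g : ℝ → ℂ} (hg : MemLp g 2 edgeMeasure) {t : ℝ}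
    (ht : t ∈ Set.Icc (0 : ℝ) 1) :
    ‖∫ x in (0 : ℝ)..t, g x‖ ≤ (eLpNorm g 2 edgeMeasure).toReal := by
  have hi : Integrable g edgeMeasure := hg.integrable (by norm_num)
  calc ‖∫ x in (0 : ℝ)..t, g x‖ ≤ ∫ x in (0 : ℝ)..t, ‖g x‖ :=
        intervalIntegral.norm_integral_le_integral_norm ht.1
    _ ≤ ∫ x, ‖g x‖ ∂edgeMeasure := by
        rw [intervalIntegral.integral_of_le ht.1]
        exact setIntegral_mono_set hi.norm (Filter.Eventually.of_forall fun _ => norm_nonneg _)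
          (LE.le.eventuallyLE fun x hx => ⟨hx.1.le, hx.2.trans ht.2⟩)
    _ = (eLpNorm g 1 edgeMeasure).toReal := by
        rw [integral_norm_eq_lintegral_enorm hi.1, eLpNorm_one_eq_lintegral_enorm]
    _ ≤ (eLpNorm g 2 edgeMeasure).toReal :=
        ENNReal.toReal_mono hg.2.ne
          (eLpNorm_le_eLpNorm_of_exponent_le (by norm_num) hi.1)

theorem continuousOn_primitive {g : ℝ → ℂ} (hg : MemLp g 2 edgeMeasure) :
    ContinuousOn (fun t => ∫ x in (0 : ℝ)..t, g x) (Set.Icc 0 1) := by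
  have hi : Integrable g edgeMeasure := hg.integrable (by norm_num)
  have := intervalIntegral.continuousOn_primitive_interval (f := g) (μ := volume)
    (a := (0 : ℝ)) (b := 1) (by rw [Set.uIcc_of_le zero_le_one]; exact hi)
  rwa [Set.uIcc_of_le zero_le_one] at this

/-- The primitive `t ↦ ∫₀ᵗ g`. -/
def primL : EdgeL2 →L[ℂ] EdgeC :=
  LinearMap.mkContinuous
    { toFun := fun g => ⟨fun t => ∫ x in (0 : ℝ)..t, g x,
        (continuousOn_primitive (Lp.memLp g)).domRestrict⟩
      map_add' := fun f g => by
        ext t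
        change ∫ x in (0 : ℝ)..t, (f + g : EdgeL2) x
          = (∫ x in (0 : ℝ)..t, f x) + ∫ x in (0 : ℝ)..t, g x
        rw [integral_congr_edge (Lp.coeFn_add f g) t.2]
        exact intervalIntegral.integral_add (memLp_edgeIntervalIntegrable (Lp.memLp f) t.2)
          (memLp_edgeIntervalIntegrable (Lp.memLp g) t.2)
      map_smul' := fun c f => by
        ext t
        change ∫ x in (0 : ℝ)..t, (c • f : EdgeL2) x = c • (∫ x in (0 : ℝ)..t, f x)
        rw [integral_congr_edge (Lp.coeFn_smul c f) t.2]
        exact intervalIntegral.integral_smul c (fun x => (f : ℝ → ℂ) x) }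
    1 fun g => by
      rw [ContinuousMap.norm_le _ (by positivity), one_mul]
      exact fun t => norm_primitive_le (Lp.memLp g) t.2

theorem primL_apply (g : EdgeL2) (t : Set.Icc (0 : ℝ) 1) :
    primL g t = ∫ x in (0 : ℝ)..t, g x := rfl

theorem memLp_mul_ext {m : ℝ → ℂ} (hm : MemLp m 2 edgeMeasure) (u : EdgeC) :
    MemLp (fun t => m t * ext u t) 2 edgeMeasure := by
  refine hm.of_le_mul (c := ‖u‖) (hm.1.mul (continuous_ext u).aestronglyMeasurable)
    (Filter.Eventually.of_forall fun t => ?_)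
  rw [norm_mul, mul_comm]
  gcongr
  exact norm_ext_le u t

/-- Multiplication by an `L²` function, from continuous functions to `L²`. -/
def mulL {m : ℝ → ℂ} (hm : MemLp m 2 edgeMeasure) : EdgeC →L[ℂ] EdgeL2 :=
  LinearMap.mkContinuous
    { toFun := fun u => (memLp_mul_ext hm u).toLp
      map_add' := fun u v => by
        rw [← MemLp.toLp_add]
        apply MemLp.toLp_congr
        refine Filter.Eventually.of_forall fun t => ?_
        change m t * (ext u t + ext v t) = _
        simp [mul_add]
      map_smul' := fun c u => by
        rw [RingHom.id_apply, ← MemLp.toLp_const_smul]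
        apply MemLp.toLp_congr
        refine Filter.Eventually.of_forall fun t => ?_
        change m t * (c * ext u t) = c * (m t * ext u t)
        ring }
    ‖hm.toLp‖ fun u => by
      refine (Lp.norm_le_mul_norm_of_ae_le_mul (g := hm.toLp) (c := ‖u‖) ?_).trans_eq
        (mul_comm _ _)
      filter_upwards [(memLp_mul_ext hm u).coeFn_toLp, hm.coeFn_toLp] with t h1 h2
      change ‖(MemLp.toLp _ (memLp_mul_ext hm u) : EdgeL2) t‖ ≤ _
      rw [h1, h2, norm_mul, mul_comm]
      gcongr
      exact norm_ext_le u t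

theorem mulL_ae {m : ℝ → ℂ} (hm : MemLp m 2 edgeMeasure) (u : EdgeC) :
    mulL hm u =ᵐ[edgeMeasure] fun t => m t * ext u t :=
  (memLp_mul_ext hm u).coeFn_toLp

theorem memLp_one_edge : MemLp (fun _ : ℝ => (1 : ℂ)) 2 edgeMeasure := memLp_const 1

/-- The inclusion of continuous functions into `L²`. -/
def inclL : EdgeC →L[ℂ] EdgeL2 := mulL memLp_one_edge

theorem inclL_ae (u : EdgeC) : inclL u =ᵐ[edgeMeasure] ext u := by
  filter_upwards [mulL_ae memLp_one_edge u] with t ht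
  rw [inclL, ht, one_mul]

variable {q : ℝ → ℝ}

theorem memLp_ofReal (hq : MemLp q 2 edgeMeasure) :
    MemLp (fun t => (q t : ℂ)) 2 edgeMeasure := hq.ofReal

/-- Multiplication by `q - lam`. -/
def potL (hq : MemLp q 2 edgeMeasure) (lam : ℂ) : EdgeC →L[ℂ] EdgeL2 :=
  mulL (memLp_ofReal hq) - lam • inclL

theorem potL_ae (hq : MemLp q 2 edgeMeasure) (lam : ℂ) (u : EdgeC) :
    potL hq lam u =ᵐ[edgeMeasure] fun t => ((q t : ℂ) - lam) * ext u t := by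
  have h1 : potL hq lam u = mulL (memLp_ofReal hq) u - lam • inclL u := rfl
  rw [h1]
  filter_upwards [Lp.coeFn_sub (mulL (memLp_ofReal hq) u) (lam • inclL u),
    Lp.coeFn_smul lam (inclL u), mulL_ae (memLp_ofReal hq) u, inclL_ae u] with t h1 h2 h3 h4
  rw [h1, Pi.sub_apply, h2, Pi.smul_apply, h3, h4, smul_eq_mul]
  ring

/-- The Volterra operator of the equation `u'' = (q - lam) u`. -/
def volterraL (hq : MemLp q 2 edgeMeasure) (lam : ℂ) : EdgeC →L[ℂ] EdgeC :=
  primL.comp (inclL.comp (primL.comp (potL hq lam)))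

theorem primL_inclL_apply (u : EdgeC) (t : Set.Icc (0 : ℝ) 1) :
    primL (inclL u) t = ∫ x in (0 : ℝ)..t, ext u x :=
  (primL_apply _ t).trans (integral_congr_edge (inclL_ae u) t.2)

theorem primL_potL_apply (hq : MemLp q 2 edgeMeasure) (lam : ℂ) (u : EdgeC)
    (t : Set.Icc (0 : ℝ) 1) :
    primL (potL hq lam u) t = ∫ x in (0 : ℝ)..t, ((q x : ℂ) - lam) * ext u x :=
  (primL_apply _ t).trans (integral_congr_edge (potL_ae hq lam u) t.2)

theorem memLp_pot (hq : MemLp q 2 edgeMeasure) (lam : ℂ) :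
    MemLp (fun t => (q t : ℂ) - lam) 2 edgeMeasure :=
  (memLp_ofReal hq).sub (memLp_const lam)

/-- The usual Volterra estimate for a potential that is only `L²`. The inner integral against `|q -
lam|` costs the factor `M`; only the outer integration produces the gain `t / (n + 1)`. -/
theorem norm_volterraL_pow_apply_le (hq : MemLp q 2 edgeMeasure) (lam : ℂ) (n : ℕ) (u : EdgeC)
    (t : Set.Icc (0 : ℝ) 1) :
    ‖(volterraL hq lam ^ n) u t‖ ≤
      (eLpNorm (fun t => (q t : ℂ) - lam) 2 edgeMeasure).toReal ^ n * ‖u‖ *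
        ((t : ℝ) ^ n / n.factorial) := by
  set M := (eLpNorm (fun t => (q t : ℂ) - lam) 2 edgeMeasure).toReal with hM
  have hM0 : 0 ≤ M := ENNReal.toReal_nonneg
  induction n generalizing t with
  | zero => simpa using u.norm_coe_le_norm t
  | succ n ih =>
    set v := (volterraL hq lam ^ n) u with hv
    have hstep : (volterraL hq lam ^ (n + 1)) u = volterraL hq lam v := by
      rw [pow_succ']; rfl
    have hm := memLp_pot hq lam
    have hin : ∀ s : Set.Icc (0 : ℝ) 1, ‖primL (potL hq lam v) s‖ ≤
        M * (M ^ n * ‖u‖ * ((s : ℝ) ^ n / n.factorial)) := by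
      intro s
      rw [primL_potL_apply]
      have hii : IntervalIntegrable (fun x => ‖(q x : ℂ) - lam‖) volume 0 s :=
        (memLp_edgeIntervalIntegrable hm s.2).norm
      calc ‖∫ x in (0 : ℝ)..s, ((q x : ℂ) - lam) * ext v x‖
          ≤ ∫ x in (0 : ℝ)..s, ‖(q x : ℂ) - lam‖ *
              (M ^ n * ‖u‖ * ((s : ℝ) ^ n / n.factorial)) := by
            apply intervalIntegral.norm_integral_le_of_norm_le s.2.1
            · refine Filter.Eventually.of_forall fun x hx => ?_
              have hx1 : x ∈ Set.Icc (0 : ℝ) 1 := ⟨hx.1.le, hx.2.trans s.2.2⟩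
              rw [norm_mul, ext_of_mem v hx1]
              refine mul_le_mul_of_nonneg_left ((ih ⟨x, hx1⟩).trans ?_) (norm_nonneg _)
              have := hx.1.le
              have := hx.2
              gcongr
            · exact hii.mul_const _
        _ = (∫ x in (0 : ℝ)..s, ‖(q x : ℂ) - lam‖) *
              (M ^ n * ‖u‖ * ((s : ℝ) ^ n / n.factorial)) :=
            intervalIntegral.integral_mul_const _ _
        _ ≤ _ := by
            have hs := s.2.1
            refine mul_le_mul_of_nonneg_right ?_ (by positivity)
            have h1 := norm_primitive_le (g := fun x => ((‖(q x : ℂ) - lam‖ : ℝ) : ℂ))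
              hm.norm.ofReal s.2
            rw [intervalIntegral.integral_ofReal, Complex.norm_real] at h1
            refine (le_abs_self _).trans (h1.trans (le_of_eq ?_))
            rw [hM]
            congr 1
            refine eLpNorm_congr_norm_ae (Filter.Eventually.of_forall fun x => ?_)
            simp
    rw [hstep]
    change ‖primL (inclL (primL (potL hq lam v))) t‖ ≤ _
    rw [primL_inclL_apply]
    calc ‖∫ x in (0 : ℝ)..t, ext (primL (potL hq lam v)) x‖
        ≤ ∫ x in (0 : ℝ)..t, M * (M ^ n * ‖u‖ * (x ^ n / n.factorial)) := by
          apply intervalIntegral.norm_integral_le_of_norm_le t.2.1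
          · refine Filter.Eventually.of_forall fun x hx => ?_
            have hx1 : x ∈ Set.Icc (0 : ℝ) 1 := ⟨hx.1.le, hx.2.trans t.2.2⟩
            rw [ext_of_mem _ hx1]
            exact hin ⟨x, hx1⟩
          · apply Continuous.intervalIntegrable
            fun_prop
      _ = M ^ (n + 1) * ‖u‖ * ((t : ℝ) ^ (n + 1) / (n + 1).factorial) := by
          simp only [intervalIntegral.integral_const_mul, intervalIntegral.integral_div,
            integral_pow]
          rw [Nat.factorial_succ]
          push_cast
          have : (n.factorial : ℝ) ≠ 0 := by positivity
          field_simp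
          ring

/-- `1 - x ^ n` factors through `1 - x` with a commuting cofactor, so its invertibility passes to `1
- x` although `x` itself need not be a contraction. -/
theorem isUnit_one_sub_of_norm_pow_lt_one {A : Type*} [NormedRing A] [CompleteSpace A] (x : A)
    (n : ℕ) (hlt : ‖x ^ n‖ < 1) : IsUnit (1 - x) := by
  have hu : IsUnit (1 - x ^ n) := isUnit_one_sub_of_norm_lt_one hlt
  have hfac : (∑ i ∈ Finset.range n, x ^ i) * (1 - x) = 1 - x ^ n := geom_sum_mul_neg _ _
  have hcomm : Commute (∑ i ∈ Finset.range n, x ^ i) (1 - x) := by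
    refine Commute.sub_right (Commute.one_right _) (Commute.sum_left _ _ _ fun i _ => ?_)
    exact Commute.pow_left (Commute.refl _) i
  rw [← hfac] at hu
  exact (hcomm.isUnit_mul_iff.1 hu).2

theorem isUnit_one_sub_volterraL (hq : MemLp q 2 edgeMeasure) (lam : ℂ) :
    IsUnit (1 - volterraL hq lam) := by
  set M := (eLpNorm (fun t => (q t : ℂ) - lam) 2 edgeMeasure).toReal with hM
  have hM0 : 0 ≤ M := ENNReal.toReal_nonneg
  obtain ⟨n, hn⟩ : ∃ n : ℕ, M ^ n / n.factorial < 1 :=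
    ((FloorSemiring.tendsto_pow_div_factorial_atTop M).eventually_lt_const one_pos).exists
  have hlt : ‖volterraL hq lam ^ n‖ < 1 := by
    refine lt_of_le_of_lt ?_ hn
    refine ContinuousLinearMap.opNorm_le_bound _ (by positivity) fun u => ?_
    rw [ContinuousMap.norm_le _ (by positivity)]
    intro t
    refine (norm_volterraL_pow_apply_le hq lam n u t).trans ?_
    have h1 : (t : ℝ) ^ n ≤ 1 := pow_le_one₀ t.2.1 t.2.2
    have h2 : (t : ℝ) ^ n / n.factorial ≤ 1 / n.factorial := by gcongr
    calc M ^ n * ‖u‖ * ((t : ℝ) ^ n / n.factorial) ≤ M ^ n * ‖u‖ * (1 / n.factorial) := by gcongr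
      _ = _ := by ring
  exact isUnit_one_sub_of_norm_pow_lt_one (A := EdgeC →L[ℂ] EdgeC) _ n hlt

end

section

variable {q : ℝ → ℝ}

/-! ### Solutions of the inhomogeneous equation on one edge -/

/-- The inverse of `1 - volterraL`. -/
def solInv (hq : MemLp q 2 edgeMeasure) (lam : ℂ) : EdgeC →L[ℂ] EdgeC :=
  Ring.inverse (1 - volterraL hq lam)

theorem solInv_sub (hq : MemLp q 2 edgeMeasure) (lam : ℂ) (u : EdgeC) :
    solInv hq lam (u - volterraL hq lam u) = u := by
  have h := Ring.inverse_mul_cancel _ (isUnit_one_sub_volterraL hq lam)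
  exact congrArg (fun A : EdgeC →L[ℂ] EdgeC => A u) h

theorem solInv_eq (hq : MemLp q 2 edgeMeasure) (lam : ℂ) (u : EdgeC) :
    solInv hq lam u = u + volterraL hq lam (solInv hq lam u) := by
  have h := Ring.mul_inverse_cancel _ (isUnit_one_sub_volterraL hq lam)
  have h2 : solInv hq lam u - volterraL hq lam (solInv hq lam u) = u :=
    congrArg (fun A : EdgeC →L[ℂ] EdgeC => A u) h
  rw [sub_eq_iff_eq_add] at h2
  exact h2

/-- The Volterra operator is affine in `lam`; together with differentiability of inversion this
makes the solution operator entire in `lam`. -/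
theorem volterraL_eq (hq : MemLp q 2 edgeMeasure) (lam : ℂ) :
    volterraL hq lam = volterraL hq 0 - lam • primL.comp (inclL.comp (primL.comp inclL)) := by
  ext1 u
  simp [volterraL, potL]

theorem differentiable_ring_inverse {A : Type*} [NormedRing A] [NormedAlgebra ℂ A]
    [CompleteSpace A] (f : ℂ → A) (hf : Differentiable ℂ f) (hu : ∀ z, IsUnit (f z)) :
    Differentiable ℂ fun z => Ring.inverse (f z) := by
  intro z
  obtain ⟨v, hv⟩ := hu z
  have h1 : DifferentiableAt ℂ (Ring.inverse : A → A) (f z) := by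
    rw [← hv]
    exact differentiableAt_inverse v.isUnit
  exact h1.comp z (hf z)

theorem differentiable_sub_smul {V : Type*} [NormedAddCommGroup V] [NormedSpace ℂ V] (A B : V) :
    Differentiable ℂ fun z : ℂ => A - z • B := by fun_prop

theorem differentiable_sub_sub_smul {V : Type*} [NormedAddCommGroup V] [NormedSpace ℂ V]
    (C A B : V) : Differentiable ℂ fun z : ℂ => C - (A - z • B) := by fun_prop

theorem differentiable_solInv (hq : MemLp q 2 edgeMeasure) : Differentiable ℂ (solInv hq) := by
  refine differentiable_ring_inverse (A := EdgeC →L[ℂ] EdgeC) (fun lam => 1 - volterraL hq lam)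
    ?_ (isUnit_one_sub_volterraL hq)
  have h : Differentiable ℂ fun lam : ℂ => (1 : EdgeC →L[ℂ] EdgeC) - (volterraL hq 0 -
      lam • primL.comp (inclL.comp (primL.comp inclL))) :=
    differentiable_sub_sub_smul (1 : EdgeC →L[ℂ] EdgeC) _ _
  exact (funext fun lam => congrArg (1 - ·) (volterraL_eq hq lam)) ▸ h

/-- Constant functions. -/
def constL : ℂ →L[ℂ] EdgeC := ContinuousLinearMap.toSpanSingleton ℂ (1 : EdgeC)

@[simp] theorem constL_apply (c : ℂ) (t : Set.Icc (0 : ℝ) 1) : constL c t = c := by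
  simp [constL, ContinuousLinearMap.toSpanSingleton_apply]

/-- The solution `u` of `-u'' + q u - lam u = g`, `u 0 = α`, `u' 0 = β`, as a function of
`(α, β, g)`. -/
def edgeSol (hq : MemLp q 2 edgeMeasure) (lam : ℂ) : (ℂ × ℂ × EdgeL2) →L[ℂ] EdgeC :=
  (solInv hq lam).comp
    (constL.comp (.fst ℂ ℂ (ℂ × EdgeL2)) +
      (primL.comp inclL).comp
        (constL.comp ((ContinuousLinearMap.fst ℂ ℂ EdgeL2).comp (.snd ℂ ℂ (ℂ × EdgeL2))) -
          primL.comp ((ContinuousLinearMap.snd ℂ ℂ EdgeL2).comp (.snd ℂ ℂ (ℂ × EdgeL2)))))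

/-- The derivative of `edgeSol`. -/
def edgeSol' (hq : MemLp q 2 edgeMeasure) (lam : ℂ) : (ℂ × ℂ × EdgeL2) →L[ℂ] EdgeC :=
  constL.comp ((ContinuousLinearMap.fst ℂ ℂ EdgeL2).comp (.snd ℂ ℂ (ℂ × EdgeL2))) +
    primL.comp ((potL hq lam).comp (edgeSol hq lam) -
      ((ContinuousLinearMap.snd ℂ ℂ EdgeL2).comp (.snd ℂ ℂ (ℂ × EdgeL2))))

theorem edgeSol_apply (hq : MemLp q 2 edgeMeasure) (lam α β : ℂ) (g : EdgeL2) :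
    edgeSol hq lam (α, β, g) =
      solInv hq lam (constL α + primL (inclL (constL β - primL g))) := rfl

theorem edgeSol'_apply (hq : MemLp q 2 edgeMeasure) (lam α β : ℂ) (g : EdgeL2) :
    edgeSol' hq lam (α, β, g) =
      constL β + primL (potL hq lam (edgeSol hq lam (α, β, g)) - g) := rfl

theorem edgeSol_eq (hq : MemLp q 2 edgeMeasure) (lam α β : ℂ) (g : EdgeL2) :
    edgeSol hq lam (α, β, g) = constL α + primL (inclL (edgeSol' hq lam (α, β, g))) := by
  have h := solInv_eq hq lam (constL α + primL (inclL (constL β - primL g)))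
  rw [← edgeSol_apply] at h
  rw [edgeSol'_apply]
  nth_rw 1 [h]
  simp only [volterraL, ContinuousLinearMap.comp_apply, map_sub, map_add]
  abel

theorem hasDerivWithinAt_primL (c : ℂ) (v : EdgeC) {t : ℝ} (ht : t ∈ Set.Icc (0 : ℝ) 1) :
    HasDerivWithinAt (ext (constL c + primL (inclL v))) (ext v t) (Set.Icc 0 1) t := by
  have h1 : HasDerivAt (fun t => c + ∫ x in (0 : ℝ)..t, ext v x) (ext v t) t :=
    ((continuous_ext v).integral_hasStrictDerivAt 0 t).hasDerivAt.const_add c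
  refine h1.hasDerivWithinAt.congr (fun s hs => ?_) ?_
  · rw [ext_of_mem _ hs, ContinuousMap.add_apply, constL_apply, primL_inclL_apply]
  · rw [ext_of_mem _ ht, ContinuousMap.add_apply, constL_apply, primL_inclL_apply]

theorem isW2_of_eq {u v : EdgeC} {c b : ℂ} {w : EdgeL2} (hu : u = constL c + primL (inclL v))
    (hv : v = constL b + primL w) : IsW2 (ext u) (ext v) w := by
  refine ⟨fun t ht => hu ▸ hasDerivWithinAt_primL c v ht, Lp.memLp w, fun t ht => ?_⟩
  rw [ext_of_mem _ ht, ext_of_mem _ (Set.left_mem_Icc.2 zero_le_one), hv]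
  simp [primL_apply]

theorem isW2_edgeSol (hq : MemLp q 2 edgeMeasure) (lam α β : ℂ) (g : EdgeL2) :
    IsW2 (ext (edgeSol hq lam (α, β, g))) (ext (edgeSol' hq lam (α, β, g)))
      (potL hq lam (edgeSol hq lam (α, β, g)) - g : EdgeL2) :=
  isW2_of_eq (edgeSol_eq hq lam α β g) (edgeSol'_apply hq lam α β g)

@[simp] theorem edgeSol_zero (hq : MemLp q 2 edgeMeasure) (lam α β : ℂ) (g : EdgeL2) :
    ext (edgeSol hq lam (α, β, g)) 0 = α := by
  rw [ext_of_mem _ (Set.left_mem_Icc.2 zero_le_one), edgeSol_eq]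
  simp [primL_apply]

@[simp] theorem edgeSol'_zero (hq : MemLp q 2 edgeMeasure) (lam α β : ℂ) (g : EdgeL2) :
    ext (edgeSol' hq lam (α, β, g)) 0 = β := by
  rw [ext_of_mem _ (Set.left_mem_Icc.2 zero_le_one), edgeSol'_apply]
  simp [primL_apply]

theorem IsW2.continuousOn {u u' w : ℝ → ℂ} (h : IsW2 u u' w) :
    ContinuousOn u (Set.Icc 0 1) := fun t ht => (h.deriv_eq t ht).continuousWithinAt

theorem IsW2.continuousOn' {u u' w : ℝ → ℂ} (h : IsW2 u u' w) :
    ContinuousOn u' (Set.Icc 0 1) :=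
  (continuousOn_const.add (continuousOn_primitive h.memLp)).congr h.integral_eq

/-- The restriction of a `W²` function to `[0,1]`. -/
def toEdgeC (u : ℝ → ℂ) (hu : ContinuousOn u (Set.Icc 0 1)) : EdgeC :=
  ⟨fun t => u t, hu.domRestrict⟩

theorem ext_toEdgeC {u : ℝ → ℂ} (hu : ContinuousOn u (Set.Icc 0 1)) {t : ℝ}
    (ht : t ∈ Set.Icc (0 : ℝ) 1) : ext (toEdgeC u hu) t = u t := by
  rw [ext_of_mem _ ht]; rfl

theorem integral_deriv_edge {u u' : ℝ → ℂ}
    (h : ∀ t ∈ Set.Icc (0 : ℝ) 1, HasDerivWithinAt u (u' t) (Set.Icc 0 1) t)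
    (h' : ContinuousOn u' (Set.Icc 0 1)) {t : ℝ} (ht : t ∈ Set.Icc (0 : ℝ) 1) :
    u t = u 0 + ∫ x in (0 : ℝ)..t, u' x := by
  have hsub : Set.Icc 0 t ⊆ Set.Icc (0 : ℝ) 1 := Set.Icc_subset_Icc_right ht.2
  rw [intervalIntegral.integral_eq_sub_of_hasDeriv_right_of_le ht.1
    (f := u)]
  · ring
  · exact fun s hs => (h s (hsub hs)).continuousWithinAt.mono hsub
  · intro s hs
    have hs1 : s ∈ Set.Ioo (0 : ℝ) 1 := ⟨hs.1, hs.2.trans_le ht.2⟩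
    exact ((h s ⟨hs1.1.le, hs1.2.le⟩).hasDerivAt (Icc_mem_nhds hs1.1 hs1.2)).hasDerivWithinAt
  · apply ContinuousOn.intervalIntegrable
    rw [Set.uIcc_of_le ht.1]
    exact h'.mono hsub

/-- Every `W²` solution of the inhomogeneous equation is given by `edgeSol`. -/
theorem IsW2.eq_edgeSol (hq : MemLp q 2 edgeMeasure) (lam : ℂ) {u u' w : ℝ → ℂ}
    (h : IsW2 u u' w) (g : EdgeL2)
    (hw : w =ᵐ[edgeMeasure] fun t => ((q t : ℂ) - lam) * u t - g t) :
    ∀ t ∈ Set.Icc (0 : ℝ) 1, u t = ext (edgeSol hq lam (u 0, u' 0, g)) t ∧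
      u' t = ext (edgeSol' hq lam (u 0, u' 0, g)) t := by
  set U := toEdgeC u h.continuousOn with hU
  set V := toEdgeC u' h.continuousOn' with hV
  have hw2 : h.memLp.toLp = potL hq lam U - g := by
    rw [Lp.ext_iff]
    filter_upwards [h.memLp.coeFn_toLp, hw, Lp.coeFn_sub (potL hq lam U) g, potL_ae hq lam U,
      ae_mem_Icc] with t h1 h2 h3 h4 h5
    rw [h1, h2, h3, Pi.sub_apply, h4, hU, ext_toEdgeC _ h5]
  have hVeq : V = constL (u' 0) + primL (potL hq lam U - g) := by
    ext t
    rw [← hw2, ContinuousMap.add_apply, constL_apply, primL_apply,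
      integral_congr_edge h.memLp.coeFn_toLp t.2]
    exact h.integral_eq t t.2
  have hUeq : U = constL (u 0) + primL (inclL V) := by
    ext t
    rw [ContinuousMap.add_apply, constL_apply, primL_inclL_apply]
    change u t = _
    rw [integral_deriv_edge h.deriv_eq h.continuousOn' t.2]
    congr 1
    apply intervalIntegral.integral_congr
    intro x hx
    rw [Set.uIcc_of_le t.2.1] at hx
    exact (ext_toEdgeC _ ⟨hx.1, hx.2.trans t.2.2⟩).symm
  -- Integrating the equation twice shows that `U` minus its Volterra image is exactly the data term
  -- to which `solInv` is applied in `edgeSol`.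
  have hsol : U = edgeSol hq lam (u 0, u' 0, g) := by
    rw [edgeSol_apply, ← solInv_sub hq lam U]
    congr 1
    nth_rw 1 [hUeq]
    rw [hVeq]
    simp only [volterraL, ContinuousLinearMap.comp_apply, map_sub, map_add]
    abel
  have hsol' : V = edgeSol' hq lam (u 0, u' 0, g) := by
    rw [edgeSol'_apply, ← hsol, hVeq]
  intro t ht
  rw [← hsol, ← hsol', ext_toEdgeC _ ht, ext_toEdgeC _ ht]
  exact ⟨rfl, rfl⟩

theorem memLp_pot_mul (hq : MemLp q 2 edgeMeasure) (lam : ℂ) {u : ℝ → ℂ}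
    (hu : ContinuousOn u (Set.Icc 0 1)) :
    MemLp (fun t => ((q t : ℂ) - lam) * u t) 2 edgeMeasure := by
  refine (memLp_congr_ae ?_).1 (memLp_mul_ext (memLp_pot hq lam) (toEdgeC u hu))
  filter_upwards [ae_mem_Icc] with t ht
  rw [ext_toEdgeC _ ht]

theorem IsSolution.isW2 (hq : MemLp q 2 edgeMeasure) {lam : ℂ} {u u' : ℝ → ℂ}
    (h : IsSolution q lam u u') : IsW2 u u' fun t => ((q t : ℂ) - lam) * u t :=
  ⟨h.deriv_eq, memLp_pot_mul hq lam fun t ht => (h.deriv_eq t ht).continuousWithinAt,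
    h.integral_eq⟩

theorem IsW2.isSolution {lam : ℂ} {u u' w : ℝ → ℂ} (h : IsW2 u u' w)
    (hw : w =ᵐ[edgeMeasure] fun t => ((q t : ℂ) - lam) * u t) : IsSolution q lam u u' :=
  ⟨h.deriv_eq, fun t ht => (h.integral_eq t ht).trans (by rw [integral_congr_edge hw ht])⟩

theorem isSolution_edgeSol (hq : MemLp q 2 edgeMeasure) (lam α β : ℂ) :
    IsSolution q lam (ext (edgeSol hq lam (α, β, 0))) (ext (edgeSol' hq lam (α, β, 0))) := by
  refine (isW2_edgeSol hq lam α β 0).isSolution ?_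
  rw [sub_zero]
  exact potL_ae hq lam _

theorem IsSolution.eq_edgeSol (hq : MemLp q 2 edgeMeasure) {lam : ℂ} {u u' : ℝ → ℂ}
    (h : IsSolution q lam u u') : ∀ t ∈ Set.Icc (0 : ℝ) 1,
      u t = ext (edgeSol hq lam (u 0, u' 0, 0)) t ∧
      u' t = ext (edgeSol' hq lam (u 0, u' 0, 0)) t := by
  refine (h.isW2 hq).eq_edgeSol hq lam 0 ?_
  filter_upwards [Lp.coeFn_zero ℂ 2 edgeMeasure] with t ht
  rw [ht]
  simp

theorem one_mem_Icc : (1 : ℝ) ∈ Set.Icc (0 : ℝ) 1 := Set.right_mem_Icc.2 zero_le_one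

theorem zero_mem_Icc : (0 : ℝ) ∈ Set.Icc (0 : ℝ) 1 := Set.left_mem_Icc.2 zero_le_one

theorem ivp_spec (hq : MemLp q 2 edgeMeasure) (lam α β : ℂ) :
    IsSolution q lam (ivp q lam α β).1 (ivp q lam α β).2 ∧
      (ivp q lam α β).1 0 = α ∧ (ivp q lam α β).2 0 = β :=
  Classical.epsilon_spec
    (p := fun p : (ℝ → ℂ) × (ℝ → ℂ) => IsSolution q lam p.1 p.2 ∧ p.1 0 = α ∧ p.2 0 = β)
    ⟨(ext (edgeSol hq lam (α, β, 0)), ext (edgeSol' hq lam (α, β, 0))),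
      isSolution_edgeSol hq lam α β, edgeSol_zero hq lam α β 0, edgeSol'_zero hq lam α β 0⟩

/-- `ivp` is an arbitrary choice off `[0,1]`, but uniqueness fixes its values at `1`, which are the
only ones used later. -/
theorem ivp_one (hq : MemLp q 2 edgeMeasure) (lam α β : ℂ) :
    (ivp q lam α β).1 1 = ext (edgeSol hq lam (α, β, 0)) 1 ∧
      (ivp q lam α β).2 1 = ext (edgeSol' hq lam (α, β, 0)) 1 := by
  obtain ⟨h1, h2, h3⟩ := ivp_spec hq lam α β
  have := h1.eq_edgeSol hq 1 one_mem_Icc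
  rwa [h2, h3] at this

theorem theta1_eq (hq : MemLp q 2 edgeMeasure) (lam : ℂ) :
    theta1 q lam = ext (edgeSol hq lam (1, 0, 0)) 1 := (ivp_one hq lam 1 0).1

theorem theta1'_eq (hq : MemLp q 2 edgeMeasure) (lam : ℂ) :
    theta1' q lam = ext (edgeSol' hq lam (1, 0, 0)) 1 := (ivp_one hq lam 1 0).2

theorem phi1_eq (hq : MemLp q 2 edgeMeasure) (lam : ℂ) :
    phi1 q lam = ext (edgeSol hq lam (0, 1, 0)) 1 := (ivp_one hq lam 0 1).1

theorem phi1'_eq (hq : MemLp q 2 edgeMeasure) (lam : ℂ) :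
    phi1' q lam = ext (edgeSol' hq lam (0, 1, 0)) 1 := (ivp_one hq lam 0 1).2

theorem data_decomp (α β : ℂ) (g : EdgeL2) :
    ((α, β, g) : ℂ × ℂ × EdgeL2) =
      α • ((1, 0, 0) : ℂ × ℂ × EdgeL2) + β • ((0, 1, 0) : ℂ × ℂ × EdgeL2) + (0, 0, g) := by
  simp

theorem ext_smul (c : ℂ) (u : EdgeC) (t : ℝ) : ext (c • u) t = c * ext u t := rfl

theorem edgeSol_decomp (hq : MemLp q 2 edgeMeasure) (lam α β : ℂ) (g : EdgeL2) (t : ℝ) :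
    ext (edgeSol hq lam (α, β, g)) t =
      α * ext (edgeSol hq lam (1, 0, 0)) t + β * ext (edgeSol hq lam (0, 1, 0)) t +
        ext (edgeSol hq lam (0, 0, g)) t := by
  conv_lhs => rw [data_decomp, map_add, map_add, map_smul, map_smul]
  rfl

theorem edgeSol'_decomp (hq : MemLp q 2 edgeMeasure) (lam α β : ℂ) (g : EdgeL2) (t : ℝ) :
    ext (edgeSol' hq lam (α, β, g)) t =
      α * ext (edgeSol' hq lam (1, 0, 0)) t + β * ext (edgeSol' hq lam (0, 1, 0)) t +
        ext (edgeSol' hq lam (0, 0, g)) t := by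
  conv_lhs => rw [data_decomp, map_add, map_add, map_smul, map_smul]
  rfl

theorem edgeSol_one (hq : MemLp q 2 edgeMeasure) (lam α β : ℂ) (g : EdgeL2) :
    ext (edgeSol hq lam (α, β, g)) 1 =
      α * theta1 q lam + β * phi1 q lam + ext (edgeSol hq lam (0, 0, g)) 1 := by
  rw [edgeSol_decomp, theta1_eq hq, phi1_eq hq]

theorem edgeSol'_one (hq : MemLp q 2 edgeMeasure) (lam α β : ℂ) (g : EdgeL2) :
    ext (edgeSol' hq lam (α, β, g)) 1 =
      α * theta1' q lam + β * phi1' q lam + ext (edgeSol' hq lam (0, 0, g)) 1 := by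
  rw [edgeSol'_decomp, theta1'_eq hq, phi1'_eq hq]

theorem ext_zero (t : ℝ) : ext 0 t = 0 := rfl

theorem edgeSol_hom_one (hq : MemLp q 2 edgeMeasure) (lam α β : ℂ) :
    ext (edgeSol hq lam (α, β, 0)) 1 = α * theta1 q lam + β * phi1 q lam := by
  rw [edgeSol_one]
  have : ((0, 0, 0) : ℂ × ℂ × EdgeL2) = 0 := rfl
  rw [this, map_zero, ext_zero, add_zero]

theorem edgeSol'_hom_one (hq : MemLp q 2 edgeMeasure) (lam α β : ℂ) :
    ext (edgeSol' hq lam (α, β, 0)) 1 = α * theta1' q lam + β * phi1' q lam := by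
  rw [edgeSol'_one]
  have : ((0, 0, 0) : ℂ × ℂ × EdgeL2) = 0 := rfl
  rw [this, map_zero, ext_zero, add_zero]

/-- Endpoint values of a solution. -/
theorem IsSolution.at_one (hq : MemLp q 2 edgeMeasure) {lam : ℂ} {u u' : ℝ → ℂ}
    (h : IsSolution q lam u u') :
    u 1 = u 0 * theta1 q lam + u' 0 * phi1 q lam ∧
      u' 1 = u 0 * theta1' q lam + u' 0 * phi1' q lam := by
  rw [← edgeSol_hom_one hq, ← edgeSol'_hom_one hq]
  exact h.eq_edgeSol hq 1 one_mem_Icc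

/-! ### Dependence on the spectral parameter -/

theorem differentiable_edgeSol (hq : MemLp q 2 edgeMeasure) (α β : ℂ) (g : EdgeL2) :
    Differentiable ℂ fun lam => edgeSol hq lam (α, β, g) := by
  simp only [edgeSol_apply]
  exact (differentiable_solInv hq).clm_apply (differentiable_const _)

theorem differentiable_edgeSol' (hq : MemLp q 2 edgeMeasure) (α β : ℂ) (g : EdgeL2) :
    Differentiable ℂ fun lam => edgeSol' hq lam (α, β, g) := by
  simp only [edgeSol'_apply]
  have h1 : Differentiable ℂ fun lam : ℂ => mulL (memLp_ofReal hq) - lam • inclL :=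
    differentiable_sub_smul (V := EdgeC →L[ℂ] EdgeL2) _ _
  have h2 := h1.clm_apply (differentiable_edgeSol hq α β g)
  exact (differentiable_const _).add (primL.differentiable.comp (h2.sub (differentiable_const _)))

/-- Evaluation at a point. -/
def evalL (t : Set.Icc (0 : ℝ) 1) : EdgeC →L[ℂ] ℂ := ContinuousMap.evalCLM ℂ t

theorem differentiable_theta1 (hq : MemLp q 2 edgeMeasure) : Differentiable ℂ (theta1 q) := by
  have : theta1 q = fun lam => evalL ⟨1, one_mem_Icc⟩ (edgeSol hq lam (1, 0, 0)) := by
    funext lam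
    rw [theta1_eq hq, ext_of_mem _ one_mem_Icc]
    rfl
  rw [this]
  exact (evalL _).differentiable.comp (differentiable_edgeSol hq 1 0 0)

theorem differentiable_phi1 (hq : MemLp q 2 edgeMeasure) : Differentiable ℂ (phi1 q) := by
  have : phi1 q = fun lam => evalL ⟨1, one_mem_Icc⟩ (edgeSol hq lam (0, 1, 0)) := by
    funext lam
    rw [phi1_eq hq, ext_of_mem _ one_mem_Icc]
    rfl
  rw [this]
  exact (evalL _).differentiable.comp (differentiable_edgeSol hq 0 1 0)

theorem differentiable_theta1' (hq : MemLp q 2 edgeMeasure) : Differentiable ℂ (theta1' q) := by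
  have : theta1' q = fun lam => evalL ⟨1, one_mem_Icc⟩ (edgeSol' hq lam (1, 0, 0)) := by
    funext lam
    rw [theta1'_eq hq, ext_of_mem _ one_mem_Icc]
    rfl
  rw [this]
  exact (evalL _).differentiable.comp (differentiable_edgeSol' hq 1 0 0)

theorem differentiable_phi1' (hq : MemLp q 2 edgeMeasure) : Differentiable ℂ (phi1' q) := by
  have : phi1' q = fun lam => evalL ⟨1, one_mem_Icc⟩ (edgeSol' hq lam (0, 1, 0)) := by
    funext lam
    rw [phi1'_eq hq, ext_of_mem _ one_mem_Icc]
    rfl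
  rw [this]
  exact (evalL _).differentiable.comp (differentiable_edgeSol' hq 0 1 0)

theorem differentiable_bigF (hq : MemLp q 2 edgeMeasure) : Differentiable ℂ (bigF q) := by
  have h1 := differentiable_theta1 hq
  have h2 := differentiable_phi1 hq
  have h3 := differentiable_theta1' hq
  have h4 := differentiable_phi1' hq
  unfold bigF hillDelta
  fun_prop

end

section

variable {q : ℝ → ℝ}

/-! ### Green's identity -/

/-- Increments of `f` are dominated by those of the primitive of `‖g‖`, which is absolutely
continuous, so the same `δ` serves. -/
theorem absolutelyContinuous_of_sub_eq_integral {f g : ℝ → ℂ}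
    (hg : IntervalIntegrable g volume 0 1)
    (h : ∀ t ∈ Set.Icc (0 : ℝ) 1, f t = f 0 + ∫ x in (0 : ℝ)..t, g x) :
    AbsolutelyContinuousOnInterval f 0 1 := by
  have hG := hg.norm.absolutelyContinuousOnInterval_intervalIntegral
    (c := 0) (by rw [Set.uIcc_of_le zero_le_one]; exact zero_mem_Icc)
  have hsub : ∀ x ∈ Set.Icc (0 : ℝ) 1, IntervalIntegrable g volume 0 x := fun x hx =>
    hg.mono_set (by
      rw [Set.uIcc_of_le zero_le_one, Set.uIcc_of_le hx.1]
      exact Set.Icc_subset_Icc_right hx.2)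
  rw [absolutelyContinuousOnInterval_iff] at hG ⊢
  intro ε hε
  obtain ⟨δ, hδ, H⟩ := hG ε hε
  refine ⟨δ, hδ, fun E hE hlt => lt_of_le_of_lt ?_ (H E hE hlt)⟩
  refine Finset.sum_le_sum fun i hi => ?_
  have h1 := hE.1 i hi
  rw [Set.uIcc_of_le zero_le_one] at h1
  obtain ⟨h1, h2⟩ := h1
  rw [dist_eq_norm, dist_eq_norm, h _ h1, h _ h2]
  have e1 : (f 0 + ∫ x in (0 : ℝ)..(E.2 i).1, g x) - (f 0 + ∫ x in (0 : ℝ)..(E.2 i).2, g x) =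
      ∫ x in (E.2 i).2..(E.2 i).1, g x := by
    rw [← intervalIntegral.integral_interval_sub_left (hsub _ h1) (hsub _ h2)]
    ring
  rw [e1, intervalIntegral.integral_interval_sub_left (hsub _ h1).norm (hsub _ h2).norm]
  exact intervalIntegral.norm_integral_le_abs_integral_norm

/-- Integration by parts when `v` is only absolutely continuous: `u v` minus the primitive of the
integrand is absolutely continuous with derivative zero almost everywhere, hence constant. -/
theorem integral_add_mul_eq {u u' v z : ℝ → ℂ}
    (h : ∀ t ∈ Set.Icc (0 : ℝ) 1, HasDerivWithinAt u (u' t) (Set.Icc 0 1) t)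
    (h' : ContinuousOn u' (Set.Icc 0 1)) (hz : MemLp z 2 edgeMeasure)
    (hv : ∀ t ∈ Set.Icc (0 : ℝ) 1, v t = v 0 + ∫ x in (0 : ℝ)..t, z x) :
    ∫ t in (0 : ℝ)..1, (u' t * v t + u t * z t) = u 1 * v 1 - u 0 * v 0 := by
  have hu : ContinuousOn u (Set.Icc 0 1) := fun t ht => (h t ht).continuousWithinAt
  have hvc : ContinuousOn v (Set.Icc 0 1) :=
    (continuousOn_const.add (continuousOn_primitive hz)).congr hv
  have hzi := memLp_edgeIntervalIntegrable hz one_mem_Icc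
  have hu'i : IntervalIntegrable u' volume 0 1 :=
    ContinuousOn.intervalIntegrable (by rwa [Set.uIcc_of_le zero_le_one])
  have hi : IntervalIntegrable (fun t => u' t * v t + u t * z t) volume 0 1 := by
    refine IntervalIntegrable.add ?_ ?_
    · apply ContinuousOn.intervalIntegrable
      rw [Set.uIcc_of_le zero_le_one]
      exact h'.mul hvc
    · exact hzi.continuousOn_mul (by rwa [Set.uIcc_of_le zero_le_one])
  have acu := absolutelyContinuous_of_sub_eq_integral hu'i fun t ht => integral_deriv_edge h h' ht
  have acv := absolutelyContinuous_of_sub_eq_integral hzi hv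
  have aci := absolutelyContinuous_of_sub_eq_integral
    (f := fun t => ∫ x in (0 : ℝ)..t, (u' x * v x + u x * z x)) hi (by simp)
  have ac := (acu.smul acv).sub aci
  have hd := ac.const_of_ae_hasDerivAt_zero (by
    have hne : ∀ᵐ x : ℝ, x ∉ ({0, 1} : Set ℝ) :=
      measure_eq_zero_iff_ae_notMem.1 ((Set.toFinite _).measure_zero _)
    filter_upwards [hzi.ae_hasDerivAt_integral, hi.ae_hasDerivAt_integral, hne]
      with x h1 h2 h3 hx
    have hm0 : (0 : ℝ) ∈ Set.uIcc (0 : ℝ) 1 := Set.left_mem_uIcc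
    have h1 := h1 hx 0 hm0
    have h2 := h2 hx 0 hm0
    rw [Set.uIcc_of_le zero_le_one] at hx
    simp only [Set.mem_insert_iff, Set.mem_singleton_iff, not_or] at h3
    have hn : Set.Icc (0 : ℝ) 1 ∈ 𝓝 x :=
      Icc_mem_nhds (lt_of_le_of_ne hx.1 (Ne.symm h3.1)) (lt_of_le_of_ne hx.2 h3.2)
    have hdu : HasDerivAt u (u' x) x := (h x hx).hasDerivAt hn
    have hdv : HasDerivAt v (z x) x := by
      refine (h1.const_add (v 0)).congr_of_eventuallyEq ?_
      filter_upwards [hn] with t ht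
      exact hv t ht
    have := (hdu.mul hdv).sub h2
    rw [sub_self] at this
    exact this)
  obtain ⟨C, hC⟩ := hd
  have e0 := hC 0 Set.left_mem_uIcc
  have e1 := hC 1 Set.right_mem_uIcc
  simp only [Pi.sub_apply, smul_eq_mul, intervalIntegral.integral_same,
    sub_zero] at e0 e1
  have e0 : u 0 * v 0 = C := e0
  have e1 : u 1 * v 1 - (∫ t in (0 : ℝ)..1, (u' t * v t + u t * z t)) = C := e1
  linear_combination e0 - e1

theorem IsW2.intervalIntegrable_mul {u u' w v v' z : ℝ → ℂ} (h : IsW2 u u' w)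
    (h₂ : IsW2 v v' z) : IntervalIntegrable (fun t => u t * z t) volume 0 1 :=
  (memLp_edgeIntervalIntegrable h₂.memLp one_mem_Icc).continuousOn_mul
    (by rw [Set.uIcc_of_le zero_le_one]; exact h.continuousOn)

/-- Green's identity on an edge. -/
theorem IsW2.green {u u' w v v' z : ℝ → ℂ} (h : IsW2 u u' w) (h₂ : IsW2 v v' z) :
    ∫ t in (0 : ℝ)..1, (u t * z t - v t * w t) =
      (u 1 * v' 1 - u' 1 * v 1) - (u 0 * v' 0 - u' 0 * v 0) := by
  have e1 := integral_add_mul_eq h.deriv_eq h.continuousOn' h₂.memLp h₂.integral_eq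
  have e2 := integral_add_mul_eq h₂.deriv_eq h₂.continuousOn' h.memLp h.integral_eq
  have c : IntervalIntegrable (fun t => u' t * v' t) volume 0 1 := by
    apply ContinuousOn.intervalIntegrable
    rw [Set.uIcc_of_le zero_le_one]
    exact h.continuousOn'.mul h₂.continuousOn'
  have c' : IntervalIntegrable (fun t => v' t * u' t) volume 0 1 := by
    simpa only [mul_comm] using c
  have i1 := h.intervalIntegrable_mul h₂
  have i2 := h₂.intervalIntegrable_mul h
  rw [intervalIntegral.integral_add c i1] at e1
  rw [intervalIntegral.integral_add c' i2] at e2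
  have e3 : ∫ t in (0 : ℝ)..1, v' t * u' t = ∫ t in (0 : ℝ)..1, u' t * v' t := by
    simp only [mul_comm]
  rw [intervalIntegral.integral_sub i1 i2]
  linear_combination e1 - e2 + e3

theorem intervalIntegral_conj (f : ℝ → ℂ) (a b : ℝ) :
    ∫ x in a..b, (starRingEnd ℂ) (f x) = (starRingEnd ℂ) (∫ x in a..b, f x) := by
  simp only [intervalIntegral, integral_conj, map_sub]

theorem IsW2.conj {u u' w : ℝ → ℂ} (h : IsW2 u u' w) :
    IsW2 (fun t => (starRingEnd ℂ) (u t)) (fun t => (starRingEnd ℂ) (u' t))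
      (fun t => (starRingEnd ℂ) (w t)) := by
  refine ⟨fun t ht => (h.deriv_eq t ht).star, h.memLp.star, fun t ht => ?_⟩
  rw [intervalIntegral_conj, h.integral_eq t ht, map_add]

theorem IsSolution.conj {lam : ℂ} {u u' : ℝ → ℂ} (h : IsSolution q lam u u') :
    IsSolution q ((starRingEnd ℂ) lam) (fun t => (starRingEnd ℂ) (u t))
      (fun t => (starRingEnd ℂ) (u' t)) := by
  refine ⟨fun t ht => (h.deriv_eq t ht).star, fun t ht => ?_⟩
  rw [h.integral_eq t ht, map_add, ← intervalIntegral_conj]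
  simp

/-- The Wronskian of `ϑ`, `φ` is one. -/
theorem wronskian (hq : MemLp q 2 edgeMeasure) (lam : ℂ) :
    theta1 q lam * phi1' q lam - theta1' q lam * phi1 q lam = 1 := by
  obtain ⟨h1, h2, h3⟩ := ivp_spec hq lam 1 0
  obtain ⟨k1, k2, k3⟩ := ivp_spec hq lam 0 1
  have h := (h1.isW2 hq).green (k1.isW2 hq)
  have e : ∀ t, (ivp q lam 1 0).1 t * (((q t : ℂ) - lam) * (ivp q lam 0 1).1 t) -
      (ivp q lam 0 1).1 t * (((q t : ℂ) - lam) * (ivp q lam 1 0).1 t) = 0 := fun t => by ring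
  simp only [e, intervalIntegral.integral_zero, h2, h3, k2, k3] at h
  simp only [theta1, phi1, theta1', phi1']
  linear_combination -h

/-- The potential, `lam` and the initial data are real, so the conjugate of the solution solves the
same initial value problem. -/
theorem ivp_real (hq : MemLp q 2 edgeMeasure) (lam α β : ℝ) :
    (starRingEnd ℂ) ((ivp q lam α β).1 1) = (ivp q lam α β).1 1 ∧
      (starRingEnd ℂ) ((ivp q lam α β).2 1) = (ivp q lam α β).2 1 := by
  obtain ⟨h1, h2, h3⟩ := ivp_spec hq lam α β
  have h4 := h1.conj
  rw [Complex.conj_ofReal] at h4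
  have h5 := h4.at_one hq
  have h6 := h1.at_one hq
  simp only [h2, h3, Complex.conj_ofReal] at h5 h6
  exact ⟨h5.1.trans h6.1.symm, h5.2.trans h6.2.symm⟩

theorem theta1_real (hq : MemLp q 2 edgeMeasure) (lam : ℝ) :
    ∃ x : ℝ, theta1 q lam = x := by
  have := (ivp_real hq lam 1 0).1
  rw [Complex.conj_eq_iff_real] at this
  simpa [theta1] using this

theorem theta1'_real (hq : MemLp q 2 edgeMeasure) (lam : ℝ) :
    ∃ x : ℝ, theta1' q lam = x := by
  have := (ivp_real hq lam 1 0).2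
  rw [Complex.conj_eq_iff_real] at this
  simpa [theta1'] using this

theorem phi1_real (hq : MemLp q 2 edgeMeasure) (lam : ℝ) :
    ∃ x : ℝ, phi1 q lam = x := by
  have := (ivp_real hq lam 0 1).1
  rw [Complex.conj_eq_iff_real] at this
  simpa [phi1] using this

theorem phi1'_real (hq : MemLp q 2 edgeMeasure) (lam : ℝ) :
    ∃ x : ℝ, phi1' q lam = x := by
  have := (ivp_real hq lam 0 1).2
  rw [Complex.conj_eq_iff_real] at this
  simpa [phi1'] using this

/-! ### The Dirichlet spectrum -/

theorem mem_dirichletSpectrum_iff (hq : MemLp q 2 edgeMeasure) (lam : ℂ) :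
    lam ∈ dirichletSpectrum q ↔ phi1 q lam = 0 := by
  constructor
  · rintro ⟨u, u', h, h0, h1, t, ht, hne⟩
    have e := (h.at_one hq).1
    rw [h0, h1, zero_mul, zero_add] at e
    rcases mul_eq_zero.1 e.symm with h2 | h2
    · have e2 := (h.eq_edgeSol hq t ht).1
      rw [h0, h2] at e2
      have : ((0, 0, 0) : ℂ × ℂ × EdgeL2) = 0 := rfl
      rw [this, map_zero, ext_zero] at e2
      exact absurd e2 hne
    · exact h2
  · intro h
    obtain ⟨h1, h2, h3⟩ := ivp_spec hq lam 0 1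
    refine ⟨_, _, h1, h2, h, ?_⟩
    -- The eigenfunction is `φ` itself; it is not identically zero because its slope at `0` is `1`.
    by_contra! hz
    have hd := h1.deriv_eq 0 zero_mem_Icc
    rw [h3] at hd
    have hd0 : HasDerivWithinAt (ivp q lam 0 1).1 0 (Set.Icc 0 1) 0 :=
      (hasDerivWithinAt_const (0 : ℝ) (Set.Icc (0 : ℝ) 1) (0 : ℂ)).congr hz (hz 0 zero_mem_Icc)
    exact one_ne_zero ((uniqueDiffOn_Icc zero_lt_one 0 zero_mem_Icc).eq_deriv _ hd hd0)

/-- Green's identity for a solution and its complex conjugate. -/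
theorem IsSolution.energy (hq : MemLp q 2 edgeMeasure) {lam : ℂ} {u u' : ℝ → ℂ}
    (h : IsSolution q lam u u') :
    (lam - (starRingEnd ℂ) lam) * ((∫ t in (0 : ℝ)..1, ‖u t‖ ^ 2 : ℝ) : ℂ) =
      (u 1 * (starRingEnd ℂ) (u' 1) - u' 1 * (starRingEnd ℂ) (u 1)) -
        (u 0 * (starRingEnd ℂ) (u' 0) - u' 0 * (starRingEnd ℂ) (u 0)) := by
  rw [← (h.isW2 hq).green (h.conj.isW2 hq), ← intervalIntegral.integral_ofReal,
    ← intervalIntegral.integral_const_mul]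
  congr 1
  funext t
  have : ((‖u t‖ ^ 2 : ℝ) : ℂ) = u t * (starRingEnd ℂ) (u t) := by
    rw [Complex.mul_conj, Complex.normSq_eq_norm_sq]
  rw [this]
  ring

theorem eq_zero_of_integral_norm_sq {u : ℝ → ℂ} (hu : ContinuousOn u (Set.Icc 0 1))
    (h : ∫ t in (0 : ℝ)..1, ‖u t‖ ^ 2 ≤ 0) : ∀ t ∈ Set.Icc (0 : ℝ) 1, u t = 0 := by
  by_contra! hne
  obtain ⟨t, ht, hne⟩ := hne
  have := intervalIntegral.integral_pos zero_lt_one (hu.norm.pow 2)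
    (fun x _ => sq_nonneg _) ⟨t, ht, pow_pos (norm_pos_iff.2 hne) 2⟩
  exact absurd this (not_lt.2 h)

/-- A Dirichlet eigenfunction has no boundary terms in the energy identity, so a non-real `lam`
would give it zero `L²` norm. -/
theorem phi1_ne_zero_of_im (hq : MemLp q 2 edgeMeasure) {lam : ℂ} (hl : lam.im ≠ 0) :
    phi1 q lam ≠ 0 := by
  intro h0
  obtain ⟨u, u', h, h1, h2, t, ht, hne⟩ := (mem_dirichletSpectrum_iff hq lam).2 h0
  have e := h.energy hq
  rw [h1, h2] at e
  simp only [map_zero, mul_zero, zero_mul, sub_zero] at e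
  have hl2 : lam - (starRingEnd ℂ) lam ≠ 0 := by
    rw [Complex.sub_conj]
    simp [hl]
  have h3 := (mul_eq_zero.1 e).resolve_left hl2
  have h4 : ∫ t in (0 : ℝ)..1, ‖u t‖ ^ 2 = 0 := by exact_mod_cast h3
  exact hne (eq_zero_of_integral_norm_sq (h.isW2 hq).continuousOn h4.le t ht)

/-! ### Trace estimate -/

theorem isW2_of_hasDerivAt {u u' w : ℝ → ℂ} (h : ∀ t, HasDerivAt u (u' t) t)
    (h' : ∀ t, HasDerivAt u' (w t) t) (hw : Continuous w) : IsW2 u u' w := by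
  refine ⟨fun t _ => (h t).hasDerivWithinAt, ?_, fun t _ => ?_⟩
  · obtain ⟨C, hC⟩ := isCompact_Icc.exists_bound_of_continuousOn (hw.continuousOn (s := Set.Icc 0 1))
    exact MemLp.of_bound hw.aestronglyMeasurable C (ae_mem_Icc.mono hC)
  · rw [intervalIntegral.integral_eq_sub_of_hasDerivAt (fun x _ => h' x)
      (hw.intervalIntegrable _ _)]
    ring

theorem norm_integral_mul_le {u ζ : ℝ → ℂ} (hu : MemLp u 2 edgeMeasure) {C : ℝ}
    (hζ : Continuous ζ) (hb : ∀ t ∈ Set.Icc (0 : ℝ) 1, ‖ζ t‖ ≤ C) :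
    ‖∫ t in (0 : ℝ)..1, ζ t * u t‖ ≤ C * ‖hu.toLp‖ := by
  have hm : MemLp (fun t => ζ t * u t) 2 edgeMeasure := by
    refine hu.of_le_mul (c := C) (hζ.aestronglyMeasurable.mul hu.1) ?_
    filter_upwards [ae_mem_Icc] with t ht
    rw [norm_mul]
    exact mul_le_mul_of_nonneg_right (hb t ht) (norm_nonneg _)
  refine (norm_primitive_le hm one_mem_Icc).trans ?_
  rw [← Lp.norm_toLp _ hm]
  refine Lp.norm_le_mul_norm_of_ae_le_mul ?_
  filter_upwards [ae_mem_Icc, hm.coeFn_toLp, hu.coeFn_toLp] with t ht h1 h2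
  rw [h1, h2, norm_mul]
  exact mul_le_mul_of_nonneg_right (hb t ht) (norm_nonneg _)

theorem IsW2.memLp_self {u u' w : ℝ → ℂ} (h : IsW2 u u' w) : MemLp u 2 edgeMeasure := by
  obtain ⟨C, hC⟩ := isCompact_Icc.exists_bound_of_continuousOn h.continuousOn
  refine MemLp.of_bound ?_ C (ae_mem_Icc.mono hC)
  exact h.continuousOn.aestronglyMeasurable measurableSet_Icc

/-- Green's identity against a test function with zero Cauchy data at `1` leaves only the boundary
terms at `0`, expressed by integrals of `u` and `w`. -/
theorem IsW2.trace_aux {ζ ζ' ζ'' : ℝ → ℂ} (hζ : IsW2 ζ ζ' ζ'') (h1 : ζ 1 = 0) (h1' : ζ' 1 = 0)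
    (hc : Continuous ζ) (hc'' : Continuous ζ'') :
    ∃ C : ℝ, 0 ≤ C ∧ ∀ {u u' w : ℝ → ℂ} (h : IsW2 u u' w),
      ‖u' 0 * ζ 0 - u 0 * ζ' 0‖ ≤ C * (‖h.memLp_self.toLp‖ + ‖h.memLp.toLp‖) := by
  obtain ⟨C1, hC1⟩ := isCompact_Icc.exists_bound_of_continuousOn
    (hc.continuousOn (s := Set.Icc 0 1))
  obtain ⟨C2, hC2⟩ := isCompact_Icc.exists_bound_of_continuousOn
    (hc''.continuousOn (s := Set.Icc 0 1))
  have p1 : 0 ≤ C1 := (norm_nonneg _).trans (hC1 0 zero_mem_Icc)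
  have p2 : 0 ≤ C2 := (norm_nonneg _).trans (hC2 0 zero_mem_Icc)
  refine ⟨C1 + C2, by positivity, fun {u u' w} h => ?_⟩
  have g := h.green hζ
  rw [h1, h1'] at g
  have e : u' 0 * ζ 0 - u 0 * ζ' 0 =
      (∫ t in (0 : ℝ)..1, ζ'' t * u t) - ∫ t in (0 : ℝ)..1, ζ t * w t := by
    rw [← intervalIntegral.integral_sub]
    · simp only [mul_comm] at g ⊢
      rw [g]
      ring
    · simpa only [mul_comm] using h.intervalIntegrable_mul hζ
    · exact hζ.intervalIntegrable_mul h
  rw [e]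
  refine (norm_sub_le _ _).trans ?_
  have b1 := norm_integral_mul_le h.memLp_self hc'' hC2
  have b2 := norm_integral_mul_le h.memLp hc hC1
  have n1 := norm_nonneg h.memLp_self.toLp
  have n2 := norm_nonneg h.memLp.toLp
  nlinarith

/-- The Cauchy data at the initial point are bounded by the `L²` norms of `u` and `u''`. -/
theorem exists_trace_bound : ∃ C : ℝ, 0 ≤ C ∧ ∀ {u u' w : ℝ → ℂ} (h : IsW2 u u' w),
    ‖u 0‖ ≤ C * (‖h.memLp_self.toLp‖ + ‖h.memLp.toLp‖) ∧
      ‖u' 0‖ ≤ C * (‖h.memLp_self.toLp‖ + ‖h.memLp.toLp‖) := by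
  have hid : ∀ t : ℝ, HasDerivAt (fun x : ℝ => (x : ℂ)) 1 t := fun t =>
    (hasDerivAt_id t).ofReal_comp
  -- The cubic Hermite polynomials at `0`: the first has value `1` and slope `0` there, the second
  -- value `0` and slope `1`, and both have zero data at `1`. They isolate `u' 0` and `u 0`
  -- respectively.
  have w1 : IsW2 (fun t => (1 - (t : ℂ)) ^ 2 * (1 + 2 * t)) (fun t => 6 * (t : ℂ) ^ 2 - 6 * t)
      (fun t => 12 * (t : ℂ) - 6) := by
    refine isW2_of_hasDerivAt (fun t => ?_) (fun t => ?_) (by fun_prop)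
    · convert! (((hid t).const_sub 1).pow 2).mul (((hid t).const_mul 2).const_add 1) using 1
      simp
      ring
    · convert! (((hid t).pow 2).const_mul 6).sub ((hid t).const_mul 6) using 1
      simp
      ring
  have w2 : IsW2 (fun t => (t : ℂ) * (1 - (t : ℂ)) ^ 2) (fun t => 1 - 4 * (t : ℂ) + 3 * t ^ 2)
      (fun t => -4 + 6 * (t : ℂ)) := by
    refine isW2_of_hasDerivAt (fun t => ?_) (fun t => ?_) (by fun_prop)
    · convert! (hid t).mul (((hid t).const_sub 1).pow 2) using 1
      simp
      ring
    · convert! (((hid t).const_mul 4).const_sub 1).add (((hid t).pow 2).const_mul 3) using 1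
      simp
      ring
  obtain ⟨C1, p1, h1⟩ := w1.trace_aux (by simp) (by simp) (by fun_prop) (by fun_prop)
  obtain ⟨C2, p2, h2⟩ := w2.trace_aux (by simp) (by norm_num) (by fun_prop) (by fun_prop)
  refine ⟨C1 + C2, by positivity, fun {u u' w} h => ?_⟩
  have n1 := norm_nonneg h.memLp_self.toLp
  have n2 := norm_nonneg h.memLp.toLp
  have b1 := h1 h
  have b2 := h2 h
  simp [-Lp.norm_toLp] at b1 b2
  exact ⟨b2.trans (by gcongr; linarith), b1.trans (by gcongr; linarith)⟩

theorem exists_trace_bound_Lp : ∃ C : ℝ, 0 ≤ C ∧ ∀ {u u' : ℝ → ℂ} {f w : EdgeL2},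
    IsW2 u u' w → f =ᵐ[edgeMeasure] u →
      ‖u 0‖ ≤ C * (‖f‖ + ‖w‖) ∧ ‖u' 0‖ ≤ C * (‖f‖ + ‖w‖) := by
  obtain ⟨C, hC, H⟩ := exists_trace_bound
  refine ⟨C, hC, fun {u u' f w} h hf => ?_⟩
  have e1 : h.memLp_self.toLp = f := by
    rw [Lp.ext_iff]
    exact h.memLp_self.coeFn_toLp.trans hf.symm
  have e2 : h.memLp.toLp = w := Lp.toLp_coeFn w _
  have := H h
  rwa [e1, e2] at this

end

section

/-! ### Resolvents of self-adjoint operators -/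

section SelfAdjoint

variable {E : Type*} [NormedAddCommGroup E] [InnerProductSpace ℂ E]

/-- `T` is symmetric and `T - z` is onto for all non-real `z`; a densely defined operator has this
property if and only if it is self-adjoint. -/
structure IsSelfAdj (T : E →ₗ.[ℂ] E) : Prop where
  symm : ∀ f g : T.domain, inner ℂ (T f) (g : E) = inner ℂ (f : E) (T g)
  surj : ∀ z : ℂ, z.im ≠ 0 → ∀ ψ : E, ∃ f : T.domain, T f - z • (f : E) = ψ

/-- The resolvent `(T - z)⁻¹ ψ`, as an element of the domain. -/
def res (T : E →ₗ.[ℂ] E) (z : ℂ) (ψ : E) : T.domain :=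
  Classical.epsilon fun f => T f - z • (f : E) = ψ

variable {T : E →ₗ.[ℂ] E}

theorem inner_self_ofReal (x : E) : inner ℂ x x = ((‖x‖ ^ 2 : ℝ) : ℂ) := by
  rw [inner_self_eq_norm_sq_to_K]
  simp

namespace IsSelfAdj

theorem res_spec (h : IsSelfAdj T) {z : ℂ} (hz : z.im ≠ 0) (ψ : E) :
    T (res T z ψ) - z • (res T z ψ : E) = ψ :=
  Classical.epsilon_spec (h.surj z hz ψ)

theorem apply_res (h : IsSelfAdj T) {z : ℂ} (hz : z.im ≠ 0) (ψ : E) :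
    T (res T z ψ) = ψ + z • (res T z ψ : E) := by
  rw [← sub_eq_iff_eq_add]
  exact h.res_spec hz ψ

theorem im_inner (h : IsSelfAdj T) (z : ℂ) (f : T.domain) :
    (inner ℂ (T f - z • (f : E)) (f : E)).im = z.im * ‖(f : E)‖ ^ 2 := by
  have h1 : (inner ℂ (T f) (f : E)).im = 0 := by
    have := inner_conj_symm (𝕜 := ℂ) (T f) (f : E)
    rw [← h.symm f f] at this
    exact Complex.conj_eq_iff_im.1 this
  rw [inner_sub_left, inner_smul_left, inner_self_ofReal, Complex.sub_im, h1, Complex.im_mul_ofReal]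
  simp

theorem le_norm (h : IsSelfAdj T) (z : ℂ) (f : T.domain) :
    |z.im| * ‖(f : E)‖ ≤ ‖T f - z • (f : E)‖ := by
  have h1 : |z.im| * ‖(f : E)‖ ^ 2 ≤ ‖T f - z • (f : E)‖ * ‖(f : E)‖ := by
    have := (Complex.abs_im_le_norm _).trans (norm_inner_le_norm (𝕜 := ℂ) (T f - z • (f : E)) (f : E))
    rwa [h.im_inner, abs_mul, abs_of_nonneg (sq_nonneg ‖(f : E)‖)] at this
  rcases (norm_nonneg (f : E)).eq_or_lt with h0 | h0
  · rw [← h0, mul_zero]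
    exact norm_nonneg _
  · rw [sq, ← mul_assoc] at h1
    exact le_of_mul_le_mul_right h1 h0

theorem eq_res (h : IsSelfAdj T) {z : ℂ} (hz : z.im ≠ 0) {ψ : E} {f : T.domain}
    (hf : T f - z • (f : E) = ψ) : f = res T z ψ := by
  have h1 := h.le_norm z (f - res T z ψ)
  have h2 : T (f - res T z ψ) - z • ((f - res T z ψ : T.domain) : E) = 0 := by
    rw [LinearPMap.map_sub, h.apply_res hz, Submodule.coe_sub, smul_sub, ← hf]
    abel
  rw [h2, norm_zero] at h1
  have h3 : ‖((f - res T z ψ : T.domain) : E)‖ = 0 :=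
    le_antisymm (nonpos_of_mul_nonpos_right h1 (abs_pos.2 hz)) (norm_nonneg _)
  rw [norm_eq_zero, Submodule.coe_eq_zero, sub_eq_zero] at h3
  exact h3

theorem norm_res_le (h : IsSelfAdj T) {z : ℂ} (hz : z.im ≠ 0) (ψ : E) :
    ‖(res T z ψ : E)‖ ≤ |z.im|⁻¹ * ‖ψ‖ := by
  have := h.le_norm z (res T z ψ)
  rw [h.res_spec hz] at this
  rwa [← div_eq_inv_mul, le_div_iff₀' (abs_pos.2 hz)]

theorem res_add_smul (h : IsSelfAdj T) {z : ℂ} (hz : z.im ≠ 0) (a b : ℂ) (φ ψ : E) :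
    (res T z (a • φ + b • ψ) : E) = a • (res T z φ : E) + b • (res T z ψ : E) := by
  have : a • res T z φ + b • res T z ψ = res T z (a • φ + b • ψ) := by
    apply h.eq_res hz
    rw [LinearPMap.map_add, LinearPMap.map_smul, LinearPMap.map_smul, h.apply_res hz,
      h.apply_res hz, Submodule.coe_add, Submodule.coe_smul, Submodule.coe_smul]
    module
  rw [← this]
  rfl

theorem inner_res_left (h : IsSelfAdj T) {w : ℂ} (hw : w.im ≠ 0) (φ ψ : E) :
    inner ℂ (res T w φ : E) ψ = inner ℂ φ (res T ((starRingEnd ℂ) w) ψ : E) := by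
  have hw' : ((starRingEnd ℂ) w).im ≠ 0 := by simpa using hw
  have e1 := congrArg (fun x => inner ℂ (res T w φ : E) x) (h.res_spec hw' ψ)
  have e2 := congrArg (fun x => inner ℂ x (res T ((starRingEnd ℂ) w) ψ : E)) (h.res_spec hw φ)
  simp only [inner_sub_right, inner_sub_left, inner_smul_left, inner_smul_right, h.symm] at e1 e2
  rw [← e1, ← e2]

/-- The first resolvent identity: both sides solve the same equation, and solutions at non-real `z`
are unique. -/
theorem smul_res_res (h : IsSelfAdj T) {z w : ℂ} (hz : z.im ≠ 0) (hw : w.im ≠ 0) (ψ : E) :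
    (z - w) • (res T z (res T w ψ) : E) = (res T z ψ : E) - res T w ψ := by
  have h1 : res T z ψ - res T w ψ = res T z ((z - w) • (res T w ψ : E) + (0 : ℂ) • (0 : E)) := by
    apply h.eq_res hz
    rw [LinearPMap.map_sub, h.apply_res hz, h.apply_res hw, Submodule.coe_sub]
    module
  have h2 := congrArg (fun x : T.domain => (x : E)) h1
  rw [h.res_add_smul hz, zero_smul, add_zero] at h2
  exact h2.symm

theorem continuousAt_res (h : IsSelfAdj T) (ψ : E) {z₀ : ℂ} (hz₀ : z₀.im ≠ 0) :
    ContinuousAt (fun z => (res T z ψ : E)) z₀ := by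
  have hev : ∀ᶠ z in 𝓝 z₀, |z₀.im| / 2 < |z.im| :=
    (Complex.continuous_im.abs.tendsto z₀).eventually
      (lt_mem_nhds (half_lt_self (abs_pos.2 hz₀)))
  rw [ContinuousAt, tendsto_iff_norm_sub_tendsto_zero]
  have hlim : Filter.Tendsto (fun z : ℂ => ‖z - z₀‖ * ((|z₀.im| / 2)⁻¹ * ‖(res T z₀ ψ : E)‖))
      (𝓝 z₀) (𝓝 0) := by
    have : Filter.Tendsto (fun z : ℂ => ‖z - z₀‖) (𝓝 z₀) (𝓝 0) :=
      tendsto_iff_norm_sub_tendsto_zero.1 Filter.tendsto_id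
    simpa using this.mul_const ((|z₀.im| / 2)⁻¹ * ‖(res T z₀ ψ : E)‖)
  refine squeeze_zero' (Filter.Eventually.of_forall fun _ => norm_nonneg _) ?_ hlim
  filter_upwards [hev] with z hz
  have hp : 0 < |z₀.im| / 2 := half_pos (abs_pos.2 hz₀)
  have hz' : z.im ≠ 0 := abs_pos.1 (hp.trans hz)
  rw [← h.smul_res_res hz' hz₀, norm_smul]
  gcongr
  refine (h.norm_res_le hz' _).trans ?_
  gcongr

/-- A self-adjoint operator is closed. -/
theorem closed (h : IsSelfAdj T) {f : ℕ → T.domain} {g k : E}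
    (hf : Filter.Tendsto (fun n => (f n : E)) Filter.atTop (𝓝 g))
    (hT : Filter.Tendsto (fun n => T (f n)) Filter.atTop (𝓝 k)) :
    ∃ x : T.domain, (x : E) = g ∧ T x = k := by
  have hI : Complex.I.im ≠ 0 := by simp
  have h1 : Filter.Tendsto (fun n => T (f n) - Complex.I • (f n : E)) Filter.atTop
      (𝓝 (k - Complex.I • g)) := hT.sub (hf.const_smul _)
  -- The limit must be the resolvent at `i` applied to the limit of `(T - i) f n`; the lower bound
  -- `le_norm` forces convergence to it.
  set x := res T Complex.I (k - Complex.I • g) with hx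
  have h2 : Filter.Tendsto (fun n => (f n : E)) Filter.atTop (𝓝 (x : E)) := by
    rw [tendsto_iff_norm_sub_tendsto_zero] at h1 ⊢
    refine squeeze_zero (fun _ => norm_nonneg _) (fun n => ?_) h1
    have h3 := h.le_norm Complex.I (f n - x)
    have h4 : T (f n - x) - Complex.I • ((f n - x : T.domain) : E) =
        T (f n) - Complex.I • (f n : E) - (k - Complex.I • g) := by
      rw [LinearPMap.map_sub, hx, h.apply_res hI, Submodule.coe_sub]
      module
    rw [h4] at h3
    simpa using h3
  have hxg : (x : E) = g := tendsto_nhds_unique h2 hf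
  refine ⟨x, hxg, ?_⟩
  rw [hx, h.apply_res hI, ← hx, hxg]
  abel

/-- Only bijectivity is assumed. Boundedness of the inverse is the closed graph theorem, applicable
because a self-adjoint operator is closed. -/
theorem inResolventOn_univ [CompleteSpace E] (h : IsSelfAdj T) (lam : ℂ)
    (hs : ∀ g : E, ∃ f : T.domain, T f - lam • (f : E) = g)
    (hi : ∀ f : T.domain, T f - lam • (f : E) = 0 → f = 0) :
    InResolventOn T Set.univ lam := by
  choose F hF using hs
  have huniq : ∀ (g : E) (f : T.domain), T f - lam • (f : E) = g → f = F g := by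
    intro g f hf
    rw [← sub_eq_zero]
    apply hi
    rw [LinearPMap.map_sub, Submodule.coe_sub]
    have := hF g
    calc T f - T (F g) - lam • ((f : E) - F g)
        = (T f - lam • (f : E)) - (T (F g) - lam • (F g : E)) := by module
      _ = 0 := by rw [hf, this, sub_self]
  let L : E →ₗ[ℂ] E :=
    { toFun := fun g => (F g : E)
      map_add' := fun x y => by
        rw [← huniq (x + y) (F x + F y), Submodule.coe_add]
        rw [LinearPMap.map_add, Submodule.coe_add]
        nth_rw 3 [← hF x]
        nth_rw 3 [← hF y]
        module
      map_smul' := fun c x => by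
        rw [← huniq (c • x) (c • F x), Submodule.coe_smul]
        · rfl
        rw [LinearPMap.map_smul, Submodule.coe_smul]
        nth_rw 3 [← hF x]
        module }
  have hcont : Continuous L := by
    apply L.continuous_of_seq_closed_graph
    intro u x y hu hy
    have h1 : Filter.Tendsto (fun n => T (F (u n))) Filter.atTop (𝓝 (x + lam • y)) := by
      have h2 : (fun n => T (F (u n))) = fun n => u n + lam • (L (u n)) := by
        funext n
        rw [← sub_eq_iff_eq_add]
        exact hF (u n)
      rw [h2]
      exact hu.add (hy.const_smul lam)
    obtain ⟨f, hf, hTf⟩ := h.closed (f := fun n => F (u n)) hy h1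
    have : f = F x := huniq x f (by rw [hTf, hf]; abel)
    change y = (F x : E)
    rw [← this, hf]
  let L' : E →L[ℂ] E := ⟨L, hcont⟩
  refine ⟨‖L'‖, fun g _ => ⟨F g, trivial, hF g, L'.le_opNorm g, fun f₂ _ hf₂ => huniq g f₂ hf₂⟩⟩

end IsSelfAdj

/-! ### Spectral measures -/

/-- The Cauchy kernel `1 / (t - z)`. -/
def cauchyKer (z : ℂ) (t : ℝ) : ℂ := ((t : ℂ) - z)⁻¹

theorem sub_ne_zero_of_im {z : ℂ} (hz : z.im ≠ 0) (t : ℝ) : (t : ℂ) - z ≠ 0 := by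
  intro h
  have := congrArg Complex.im h
  simp at this
  exact hz this

theorem continuous_cauchyKer {z : ℂ} (hz : z.im ≠ 0) : Continuous (cauchyKer z) := by
  unfold cauchyKer
  exact Continuous.inv₀ (by fun_prop) (sub_ne_zero_of_im hz)

theorem norm_cauchyKer_le {z : ℂ} (hz : z.im ≠ 0) (t : ℝ) : ‖cauchyKer z t‖ ≤ |z.im|⁻¹ := by
  rw [cauchyKer, norm_inv]
  have h1 : |z.im| ≤ ‖(t : ℂ) - z‖ := by
    have := Complex.abs_im_le_norm ((t : ℂ) - z)
    simpa using this
  exact inv_anti₀ (abs_pos.2 hz) h1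

theorem conj_cauchyKer (z : ℂ) (t : ℝ) :
    (starRingEnd ℂ) (cauchyKer z t) = cauchyKer ((starRingEnd ℂ) z) t := by
  simp [cauchyKer]

theorem integrable_cauchyKer (μ : Measure ℝ) [IsFiniteMeasure μ] {z : ℂ} (hz : z.im ≠ 0) :
    Integrable (cauchyKer z) μ :=
  Integrable.of_bound (continuous_cauchyKer hz).aestronglyMeasurable _
    (Filter.Eventually.of_forall (norm_cauchyKer_le hz))

theorem cauchyKer_im (z : ℂ) (t : ℝ) :
    (cauchyKer z t).im = z.im * ‖cauchyKer z t‖ ^ 2 := by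
  rw [cauchyKer, Complex.inv_im, norm_inv, inv_pow, ← Complex.normSq_eq_norm_sq]
  simp [div_eq_mul_inv]

theorem integrable_norm_sq_cauchyKer (μ : Measure ℝ) [IsFiniteMeasure μ] {z : ℂ} (hz : z.im ≠ 0) :
    Integrable (fun t => ‖cauchyKer z t‖ ^ 2) μ := by
  refine Integrable.of_bound ((continuous_cauchyKer hz).norm.pow 2).aestronglyMeasurable
    (|z.im|⁻¹ ^ 2) (Filter.Eventually.of_forall fun t => ?_)
  rw [norm_pow, norm_norm]
  gcongr
  exact norm_cauchyKer_le hz t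

theorem isSpectralMeasure_iff (h : IsSelfAdj T) {ψ : E} {μ : Measure ℝ} :
    IsSpectralMeasure T ψ μ ↔ IsFiniteMeasure μ ∧ ∀ z : ℂ, z.im ≠ 0 →
      inner ℂ ψ (res T z ψ : E) = ∫ t, cauchyKer z t ∂μ := by
  constructor
  · rintro ⟨h1, h2⟩
    refine ⟨h1, fun z hz => ?_⟩
    obtain ⟨f, hf, hi⟩ := h2 z hz
    rw [← h.eq_res hz hf, hi]
    rfl
  · rintro ⟨h1, h2⟩
    exact ⟨h1, fun z hz => ⟨res T z ψ, h.res_spec hz ψ, h2 z hz⟩⟩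

/-- Imaginary parts of the Stieltjes formula: both `⟨ψ, (T - z)⁻¹ ψ⟩` and `(t - z)⁻¹` have imaginary
part `Im z` times a squared norm, and `Im z` cancels. -/
theorem norm_res_sq (h : IsSelfAdj T) {ψ : E} {μ : Measure ℝ} (hμ : IsSpectralMeasure T ψ μ)
    {z : ℂ} (hz : z.im ≠ 0) :
    ‖(res T z ψ : E)‖ ^ 2 = ∫ t, ‖cauchyKer z t‖ ^ 2 ∂μ := by
  obtain ⟨h1, h2⟩ := (isSpectralMeasure_iff h).1 hμ
  have e1 := h.im_inner z (res T z ψ)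
  rw [h.res_spec hz, h2 z hz] at e1
  have e2 : (∫ t, cauchyKer z t ∂μ).im = ∫ t, (cauchyKer z t).im ∂μ :=
    (Complex.imCLM.integral_comp_comm (integrable_cauchyKer μ hz)).symm
  rw [e2] at e1
  simp only [cauchyKer_im] at e1
  rw [integral_const_mul] at e1
  exact (mul_left_cancel₀ hz e1).symm

theorem continuousAt_integral_cauchyKer (μ : Measure ℝ) [IsFiniteMeasure μ] {z₀ : ℂ}
    (hz₀ : z₀.im ≠ 0) : ContinuousAt (fun z => ∫ t, cauchyKer z t ∂μ) z₀ := by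
  have hp : 0 < |z₀.im| / 2 := half_pos (abs_pos.2 hz₀)
  have hev : ∀ᶠ z in 𝓝 z₀, |z₀.im| / 2 < |z.im| :=
    (Complex.continuous_im.abs.tendsto z₀).eventually
      (lt_mem_nhds (half_lt_self (abs_pos.2 hz₀)))
  refine continuousAt_of_dominated (bound := fun _ => (|z₀.im| / 2)⁻¹) ?_ ?_
    (integrable_const _) ?_
  · filter_upwards [hev] with z hz
    exact (continuous_cauchyKer (abs_pos.1 (hp.trans hz))).aestronglyMeasurable
  · filter_upwards [hev] with z hz
    refine Filter.Eventually.of_forall fun t => ?_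
    exact (norm_cauchyKer_le (abs_pos.1 (hp.trans hz)) t).trans (inv_anti₀ hp hz.le)
  · refine Filter.Eventually.of_forall fun t => ?_
    unfold cauchyKer
    exact ContinuousAt.inv₀ (by fun_prop) (sub_ne_zero_of_im hz₀ t)

/-- The Stieltjes formula need only be checked off a finite set. -/
theorem isSpectralMeasure_of_finite (h : IsSelfAdj T) {ψ : E} {μ : Measure ℝ} [IsFiniteMeasure μ]
    (s : Set ℂ) (hs : s.Finite) (H : ∀ z : ℂ, z.im ≠ 0 → z ∉ s →
      inner ℂ ψ (res T z ψ : E) = ∫ t, cauchyKer z t ∂μ) : IsSpectralMeasure T ψ μ := by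
  refine (isSpectralMeasure_iff h).2 ⟨inferInstance, fun z₀ hz₀ => ?_⟩
  -- The complement of a finite set is dense and both sides are continuous off the real axis.
  have hne : (𝓝[sᶜ] z₀).NeBot :=
    mem_closure_iff_nhdsWithin_neBot.1 (hs.countable.dense_compl ℂ z₀)
  have c1 : Filter.Tendsto (fun z => inner ℂ ψ (res T z ψ : E)) (𝓝[sᶜ] z₀)
      (𝓝 (inner ℂ ψ (res T z₀ ψ : E))) :=
    (tendsto_const_nhds.inner (h.continuousAt_res ψ hz₀)).mono_left nhdsWithin_le_nhds
  have c2 : Filter.Tendsto (fun z => ∫ t, cauchyKer z t ∂μ) (𝓝[sᶜ] z₀)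
      (𝓝 (∫ t, cauchyKer z₀ t ∂μ)) :=
    (continuousAt_integral_cauchyKer μ hz₀).tendsto.mono_left nhdsWithin_le_nhds
  refine tendsto_nhds_unique (c1.congr' ?_) c2
  have hev : ∀ᶠ z in 𝓝[sᶜ] z₀, z.im ≠ 0 :=
    nhdsWithin_le_nhds ((Complex.continuous_im.tendsto z₀).eventually_ne hz₀)
  filter_upwards [hev, self_mem_nhdsWithin] with z hz1 hz2
  exact H z hz1 hz2

/-- Moving one resolvent across the inner product and applying the resolvent identity corresponds to
a partial fraction decomposition of the kernel; `z` must differ from the conjugate of `w` for the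
division. -/
theorem inner_res_res (h : IsSelfAdj T) {ψ : E} {μ : Measure ℝ} (hμ : IsSpectralMeasure T ψ μ)
    {w z : ℂ} (hw : w.im ≠ 0) (hz : z.im ≠ 0) (hne : z ≠ (starRingEnd ℂ) w) :
    inner ℂ (res T w ψ : E) (res T z ψ : E) =
      ∫ t, (starRingEnd ℂ) (cauchyKer w t) * cauchyKer z t ∂μ := by
  obtain ⟨h1, h2⟩ := (isSpectralMeasure_iff h).1 hμ
  have hw' : ((starRingEnd ℂ) w).im ≠ 0 := by simpa using hw
  have hne' : (starRingEnd ℂ) w - z ≠ 0 := sub_ne_zero.2 hne.symm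
  rw [h.inner_res_left hw]
  have e1 := congrArg (fun x => inner ℂ ψ x) (h.smul_res_res hw' hz ψ)
  simp only [inner_smul_right, inner_sub_right, h2 _ hw', h2 _ hz] at e1
  rw [← integral_sub (integrable_cauchyKer μ hw') (integrable_cauchyKer μ hz)] at e1
  apply mul_left_cancel₀ hne'
  rw [e1, ← integral_const_mul]
  congr 1
  funext t
  rw [conj_cauchyKer]
  unfold cauchyKer
  have := sub_ne_zero_of_im hw' t
  have := sub_ne_zero_of_im hz t
  field_simp
  ring

theorem integrable_conj_mul_cauchyKer (μ : Measure ℝ) [IsFiniteMeasure μ] {w z : ℂ}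
    (hw : w.im ≠ 0) (hz : z.im ≠ 0) :
    Integrable (fun t => (starRingEnd ℂ) (cauchyKer w t) * cauchyKer z t) μ := by
  refine Integrable.of_bound (((Complex.continuous_conj.comp (continuous_cauchyKer hw)).mul
    (continuous_cauchyKer hz)).aestronglyMeasurable) (|w.im|⁻¹ * |z.im|⁻¹)
    (Filter.Eventually.of_forall fun t => ?_)
  rw [norm_mul, RCLike.norm_conj]
  gcongr
  · exact norm_cauchyKer_le hw t
  · exact norm_cauchyKer_le hz t

theorem integral_combination {α : Type*} [MeasurableSpace α] {μ : Measure α}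
    {f₁ f₂ f₃ f₄ : α → ℂ} (h₁ : Integrable f₁ μ) (h₂ : Integrable f₂ μ) (h₃ : Integrable f₃ μ)
    (h₄ : Integrable f₄ μ) (c₁ c₂ c₃ c₄ : ℂ) :
    ∫ x, (c₁ * f₁ x + (c₂ * f₂ x + (c₃ * f₃ x + c₄ * f₄ x))) ∂μ =
      c₁ * ∫ x, f₁ x ∂μ + (c₂ * ∫ x, f₂ x ∂μ + (c₃ * ∫ x, f₃ x ∂μ + c₄ * ∫ x, f₄ x ∂μ)) := by
  have i1 := h₁.const_mul c₁
  have i2 := h₂.const_mul c₂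
  have i3 := h₃.const_mul c₃
  have i4 := h₄.const_mul c₄
  have i34 : Integrable (fun x => c₃ * f₃ x + c₄ * f₄ x) μ := i3.add i4
  have i234 : Integrable (fun x => c₂ * f₂ x + (c₃ * f₃ x + c₄ * f₄ x)) μ := i2.add i34
  rw [integral_add i1 i234, integral_add i2 i34, integral_add i3 i4]
  simp only [integral_const_mul]

/-- The spectral measure of `a ψ + b (T - w)⁻¹ ψ`. -/
theorem isSpectralMeasure_combination (h : IsSelfAdj T) {ψ : E} {μ : Measure ℝ}
    (hμ : IsSpectralMeasure T ψ μ) {w : ℂ} (hw : w.im ≠ 0) (a b : ℂ) :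
    IsSpectralMeasure T (a • ψ + b • (res T w ψ : E))
      (μ.withDensity fun t => ENNReal.ofReal (‖a + b * cauchyKer w t‖ ^ 2)) := by
  obtain ⟨h1, h2⟩ := (isSpectralMeasure_iff h).1 hμ
  have hc : Continuous fun t => ‖a + b * cauchyKer w t‖ ^ 2 := by
    have := continuous_cauchyKer hw
    fun_prop
  have hi : Integrable (fun t => ‖a + b * cauchyKer w t‖ ^ 2) μ := by
    refine Integrable.of_bound hc.aestronglyMeasurable ((‖a‖ + ‖b‖ * |w.im|⁻¹) ^ 2)
      (Filter.Eventually.of_forall fun t => ?_)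
    rw [norm_pow, norm_norm]
    gcongr
    refine (norm_add_le _ _).trans ?_
    rw [norm_mul]
    gcongr
    exact norm_cauchyKer_le hw t
  have : IsFiniteMeasure
      (μ.withDensity fun t => ENNReal.ofReal (‖a + b * cauchyKer w t‖ ^ 2)) :=
    isFiniteMeasure_withDensity_ofReal hi.2
  -- The excluded points `w` and its conjugate are those at which the partial fractions below would
  -- divide by zero.
  refine isSpectralMeasure_of_finite h {w, (starRingEnd ℂ) w} (Set.toFinite _)
    fun z hz hzs => ?_
  simp only [Set.mem_insert_iff, Set.mem_singleton_iff, not_or] at hzs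
  have hzw : z - w ≠ 0 := sub_ne_zero.2 hzs.1
  rw [integral_withDensity_eq_integral_toReal_smul hc.measurable.ennreal_ofReal
    (Filter.Eventually.of_forall fun _ => ENNReal.ofReal_lt_top)]
  have e1 : (res T z (res T w ψ) : E) = (z - w)⁻¹ • ((res T z ψ : E) - res T w ψ) := by
    rw [← h.smul_res_res hz hw, smul_smul, inv_mul_cancel₀ hzw, one_smul]
  have e2 : inner ℂ (res T w ψ : E) (res T w ψ : E) =
      ∫ t, (starRingEnd ℂ) (cauchyKer w t) * cauchyKer w t ∂μ := by
    rw [inner_self_ofReal, norm_res_sq h hμ hw, ← integral_complex_ofReal]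
    congr 1
    funext t
    rw [mul_comm, Complex.mul_conj, Complex.normSq_eq_norm_sq]
  have i1 := integrable_cauchyKer μ hz
  have i2 := integrable_cauchyKer μ hw
  have i3 := integrable_conj_mul_cauchyKer μ hw hz
  have i4 := integrable_conj_mul_cauchyKer μ hw hw
  rw [h.res_add_smul hz, e1]
  simp only [inner_add_left, inner_add_right, inner_smul_left, inner_smul_right, inner_sub_right,
    h2 z hz, h2 w hw, inner_res_res h hμ hw hz hzs.2, e2]
  -- The density times the kernel is split into the four kernels whose integrals are the terms of
  -- the expanded inner product.
  have e3 : ∀ t, (ENNReal.ofReal (‖a + b * cauchyKer w t‖ ^ 2)).toReal • cauchyKer z t =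
      (starRingEnd ℂ) a * (a + b * (z - w)⁻¹) * cauchyKer z t +
      (-((starRingEnd ℂ) a * b * (z - w)⁻¹) * cauchyKer w t +
      ((starRingEnd ℂ) b * (a + b * (z - w)⁻¹) *
        ((starRingEnd ℂ) (cauchyKer w t) * cauchyKer z t) +
      (-((starRingEnd ℂ) b * b * (z - w)⁻¹)) *
        ((starRingEnd ℂ) (cauchyKer w t) * cauchyKer w t))) := by
    intro t
    have hk : cauchyKer w t = cauchyKer z t - (z - w) * (cauchyKer z t * cauchyKer w t) := by
      unfold cauchyKer
      have := sub_ne_zero_of_im hw t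
      have := sub_ne_zero_of_im hz t
      field_simp
      ring
    rw [ENNReal.toReal_ofReal (by positivity), Complex.real_smul]
    have : ((‖a + b * cauchyKer w t‖ ^ 2 : ℝ) : ℂ) =
        (a + b * cauchyKer w t) * (starRingEnd ℂ) (a + b * cauchyKer w t) := by
      rw [Complex.mul_conj, Complex.normSq_eq_norm_sq]
    rw [this, map_add, map_mul]
    have hk2 : (z - w)⁻¹ * cauchyKer w t =
        (z - w)⁻¹ * cauchyKer z t - cauchyKer z t * cauchyKer w t := by
      nth_rw 1 [hk]
      field_simp
    linear_combination (b * (starRingEnd ℂ) a +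
      b * (starRingEnd ℂ) b * (starRingEnd ℂ) (cauchyKer w t)) * hk2
  simp only [e3]
  rw [integral_combination i1 i2 i3 i4]
  ring

/-- This stability is all that is needed of `acSubspace`; that it is a closed linear subspace is
never used. -/
theorem combination_mem_acSubspace (h : IsSelfAdj T) {ψ : E} (hψ : ψ ∈ acSubspace T) {w : ℂ}
    (hw : w.im ≠ 0) (a b : ℂ) : a • ψ + b • (res T w ψ : E) ∈ acSubspace T := by
  obtain ⟨μ, hμ, hac⟩ := hψ
  exact ⟨_, isSpectralMeasure_combination h hμ hw a b,
    (withDensity_absolutelyContinuous μ _).trans hac⟩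

theorem res_mem_acSubspace (h : IsSelfAdj T) {ψ : E} (hψ : ψ ∈ acSubspace T) {w : ℂ}
    (hw : w.im ≠ 0) : (res T w ψ : E) ∈ acSubspace T := by
  have := combination_mem_acSubspace h hψ hw 0 1
  rwa [zero_smul, zero_add, one_smul] at this

end SelfAdjoint

end

section

/-! ### The absolutely continuous subspace -/

/-- The point `lam + i η`. -/
def offAxis (lam η : ℝ) : ℂ := (lam : ℂ) + η * Complex.I

@[simp] theorem offAxis_im (lam η : ℝ) : (offAxis lam η).im = η := by simp [offAxis]

@[simp] theorem offAxis_re (lam η : ℝ) : (offAxis lam η).re = lam := by simp [offAxis]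

theorem norm_sq_cauchyKer (z : ℂ) (t : ℝ) :
    ‖cauchyKer z t‖ ^ 2 = ((t - z.re) ^ 2 + z.im ^ 2)⁻¹ := by
  rw [cauchyKer, norm_inv, inv_pow, ← Complex.normSq_eq_norm_sq, Complex.normSq_apply]
  simp [sq]

/-- Chebyshev's inequality: on the ball of radius `η` the squared kernel at height `η` is at least
`1 / (2 η²)`. -/
theorem measureReal_closedBall_le {μ : Measure ℝ} [IsFiniteMeasure μ] {lam η C : ℝ} (hη : 0 < η)
    (h : ∫ t, ‖cauchyKer (offAxis lam η) t‖ ^ 2 ∂μ ≤ C) :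
    μ.real (Metric.closedBall lam η) ≤ 2 * C * η ^ 2 := by
  have hz : (offAxis lam η).im ≠ 0 := by simp [hη.ne']
  have h1 := mul_meas_ge_le_integral_of_nonneg (μ := μ)
    (Filter.Eventually.of_forall fun t => sq_nonneg ‖cauchyKer (offAxis lam η) t‖)
    (integrable_norm_sq_cauchyKer μ hz) (2 * η ^ 2)⁻¹
  have h2 : Metric.closedBall lam η ⊆ {t | (2 * η ^ 2)⁻¹ ≤ ‖cauchyKer (offAxis lam η) t‖ ^ 2} := by
    intro t ht
    rw [Metric.mem_closedBall, Real.dist_eq] at ht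
    change (2 * η ^ 2)⁻¹ ≤ ‖cauchyKer (offAxis lam η) t‖ ^ 2
    rw [norm_sq_cauchyKer, offAxis_re, offAxis_im]
    apply inv_anti₀ (by positivity)
    have := sq_le_sq' (by linarith [abs_nonneg (t - lam)]) ht
    rw [sq_abs] at this
    linarith
  have h3 := measureReal_mono (μ := μ) h2
  have h4 : (2 * η ^ 2)⁻¹ * μ.real (Metric.closedBall lam η) ≤ C :=
    (mul_le_mul_of_nonneg_left h3 (by positivity)).trans (h1.trans h)
  rw [inv_mul_le_iff₀ (by positivity)] at h4
  linarith

/-- A bound uniform in `η` gives balls of radius `η` mass `O(η²)`. Covering the interval by `n`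
balls of radius `r / n` gives total mass `O(1 / n)`. -/
theorem measure_Ioo_eq_zero {μ : Measure ℝ} [IsFiniteMeasure μ] {lam r C η₀ : ℝ} (hr : 0 < r)
    (hη₀ : 0 < η₀)
    (h : ∀ x ∈ Set.Ioo (lam - r) (lam + r), ∀ η ∈ Set.Ioo 0 η₀,
      ∫ t, ‖cauchyKer (offAxis x η) t‖ ^ 2 ∂μ ≤ C) :
    μ (Set.Ioo (lam - r) (lam + r)) = 0 := by
  have key : ∀ᶠ n : ℕ in Filter.atTop,
      μ.real (Set.Ioo (lam - r) (lam + r)) ≤ 2 * C * r ^ 2 * (n : ℝ)⁻¹ := by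
    have h1 : Filter.Tendsto (fun n : ℕ => r * (n : ℝ)⁻¹) Filter.atTop (𝓝 0) := by
      simpa using (tendsto_inv_atTop_nhds_zero_nat (𝕜 := ℝ)).const_mul r
    filter_upwards [h1.eventually (gt_mem_nhds hη₀), Filter.eventually_gt_atTop 0] with n hn hn0
    have hnp : (0 : ℝ) < n := by exact_mod_cast hn0
    set d := r * (n : ℝ)⁻¹ with hd
    have hd0 : 0 < d := by positivity
    have hnd : n * d = r := by rw [hd]; field_simp
    -- Balls of diameter `2d` centred at odd multiples of `d` from the left end; the index of the
    -- ball containing `x` is a floor.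
    have hcov : Set.Ioo (lam - r) (lam + r) ⊆ ⋃ i ∈ Finset.range n,
        Metric.closedBall (lam - r + (2 * i + 1) * d) d := by
      intro x hx
      have hx0 : 0 ≤ (x - (lam - r)) / (2 * d) := div_nonneg (by linarith [hx.1]) (by positivity)
      have hf1 := Nat.floor_le hx0
      have hf2 := Nat.lt_floor_add_one ((x - (lam - r)) / (2 * d))
      rw [le_div_iff₀ (by positivity)] at hf1
      rw [div_lt_iff₀ (by positivity)] at hf2
      have hlt : ⌊(x - (lam - r)) / (2 * d)⌋₊ < n := by
        rw [Nat.floor_lt hx0, div_lt_iff₀ (by positivity)]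
        have := hx.2
        nlinarith
      simp only [Set.mem_iUnion, Finset.mem_range]
      refine ⟨_, hlt, ?_⟩
      rw [Metric.mem_closedBall, Real.dist_eq, abs_le]
      constructor <;> nlinarith
    calc μ.real (Set.Ioo (lam - r) (lam + r))
        ≤ μ.real (⋃ i ∈ Finset.range n, Metric.closedBall (lam - r + (2 * i + 1) * d) d) :=
          measureReal_mono hcov (measure_ne_top _ _)
      _ ≤ ∑ i ∈ Finset.range n, μ.real (Metric.closedBall (lam - r + (2 * i + 1) * d) d) :=
          measureReal_biUnion_finset_le _ _
      _ ≤ ∑ _i ∈ Finset.range n, 2 * C * d ^ 2 := by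
          refine Finset.sum_le_sum fun i hi => measureReal_closedBall_le hd0 (h _ ?_ d ⟨hd0, hn⟩)
          have hi' : (i : ℝ) + 1 ≤ n := by exact_mod_cast Finset.mem_range.1 hi
          constructor <;> nlinarith [(Nat.cast_nonneg i : (0 : ℝ) ≤ i)]
      _ = 2 * C * r ^ 2 * (n : ℝ)⁻¹ := by
          rw [Finset.sum_const, Finset.card_range, nsmul_eq_mul, hd]
          field_simp
  have hlim : Filter.Tendsto (fun n : ℕ => 2 * C * r ^ 2 * (n : ℝ)⁻¹) Filter.atTop (𝓝 0) := by
    simpa using (tendsto_inv_atTop_nhds_zero_nat (𝕜 := ℝ)).const_mul (2 * C * r ^ 2)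
  have := ge_of_tendsto hlim key
  rw [← measureReal_eq_zero_iff]
  exact le_antisymm this measureReal_nonneg

section

variable {E : Type*} [NormedAddCommGroup E] [InnerProductSpace ℂ E] {T : E →ₗ.[ℂ] E}

/-- For `z` near `lam` the vector `f = (T - z)⁻¹ ψ` satisfies `(T - lam) f = ψ + (z - lam) f`, and
the last term is absorbed by the bound at `lam`. So `f` stays bounded as `z` approaches the real
axis, on an interval whose length does not depend on `ψ`. Stability of `S` keeps `f` and the
right-hand side in `S`. -/
theorem exists_measure_Ioo_eq_zero (h : IsSelfAdj T) (S : Set E)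
    (hS : ∀ ψ ∈ S, ∀ w : ℂ, w.im ≠ 0 → ∀ a b : ℂ, a • ψ + b • (res T w ψ : E) ∈ S) {lam : ℝ}
    (hr : InResolventOn T S lam) :
    ∃ r > 0, ∀ ψ ∈ S, ∀ μ : Measure ℝ, IsSpectralMeasure T ψ μ →
      μ (Set.Ioo (lam - r) (lam + r)) = 0 := by
  obtain ⟨C₀, hC₀⟩ := hr
  -- The constant supplied by `InResolventOn` need not be positive; `C` is used as a divisor.
  set C := max C₀ 1 with hC
  have hCpos : 0 < C := lt_of_lt_of_le one_pos (le_max_right _ _)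
  refine ⟨(4 * C)⁻¹, by positivity, fun ψ hψ μ hμ => ?_⟩
  have hfin : IsFiniteMeasure μ := hμ.1
  refine measure_Ioo_eq_zero (C := (2 * C * ‖ψ‖) ^ 2) (η₀ := (4 * C)⁻¹) (by positivity)
    (by positivity) fun x hx η hη => ?_
  set z := offAxis x η with hz
  have hzim : z.im ≠ 0 := by rw [hz, offAxis_im]; exact hη.1.ne'
  rw [← norm_res_sq h hμ hzim]
  set f := res T z ψ with hf
  have hfS : (f : E) ∈ S := by
    have := hS ψ hψ z hzim 0 1
    rwa [zero_smul, zero_add, one_smul] at this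
  have hgS : (1 : ℂ) • ψ + (z - lam) • (f : E) ∈ S := hS ψ hψ z hzim 1 (z - lam)
  have hTf : T f - (lam : ℂ) • (f : E) = (1 : ℂ) • ψ + (z - lam) • (f : E) := by
    rw [hf, h.apply_res hzim]
    module
  obtain ⟨f₁, -, -, hb, hu⟩ := hC₀ _ hgS
  have hff : f = f₁ := hu f hfS hTf
  rw [← hff] at hb
  have hzl : ‖z - lam‖ ≤ (2 * C)⁻¹ := by
    have e : z - lam = ((x - lam : ℝ) : ℂ) + η * Complex.I := by
      rw [hz, offAxis]; push_cast; ring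
    rw [e]
    refine (norm_add_le _ _).trans ?_
    rw [norm_mul, Complex.norm_I, mul_one, Complex.norm_real, Complex.norm_real,
      Real.norm_eq_abs, Real.norm_eq_abs, abs_of_pos hη.1]
    have h1 : |x - lam| ≤ (4 * C)⁻¹ := abs_le.2 ⟨by linarith [hx.1], by linarith [hx.2]⟩
    have h2 : (2 * C)⁻¹ = (4 * C)⁻¹ + (4 * C)⁻¹ := by field_simp; norm_num
    linarith [hη.2]
  have h3 : ‖(f : E)‖ ≤ C * (‖ψ‖ + (2 * C)⁻¹ * ‖(f : E)‖) := by
    refine hb.trans ?_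
    have h4 : ‖(1 : ℂ) • ψ + (z - lam) • (f : E)‖ ≤ ‖ψ‖ + (2 * C)⁻¹ * ‖(f : E)‖ := by
      refine (norm_add_le _ _).trans ?_
      rw [one_smul, norm_smul]
      gcongr
    refine (mul_le_mul_of_nonneg_right (le_max_left C₀ 1) (norm_nonneg _)).trans ?_
    exact mul_le_mul_of_nonneg_left h4 hCpos.le
  have h5 : C * ((2 * C)⁻¹ * ‖(f : E)‖) = ‖(f : E)‖ / 2 := by field_simp
  have h6 : ‖(f : E)‖ ≤ 2 * C * ‖ψ‖ := by nlinarith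
  gcongr

theorem exists_measure_Ioo_eq_zero_ac (h : IsSelfAdj T) {lam : ℝ}
    (hr : InResolventOn T (acSubspace T) lam) :
    ∃ r > 0, ∀ ψ ∈ acSubspace T, ∀ μ : Measure ℝ, IsSpectralMeasure T ψ μ →
      μ (Set.Ioo (lam - r) (lam + r)) = 0 :=
  exists_measure_Ioo_eq_zero h _
    (fun _ hψ _ hw a b => combination_mem_acSubspace h hψ hw a b) hr

theorem exists_measure_Ioo_eq_zero_univ (h : IsSelfAdj T) {lam : ℝ}
    (hr : InResolventOn T Set.univ lam) :
    ∃ r > 0, ∀ ψ, ∀ μ : Measure ℝ, IsSpectralMeasure T ψ μ →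
      μ (Set.Ioo (lam - r) (lam + r)) = 0 := by
  obtain ⟨r, h1, h2⟩ := exists_measure_Ioo_eq_zero h Set.univ (fun _ _ _ _ _ _ => trivial) hr
  exact ⟨r, h1, fun ψ => h2 ψ trivial⟩

/-- An eigenvector is orthogonal to any vector whose resolvent stays bounded near the
eigenvalue. -/
theorem inner_eigenvector_eq_zero (h : IsSelfAdj T) {lam : ℝ} {e : T.domain}
    (he : T e = (lam : ℂ) • (e : E)) {g : E} {C : ℝ}
    (hb : ∀ n : ℕ, ‖(res T (offAxis lam (1 / ((n : ℝ) + 1))) g : E)‖ ≤ C) :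
    inner ℂ (e : E) g = 0 := by
  have key : ∀ n : ℕ, ‖inner ℂ (e : E) g‖ ≤ (1 / ((n : ℝ) + 1)) * (‖(e : E)‖ * C) := by
    intro n
    set η : ℝ := 1 / ((n : ℝ) + 1) with hη
    have hpos : 0 < η := by positivity
    set z := offAxis lam η with hz
    have hzim : z.im ≠ 0 := by rw [hz, offAxis_im]; exact hpos.ne'
    -- Symmetry turns the pairing with `e` into the factor `lam - z`, which tends to zero while the
    -- resolvent stays bounded.
    have h1 : inner ℂ (e : E) g = ((lam : ℂ) - z) * inner ℂ (e : E) (res T z g : E) := by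
      nth_rw 1 [← h.res_spec hzim g]
      rw [inner_sub_right, ← h.symm, he, inner_smul_left, inner_smul_right, Complex.conj_ofReal]
      ring
    have h2 : ‖(lam : ℂ) - z‖ = η := by
      have : (lam : ℂ) - z = -(η * Complex.I) := by rw [hz, offAxis]; ring
      rw [this, norm_neg, norm_mul, Complex.norm_I, mul_one, Complex.norm_real,
        Real.norm_of_nonneg hpos.le]
    rw [h1, norm_mul, h2]
    gcongr
    exact (norm_inner_le_norm _ _).trans (by gcongr; exact hb n)
  have hlim : Filter.Tendsto (fun n : ℕ => (1 / ((n : ℝ) + 1)) * (‖(e : E)‖ * C)) Filter.atTop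
      (𝓝 0) := by
    simpa using (tendsto_one_div_add_atTop_nhds_zero_nat (𝕜 := ℝ)).mul_const (‖(e : E)‖ * C)
  exact norm_eq_zero.1 (le_antisymm (ge_of_tendsto' hlim key) (norm_nonneg _))

theorem norm_sq_cauchyKer_le {lam η r t : ℝ} (hr : 0 < r) (ht : r ≤ |t - lam|) :
    ‖cauchyKer (offAxis lam η) t‖ ^ 2 ≤ (r ^ 2)⁻¹ := by
  rw [norm_sq_cauchyKer, offAxis_re, offAxis_im]
  apply inv_anti₀ (by positivity)
  have := pow_le_pow_left₀ hr.le ht 2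
  rw [sq_abs] at this
  nlinarith [sq_nonneg η]

/-- Comparison with the kernel at height `1`, rather than with a constant, lets the resulting
resolvent bound be expressed by `‖ψ‖` without identifying the total mass of the spectral measure. -/
theorem norm_sq_cauchyKer_le_mul {lam η r t : ℝ} (hr : 0 < r) (ht : r ≤ |t - lam|) :
    ‖cauchyKer (offAxis lam η) t‖ ^ 2 ≤
      (1 + (r ^ 2)⁻¹) * ‖cauchyKer (offAxis lam 1) t‖ ^ 2 := by
  simp only [norm_sq_cauchyKer, offAxis_re, offAxis_im]
  have h1 := pow_le_pow_left₀ hr.le ht 2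
  rw [sq_abs] at h1
  have h2 : 0 < r ^ 2 := by positivity
  have h3 : 0 < (t - lam) ^ 2 := h2.trans_le h1
  rw [← div_eq_mul_inv, inv_le_comm₀ (by positivity) (by positivity), inv_div,
    div_le_iff₀ (by positivity)]
  have h4 : 1 ≤ (t - lam) ^ 2 * (r ^ 2)⁻¹ := by
    rw [← div_eq_mul_inv, one_le_div h2]; exact h1
  nlinarith [mul_nonneg (sq_nonneg η) (inv_nonneg.2 h2.le), sq_nonneg η]

theorem ae_le_abs_of_measure_Ioo {μ : Measure ℝ} {lam r : ℝ}
    (h : μ (Set.Ioo (lam - r) (lam + r)) = 0) : ∀ᵐ t ∂μ, r ≤ |t - lam| := by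
  filter_upwards [measure_eq_zero_iff_ae_notMem.1 h] with t ht
  by_contra! hlt
  rw [abs_lt] at hlt
  exact ht ⟨by linarith [hlt.1], by linarith [hlt.2]⟩

theorem norm_res_le_of_measure (h : IsSelfAdj T) {lam r : ℝ} (hr : 0 < r) {ψ : E}
    {μ : Measure ℝ} (hμ : IsSpectralMeasure T ψ μ) (h0 : μ (Set.Ioo (lam - r) (lam + r)) = 0)
    {η : ℝ} (hη : η ≠ 0) :
    ‖(res T (offAxis lam η) ψ : E)‖ ≤ √(1 + (r ^ 2)⁻¹) * ‖ψ‖ := by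
  have hfin : IsFiniteMeasure μ := hμ.1
  have i1 : (offAxis lam η).im ≠ 0 := by simpa
  have i2 : (offAxis lam 1).im ≠ 0 := by simp
  have h1 : ‖(res T (offAxis lam η) ψ : E)‖ ^ 2 ≤ (1 + (r ^ 2)⁻¹) * ‖ψ‖ ^ 2 := by
    rw [norm_res_sq h hμ i1]
    calc ∫ t, ‖cauchyKer (offAxis lam η) t‖ ^ 2 ∂μ
        ≤ ∫ t, (1 + (r ^ 2)⁻¹) * ‖cauchyKer (offAxis lam 1) t‖ ^ 2 ∂μ := by
          refine integral_mono_ae (integrable_norm_sq_cauchyKer μ i1)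
            ((integrable_norm_sq_cauchyKer μ i2).const_mul _) ?_
          filter_upwards [ae_le_abs_of_measure_Ioo h0] with t ht
          exact norm_sq_cauchyKer_le_mul hr ht
      _ = (1 + (r ^ 2)⁻¹) * ‖(res T (offAxis lam 1) ψ : E)‖ ^ 2 := by
          rw [integral_const_mul, norm_res_sq h hμ i2]
      _ ≤ _ := by
          gcongr
          simpa using h.norm_res_le i2 ψ
  have h2 := Real.sqrt_le_sqrt h1
  rwa [Real.sqrt_sq (norm_nonneg _), Real.sqrt_mul (by positivity),
    Real.sqrt_sq (norm_nonneg _)] at h2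

theorem continuous_cauchyKer_offAxis_tendsto {lam t : ℝ} (ht : t ≠ lam) :
    Filter.Tendsto (fun n : ℕ => cauchyKer (offAxis lam (1 / ((n : ℝ) + 1))) t) Filter.atTop
      (𝓝 (cauchyKer lam t)) := by
  have h1 : Filter.Tendsto (fun n : ℕ => offAxis lam (1 / ((n : ℝ) + 1))) Filter.atTop
      (𝓝 (lam : ℂ)) := by
    have h2 := (Complex.continuous_ofReal.tendsto 0).comp
      (tendsto_one_div_add_atTop_nhds_zero_nat (𝕜 := ℝ))
    have h3 := (h2.mul_const Complex.I).const_add (lam : ℂ)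
    simpa [offAxis] using h3
  refine (tendsto_const_nhds.sub h1).inv₀ ?_
  rw [sub_ne_zero]
  exact_mod_cast ht

/-- If no absolutely continuous spectral measure charges a neighbourhood of `lam`, then `lam` is in
the resolvent set of the absolutely continuous part. -/
theorem inResolventOn_acSubspace [CompleteSpace E] (h : IsSelfAdj T) {lam r : ℝ} (hr : 0 < r)
    (H : ∀ ψ, ∀ μ : Measure ℝ, IsSpectralMeasure T ψ μ → μ ≪ volume →
      μ (Set.Ioo (lam - r) (lam + r)) = 0) :
    InResolventOn T (acSubspace T) lam := by
  refine ⟨√(1 + (r ^ 2)⁻¹), ?_⟩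
  rintro ψ ⟨μ, hμ, hac⟩
  have h0 := H ψ μ hμ hac
  have hfin : IsFiniteMeasure μ := hμ.1
  have hae := ae_le_abs_of_measure_Ioo h0
  set η : ℕ → ℝ := fun n => 1 / ((n : ℝ) + 1) with hη
  have hηpos : ∀ n, 0 < η n := fun n => by rw [hη]; positivity
  have hηlim : Filter.Tendsto η Filter.atTop (𝓝 0) := tendsto_one_div_add_atTop_nhds_zero_nat
  set z : ℕ → ℂ := fun n => offAxis lam (η n) with hz
  have hzim : ∀ n, (z n).im ≠ 0 := fun n => by
    rw [hz]; simp only [offAxis_im]; exact (hηpos n).ne'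
  have hzlim : Filter.Tendsto z Filter.atTop (𝓝 (lam : ℂ)) := by
    have h2 := (Complex.continuous_ofReal.tendsto 0).comp hηlim
    have h3 := (h2.mul_const Complex.I).const_add (lam : ℂ)
    simpa [hz, offAxis] using h3
  set f : ℕ → T.domain := fun n => res T (z n) ψ with hf
  -- By the resolvent identity this is an estimate of `(T - z n)⁻¹ (T - z m)⁻¹ ψ`. On the support of
  -- `μ` both squared kernels are at most `1 / r²`, uniformly in `n` and `m`.
  have hdiff : ∀ n m, ‖(f n : E) - f m‖ ≤ ‖z n - z m‖ * √((r ^ 2)⁻¹ * ((r ^ 2)⁻¹ * μ.real Set.univ)) := by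
    intro n m
    rw [hf, ← h.smul_res_res (hzim n) (hzim m), norm_smul]
    refine mul_le_mul_of_nonneg_left (Real.le_sqrt_of_sq_le ?_) (norm_nonneg _)
    have hs := isSpectralMeasure_combination h hμ (hzim m) 0 1
    rw [zero_smul, zero_add, one_smul] at hs
    rw [norm_res_sq h hs (hzim n)]
    have hcm := (continuous_cauchyKer (hzim m))
    rw [integral_withDensity_eq_integral_toReal_smul
      (by simp only [zero_add, one_mul]; exact (hcm.norm.pow 2).measurable.ennreal_ofReal)
      (Filter.Eventually.of_forall fun _ => ENNReal.ofReal_lt_top)]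
    have hb : ∀ᵐ t ∂μ, (ENNReal.ofReal (‖(0 : ℂ) + 1 * cauchyKer (z m) t‖ ^ 2)).toReal •
        ‖cauchyKer (z n) t‖ ^ 2 ≤ (r ^ 2)⁻¹ * (r ^ 2)⁻¹ := by
      filter_upwards [hae] with t ht
      rw [ENNReal.toReal_ofReal (by positivity), zero_add, one_mul, smul_eq_mul]
      exact mul_le_mul (norm_sq_cauchyKer_le hr ht) (norm_sq_cauchyKer_le hr ht) (by positivity)
        (by positivity)
    calc _ ≤ ∫ _t, (r ^ 2)⁻¹ * (r ^ 2)⁻¹ ∂μ :=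
          integral_mono_of_nonneg (Filter.Eventually.of_forall fun t => by
            simp only [smul_eq_mul, Pi.zero_apply]; positivity) (integrable_const _) hb
      _ = _ := by rw [integral_const, smul_eq_mul]; ring
  have hcau : CauchySeq fun n => (f n : E) := by
    have hzc := hzlim.cauchySeq
    rw [Metric.cauchySeq_iff'] at hzc ⊢
    intro ε hε
    set K := √((r ^ 2)⁻¹ * ((r ^ 2)⁻¹ * μ.real Set.univ)) with hK
    have hK0 : 0 ≤ K := Real.sqrt_nonneg _
    obtain ⟨N, hN⟩ := hzc (ε / (K + 1)) (by positivity)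
    refine ⟨N, fun n hn => ?_⟩
    have := hN n hn
    rw [dist_eq_norm] at this ⊢
    calc _ ≤ ‖z n - z N‖ * K := hdiff n N
      _ ≤ ‖z n - z N‖ * (K + 1) := by gcongr; linarith
      _ < ε := by rwa [lt_div_iff₀ (by positivity)] at this
  obtain ⟨g, hg⟩ := cauchySeq_tendsto_of_complete hcau
  have hTlim : Filter.Tendsto (fun n => T (f n)) Filter.atTop (𝓝 (ψ + (lam : ℂ) • g)) := by
    have : (fun n => T (f n)) = fun n => ψ + z n • (f n : E) :=
      funext fun n => h.apply_res (hzim n) ψ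
    rw [this]
    exact (hzlim.smul hg).const_add ψ
  obtain ⟨x, hx, hTx⟩ := h.closed hg hTlim
  have hxb : ∀ φ, ∀ ν : Measure ℝ, IsSpectralMeasure T φ ν → ν ≪ volume → ∀ n : ℕ,
      ‖(res T (offAxis lam (1 / ((n : ℝ) + 1))) φ : E)‖ ≤ √(1 + (r ^ 2)⁻¹) * ‖φ‖ :=
    fun φ ν hν hνac n => norm_res_le_of_measure h hr hν (H φ ν hν hνac) (hηpos n).ne'
  -- The spectral measure of the limit is `|t - lam|⁻² μ`, found from those of the `f n` by
  -- dominated convergence; the kernels are bounded because `μ` does not charge the interval around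
  -- `lam`.
  have hxS : (x : E) ∈ acSubspace T := by
    have hmeas : Measurable fun t => ‖cauchyKer lam t‖ ^ 2 := by
      unfold cauchyKer
      fun_prop
    have hbd : ∀ t, r ≤ |t - lam| → ‖cauchyKer lam t‖ ^ 2 ≤ (r ^ 2)⁻¹ := by
      intro t ht
      have := norm_sq_cauchyKer_le (η := 0) hr ht
      simpa [offAxis] using this
    have hint : Integrable (fun t => ‖cauchyKer lam t‖ ^ 2) μ := by
      refine Integrable.of_bound hmeas.aestronglyMeasurable (r ^ 2)⁻¹ ?_
      filter_upwards [hae] with t ht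
      rw [norm_pow, norm_norm]
      exact hbd t ht
    have hfin2 : IsFiniteMeasure
        (μ.withDensity fun t => ENNReal.ofReal (‖cauchyKer lam t‖ ^ 2)) :=
      isFiniteMeasure_withDensity_ofReal hint.2
    refine ⟨μ.withDensity fun t => ENNReal.ofReal (‖cauchyKer lam t‖ ^ 2),
      (isSpectralMeasure_iff h).2 ⟨hfin2, fun w hw => ?_⟩,
      (withDensity_absolutelyContinuous μ _).trans hac⟩
    rw [integral_withDensity_eq_integral_toReal_smul hmeas.ennreal_ofReal
      (Filter.Eventually.of_forall fun _ => ENNReal.ofReal_lt_top), hx]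
    have c0 : Filter.Tendsto (fun n => (res T w (f n : E) : E)) Filter.atTop
        (𝓝 (res T w g : E)) := by
      rw [tendsto_iff_norm_sub_tendsto_zero] at hg ⊢
      have hlim0 : Filter.Tendsto (fun n => |w.im|⁻¹ * ‖(f n : E) - g‖) Filter.atTop (𝓝 0) := by
        simpa using hg.const_mul |w.im|⁻¹
      refine squeeze_zero (fun _ => norm_nonneg _) (fun n => ?_) hlim0
      have e := h.res_add_smul hw 1 (-1) (f n : E) g
      rw [one_smul, neg_one_smul, one_smul, neg_one_smul, ← sub_eq_add_neg,
        ← sub_eq_add_neg] at e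
      rw [← e]
      exact h.norm_res_le hw _
    have c1 := hg.inner (𝕜 := ℂ) c0
    refine tendsto_nhds_unique c1 ?_
    have hs : ∀ n, inner ℂ (f n : E) (res T w (f n : E) : E) =
        ∫ t, (‖cauchyKer (z n) t‖ ^ 2 : ℝ) • cauchyKer w t ∂μ := by
      intro n
      have hs := isSpectralMeasure_combination h hμ (hzim n) 0 1
      simp only [zero_smul, zero_add, one_smul, one_mul] at hs
      have hm : Measurable fun t => ENNReal.ofReal (‖cauchyKer (z n) t‖ ^ 2) :=
        ((continuous_cauchyKer (hzim n)).norm.pow 2).measurable.ennreal_ofReal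
      rw [((isSpectralMeasure_iff h).1 hs).2 w hw,
        integral_withDensity_eq_integral_toReal_smul
          hm (Filter.Eventually.of_forall fun _ => ENNReal.ofReal_lt_top)]
      congr 1
      funext t
      rw [ENNReal.toReal_ofReal (by positivity)]
    simp only [hs]
    refine tendsto_integral_of_dominated_convergence (fun _ => (r ^ 2)⁻¹ * |w.im|⁻¹)
      (fun n => ?_) (integrable_const _) (fun n => ?_) ?_
    · exact (((continuous_cauchyKer (hzim n)).norm.pow 2).smul
        (continuous_cauchyKer hw)).aestronglyMeasurable
    · filter_upwards [hae] with t ht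
      rw [norm_smul, norm_pow, norm_norm]
      exact mul_le_mul (norm_sq_cauchyKer_le hr ht) (norm_cauchyKer_le hw t) (norm_nonneg _)
        (by positivity)
    · filter_upwards [hae] with t ht
      rw [ENNReal.toReal_ofReal (by positivity)]
      have hne : t ≠ lam := by
        rintro rfl
        rw [sub_self, abs_zero] at ht
        exact absurd ht (not_le.2 hr)
      exact (((continuous_cauchyKer_offAxis_tendsto hne).norm.pow 2).smul_const _)
  refine ⟨x, hxS, ?_, ?_, ?_⟩
  · rw [hTx, hx]; abel
  · rw [hx]
    exact le_of_tendsto hg.norm (Filter.Eventually.of_forall fun n => hxb ψ μ hμ hac n)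
  · intro f₂ hf₂ hTf₂
    -- The difference of two solutions is an eigenvector. It is orthogonal to each of them, as both
    -- have absolutely continuous spectral measures and hence bounded resolvents near `lam`; so it
    -- is orthogonal to itself.
    have he : T (f₂ - x) = (lam : ℂ) • ((f₂ - x : T.domain) : E) := by
      rw [LinearPMap.map_sub, hTx, Submodule.coe_sub, hx]
      rw [sub_eq_iff_eq_add] at hTf₂
      rw [hTf₂]
      module
    obtain ⟨ν, hν, hνac⟩ := hf₂
    obtain ⟨ν', hν', hνac'⟩ := hxS
    have e1 := inner_eigenvector_eq_zero h he (hxb _ ν hν hνac)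
    have e2 := inner_eigenvector_eq_zero h he (hxb _ ν' hν' hνac')
    have e3 : inner ℂ ((f₂ - x : T.domain) : E) ((f₂ - x : T.domain) : E) = 0 := by
      nth_rw 2 [Submodule.coe_sub]
      rw [inner_sub_right, e1, e2, sub_zero]
    rw [inner_self_eq_zero, Submodule.coe_eq_zero, sub_eq_zero] at e3
    exact e3

theorem inResolventOn_acSubspace_of_im (h : IsSelfAdj T) {z : ℂ} (hz : z.im ≠ 0) :
    InResolventOn T (acSubspace T) z :=
  ⟨|z.im|⁻¹, fun ψ hψ => ⟨res T z ψ, res_mem_acSubspace h hψ hz, h.res_spec hz ψ,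
    h.norm_res_le hz ψ, fun _ _ hf => h.eq_res hz hf⟩⟩

/-- The resolvent set is contained in that of the absolutely continuous part. -/
theorem inResolventOn_acSubspace_of_univ [CompleteSpace E] (h : IsSelfAdj T) {lam : ℝ}
    (hr : InResolventOn T Set.univ lam) : InResolventOn T (acSubspace T) lam := by
  obtain ⟨r, h1, h2⟩ := exists_measure_Ioo_eq_zero_univ h hr
  exact inResolventOn_acSubspace h h1 fun ψ μ hμ _ => h2 ψ μ hμ

/-- Points of the resolvent set accumulate only at points of the resolvent set of the absolutely
continuous part. -/
theorem inResolventOn_acSubspace_of_punctured [CompleteSpace E] (h : IsSelfAdj T) {lam : ℝ}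
    (hr : ∀ᶠ x : ℝ in 𝓝[≠] lam, InResolventOn T Set.univ x) :
    InResolventOn T (acSubspace T) lam := by
  rw [eventually_nhdsWithin_iff, Metric.eventually_nhds_iff] at hr
  obtain ⟨r, hr0, H⟩ := hr
  refine inResolventOn_acSubspace h hr0 fun ψ μ hμ hac => ?_
  have h1 : μ (Set.Ioo (lam - r) (lam + r) \ {lam}) = 0 := by
    refine measure_null_of_locally_null _ fun x hx => ?_
    have hd : dist x lam < r := by
      rw [Real.dist_eq, abs_lt]
      exact ⟨by linarith [hx.1.1], by linarith [hx.1.2]⟩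
    obtain ⟨ρ, hρ, hρ2⟩ := exists_measure_Ioo_eq_zero_univ h (H hd hx.2)
    exact ⟨_, nhdsWithin_le_nhds (Ioo_mem_nhds (by linarith) (by linarith)), hρ2 ψ μ hμ⟩
  -- The one place where absolute continuity enters: `lam` itself may be an eigenvalue, but its mass
  -- is zero.
  have h2 : μ {lam} = 0 := hac (by simp)
  refine measure_mono_null (fun x hx => ?_) (measure_union_null h1 h2)
  by_cases hxl : x = lam
  · exact Or.inr hxl
  · exact Or.inl ⟨hx, hxl⟩

end

end

section

variable {q : ℝ → ℝ} {N : ℕ} {a : ℝ} {k : ℤ}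

/-! ### Kirchhoff conditions and boundary terms -/

theorem exp_mul_conj (a : ℝ) :
    Complex.exp (Complex.I * a) * (starRingEnd ℂ) (Complex.exp (Complex.I * a)) = 1 := by
  rw [Complex.mul_conj, Complex.normSq_eq_norm_sq, mul_comm, Complex.norm_exp_ofReal_mul_I]
  simp

theorem sPow_eq (N : ℕ) (k : ℤ) :
    sPow N k = Complex.exp (((2 * (Real.pi * k / N) : ℝ) : ℂ) * Complex.I) := by
  rw [sPow, ← Complex.exp_int_mul]
  congr 1
  push_cast
  ring

theorem sPow_mul_conj (N : ℕ) (k : ℤ) : sPow N k * (starRingEnd ℂ) (sPow N k) = 1 := by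
  rw [sPow_eq, Complex.mul_conj, Complex.normSq_eq_norm_sq, Complex.norm_exp_ofReal_mul_I]
  simp

/-- The sesquilinear boundary form. -/
def bdry (u u' v v' : ℝ → ℂ) (t : ℝ) : ℂ :=
  (starRingEnd ℂ) (u t) * v' t - (starRingEnd ℂ) (u' t) * v t

/-- The sum of the boundary terms over one cell telescopes. -/
theorem Kirchhoff.sum_bdry {u u' v v' : Edge → ℝ → ℂ} (h : Kirchhoff N a k u u')
    (h₂ : Kirchhoff N a k v v') (n : ℤ) :
    ∑ j : Fin 3, (bdry (u (n, j)) (u' (n, j)) (v (n, j)) (v' (n, j)) 1 -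
      bdry (u (n, j)) (u' (n, j)) (v (n, j)) (v' (n, j)) 0) =
    bdry (u (n + 1, 0)) (u' (n + 1, 0)) (v (n + 1, 0)) (v' (n + 1, 0)) 0 -
      bdry (u (n, 0)) (u' (n, 0)) (v (n, 0)) (v' (n, 0)) 0 := by
  obtain ⟨a1, a2, a3, a4, a5, a6⟩ := h
  obtain ⟨b1, b2, b3, b4, b5, b6⟩ := h₂
  have a1 := a1 n
  have a2 := a2 n
  have a3 := a3 n
  have a4 := a4 n
  have a5 := a5 n
  have a6 := a6 n
  have b1 := b1 n
  have b2 := b2 n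
  have b3 := b3 n
  have b4 := b4 n
  have b5 := b5 n
  have b6 := b6 n
  have he := exp_mul_conj a
  have hs := sPow_mul_conj N k
  rw [Fin.sum_univ_three]
  simp only [bdry]
  generalize Complex.exp (Complex.I * a) = e at *
  generalize sPow N k = S at *
  have p1 : u (n, 0) 1 = e * S * u (n, 2) 1 := a1.trans a2
  have q1 : v (n, 0) 1 = e * S * v (n, 2) 1 := b1.trans b2
  have p2 : u (n, 2) 0 = e * u (n, 1) 1 := a4.symm
  have q2 : v (n, 2) 0 = e * v (n, 1) 1 := b4.symm
  have p3 : u' (n, 1) 0 = u' (n, 0) 1 + e * S * u' (n, 2) 1 := by linear_combination a5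
  have q3 : v' (n, 1) 0 = v' (n, 0) 1 + e * S * v' (n, 2) 1 := by linear_combination b5
  have p4 : u' (n + 1, 0) 0 = e * u' (n, 1) 1 - u' (n, 2) 0 := by linear_combination a6
  have q4 : v' (n + 1, 0) 0 = e * v' (n, 1) 1 - v' (n, 2) 0 := by linear_combination b6
  rw [p1, q1, a2, b2, p2, q2, a3, b3, p3, q3, p4, q4]
  simp only [map_add, map_sub, map_mul]
  set E := (starRingEnd ℂ) e
  set R := (starRingEnd ℂ) S
  set U2 := (starRingEnd ℂ) (u (n, 2) 1)
  set U2' := (starRingEnd ℂ) (u' (n, 2) 1)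
  set U1 := (starRingEnd ℂ) (u (n, 1) 1)
  set U1' := (starRingEnd ℂ) (u' (n, 1) 1)
  -- After substitution of the vertex conditions the terms cancel because both phases are
  -- unimodular.
  have hes : e * E * (S * R) = 1 := by rw [he, hs, one_mul]
  linear_combination (U2' * v (n, 2) 1 - U2 * v' (n, 2) 1) * hes +
    (U1' * v (n, 1) 1 - U1 * v' (n, 1) 1) * he

/-! ### The operator is symmetric -/

theorem summable_norm_sq (f : L2Graph) : Summable fun e => ‖f e‖ ^ 2 := by
  have := (lp.memℓp f).summable (by norm_num)
  simpa using this

theorem summable_norm_sq_row (f : L2Graph) (j : Fin 3) : Summable fun n : ℤ => ‖f (n, j)‖ ^ 2 :=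
  (summable_norm_sq f).comp_injective (i := fun n : ℤ => ((n, j) : Edge)) fun _ _ h =>
    (Prod.mk.inj h).1

theorem inner_edge_sub {u u' v v' : ℝ → ℂ} {w z f g f₂ g₂ : EdgeL2} (h : IsW2 u u' w)
    (h₂ : IsW2 v v' z) (hf : f =ᵐ[edgeMeasure] u) (hf₂ : f₂ =ᵐ[edgeMeasure] v)
    (hg : g =ᵐ[edgeMeasure] fun t => -(w t) + (q t : ℂ) * u t)
    (hg₂ : g₂ =ᵐ[edgeMeasure] fun t => -(z t) + (q t : ℂ) * v t) :
    inner ℂ g f₂ - inner ℂ f g₂ = bdry u u' v v' 1 - bdry u u' v v' 0 := by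
  have hgr := h.conj.green h₂
  rw [L2.inner_def, L2.inner_def, ← integral_sub (L2.integrable_inner _ _)
    (L2.integrable_inner _ _)]
  simp only [bdry]
  rw [← hgr, ← integral_edge]
  apply integral_congr_ae
  filter_upwards [hf, hf₂, hg, hg₂] with t h1 h2 h3 h4
  rw [h1, h2, h3, h4]
  simp only [RCLike.inner_apply, map_add, map_neg, map_mul, Complex.conj_ofReal]
  ring

theorem hasSum_int_sub {B : ℤ → ℂ} (hB : Summable B) :
    HasSum (fun n : ℤ => B (n + 1) - B n) 0 := by
  have h1 := hB.hasSum
  have h2 : HasSum (fun n : ℤ => B (n + 1)) (∑' n, B n) :=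
    (Equiv.addRight (1 : ℤ)).hasSum_iff.2 h1
  simpa using h2.sub h1

/-- The trace estimate bounds the boundary form at a vertex by the `L²` norms on one edge, so its
terms are summable over the cells and telescoping leaves nothing at infinity. -/
theorem summable_bdry {f w f₂ z : L2Graph} {u u' v v' : Edge → ℝ → ℂ}
    (hW : ∀ e, IsW2 (u e) (u' e) (w e)) (hW₂ : ∀ e, IsW2 (v e) (v' e) (z e))
    (hf : ∀ e, f e =ᵐ[edgeMeasure] u e) (hf₂ : ∀ e, f₂ e =ᵐ[edgeMeasure] v e) :
    Summable fun n : ℤ => bdry (u (n, 0)) (u' (n, 0)) (v (n, 0)) (v' (n, 0)) 0 := by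
  obtain ⟨C, hC, hT⟩ := exists_trace_bound_Lp
  have h1 : Summable fun n : ℤ => C ^ 2 * (4 * (‖f (n, 0)‖ ^ 2 + ‖w (n, 0)‖ ^ 2 +
      ‖f₂ (n, 0)‖ ^ 2 + ‖z (n, 0)‖ ^ 2)) :=
    (((((summable_norm_sq_row f 0).add (summable_norm_sq_row w 0)).add
      (summable_norm_sq_row f₂ 0)).add (summable_norm_sq_row z 0)).mul_left 4).mul_left _
  refine Summable.of_norm_bounded h1 fun n => ?_
  obtain ⟨t1, t2⟩ := hT (hW (n, 0)) (hf (n, 0))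
  obtain ⟨t3, t4⟩ := hT (hW₂ (n, 0)) (hf₂ (n, 0))
  set F := ‖f (n, 0)‖
  set W := ‖w (n, 0)‖
  set F₂ := ‖f₂ (n, 0)‖
  set Z := ‖z (n, 0)‖
  have hF : 0 ≤ F := norm_nonneg _
  have hWn : 0 ≤ W := norm_nonneg _
  have hF₂ : 0 ≤ F₂ := norm_nonneg _
  have hZ : 0 ≤ Z := norm_nonneg _
  calc _ ≤ ‖u (n, 0) 0‖ * ‖v' (n, 0) 0‖ + ‖u' (n, 0) 0‖ * ‖v (n, 0) 0‖ := by
        refine (norm_sub_le _ _).trans_eq ?_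
        rw [norm_mul, norm_mul, RCLike.norm_conj, RCLike.norm_conj]
    _ ≤ C * (F + W) * (C * (F₂ + Z)) + C * (F + W) * (C * (F₂ + Z)) := by gcongr
    _ = C ^ 2 * (2 * ((F + W) * (F₂ + Z))) := by ring
    _ ≤ _ := by
        refine mul_le_mul_of_nonneg_left ?_ (sq_nonneg C)
        nlinarith [sq_nonneg (F - F₂), sq_nonneg (F - Z), sq_nonneg (W - F₂), sq_nonneg (W - Z)]

theorem HasSum.eq_zero_of_telescope {D : Edge → ℂ} {G : ℤ → ℂ} {s : ℂ} (hD : HasSum D s)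
    (hG : Summable G) (h : ∀ n : ℤ, ∑ j : Fin 3, D (n, j) = G (n + 1) - G n) : s = 0 := by
  have h1 : HasSum (fun n : ℤ => ∑ j : Fin 3, D (n, j)) s :=
    hD.prod_fiberwise (fun n => hasSum_fintype _)
  have h2 : (fun n : ℤ => ∑ j : Fin 3, D (n, j)) = fun n => G (n + 1) - G n := funext h
  rw [h2] at h1
  exact h1.unique (hasSum_int_sub hG)

theorem hasSum_inner_graph (f g : L2Graph) :
    HasSum (fun e : Edge => (inner ℂ (f e) (g e) : ℂ)) (inner ℂ f g) :=
  lp.hasSum_inner (𝕜 := ℂ) (G := fun _ : Edge => EdgeL2) f g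

theorem hasSum_bdry {f g f₂ g₂ w z : L2Graph} {u u' v v' : Edge → ℝ → ℂ}
    (hW : ∀ e, IsW2 (u e) (u' e) (w e)) (hW₂ : ∀ e, IsW2 (v e) (v' e) (z e))
    (hf : ∀ e, f e =ᵐ[edgeMeasure] u e) (hf₂ : ∀ e, f₂ e =ᵐ[edgeMeasure] v e)
    (hg : ∀ e, g e =ᵐ[edgeMeasure] fun t => -(w e t) + (q t : ℂ) * u e t)
    (hg₂ : ∀ e, g₂ e =ᵐ[edgeMeasure] fun t => -(z e t) + (q t : ℂ) * v e t) :
    HasSum (fun e : Edge => bdry (u e) (u' e) (v e) (v' e) 1 -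
      bdry (u e) (u' e) (v e) (v' e) 0) (inner ℂ g f₂ - inner ℂ f g₂) := by
  have h3 := (hasSum_inner_graph g f₂).sub (hasSum_inner_graph f g₂)
  have h4 : (fun e : Edge => bdry (u e) (u' e) (v e) (v' e) 1 - bdry (u e) (u' e) (v e) (v' e) 0) =
      fun e : Edge => inner ℂ (g e) (f₂ e) - inner ℂ (f e) (g₂ e) :=
    funext fun e => (inner_edge_sub (hW e) (hW₂ e) (hf e) (hf₂ e) (hg e) (hg₂ e)).symm
  rw [h4]
  exact h3

theorem HRel.symm {f g f₂ g₂ : L2Graph} (h : HRel q N a k f g) (h₂ : HRel q N a k f₂ g₂) :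
    inner ℂ g f₂ = inner ℂ f g₂ := by
  obtain ⟨u, u', w, hW, hK, hf, hg⟩ := h
  obtain ⟨v, v', z, hW₂, hK₂, hf₂, hg₂⟩ := h₂
  exact sub_eq_zero.1 (HasSum.eq_zero_of_telescope (hasSum_bdry hW hW₂ hf hf₂ hg hg₂)
    (summable_bdry hW hW₂ hf hf₂) (hK.sum_bdry hK₂))

theorem exists_domain_of_HRel {f g : L2Graph} (h : HRel q N a k f g) :
    ∃ x : (opH q N a k).domain, (x : L2Graph) = f ∧ opH q N a k x = g := by
  have := (mem_graph_opH q N a k f g).2 h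
  rw [LinearPMap.mem_graph_iff] at this
  exact this

theorem HRel_apply (x : (opH q N a k).domain) : HRel q N a k x (opH q N a k x) :=
  (mem_graph_opH q N a k _ _).1 (LinearPMap.mem_graph _ x)

/-! ### Construction of elements of the domain -/

theorem summable_norm_sq_clm (L : (ℂ × ℂ × EdgeL2) →L[ℂ] EdgeL2) {α β : Edge → ℂ}
    (hα : Summable fun e => ‖α e‖ ^ 2) (hβ : Summable fun e => ‖β e‖ ^ 2) (g : L2Graph) :
    Summable fun e => ‖L (α e, β e, g e)‖ ^ 2 := by
  have h1 : Summable fun e => ‖L‖ ^ 2 * (‖α e‖ ^ 2 + ‖β e‖ ^ 2 + ‖g e‖ ^ 2) :=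
    ((hα.add hβ).add (summable_norm_sq g)).mul_left _
  refine Summable.of_nonneg_of_le (fun _ => sq_nonneg _) (fun e => ?_) h1
  have h2 := L.le_opNorm (α e, β e, g e)
  have h3 : ‖((α e, β e, g e) : ℂ × ℂ × EdgeL2)‖ ^ 2 ≤ ‖α e‖ ^ 2 + ‖β e‖ ^ 2 + ‖g e‖ ^ 2 := by
    have hA := sq_nonneg ‖α e‖
    have hB := sq_nonneg ‖β e‖
    have hC := sq_nonneg ‖g e‖
    rw [Prod.norm_def, Prod.norm_def]
    rcases max_choice ‖α e‖ (max ‖β e‖ ‖g e‖) with h | h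
    · simp only [h]; linarith
    · rcases max_choice ‖β e‖ ‖g e‖ with h' | h'
      · simp only [h]; rw [h']; linarith
      · simp only [h]; rw [h']; linarith
  calc _ ≤ (‖L‖ * ‖((α e, β e, g e) : ℂ × ℂ × EdgeL2)‖) ^ 2 :=
        pow_le_pow_left₀ (norm_nonneg _) h2 2
    _ ≤ _ := by
        rw [mul_pow]
        gcongr

/-- An element of `L²` on the graph from a square summable family. -/
def mkL2 (f : Edge → EdgeL2) (hf : Summable fun e => ‖f e‖ ^ 2) : L2Graph :=
  ⟨f, memℓp_gen (by simpa using hf)⟩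

/-- Square summable initial data suffice for membership in the domain: on each edge `u` and `u''`
are images of `(α, β, g)` under bounded operators that do not depend on the edge. -/
theorem HRel_of_edgeSol (hq : MemLp q 2 edgeMeasure) (lam : ℂ) {α β : Edge → ℂ}
    (hα : Summable fun e => ‖α e‖ ^ 2) (hβ : Summable fun e => ‖β e‖ ^ 2) (g : L2Graph)
    (hK : Kirchhoff N a k (fun e => ext (edgeSol hq lam (α e, β e, g e)))
      (fun e => ext (edgeSol' hq lam (α e, β e, g e)))) :
    ∃ f : L2Graph, (∀ e, f e = inclL (edgeSol hq lam (α e, β e, g e))) ∧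
      HRel q N a k f (g + lam • f) := by
  set L : (ℂ × ℂ × EdgeL2) →L[ℂ] EdgeL2 := inclL.comp (edgeSol hq lam) with hL
  set L₂ : (ℂ × ℂ × EdgeL2) →L[ℂ] EdgeL2 := (potL hq lam).comp (edgeSol hq lam) -
      ((ContinuousLinearMap.snd ℂ ℂ EdgeL2).comp (.snd ℂ ℂ (ℂ × EdgeL2))) with hL₂
  set f := mkL2 _ (summable_norm_sq_clm L hα hβ g) with hf
  set h := mkL2 _ (summable_norm_sq_clm L₂ hα hβ g) with hh
  refine ⟨f, fun e => rfl, _, _, h, fun e => isW2_edgeSol hq lam (α e) (β e) (g e), hK,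
    fun e => inclL_ae _, fun e => ?_⟩
  have hadd : ((g + lam • f : L2Graph) e : ℝ → ℂ) =ᵐ[edgeMeasure] (g e : ℝ → ℂ) +
      ((lam • f : L2Graph) e : ℝ → ℂ) := Lp.coeFn_add (g e) _
  have hsmul : ((lam • f : L2Graph) e : ℝ → ℂ) =ᵐ[edgeMeasure] lam • (f e : ℝ → ℂ) :=
    Lp.coeFn_smul lam (f e)
  have hfe : (f e : ℝ → ℂ) =ᵐ[edgeMeasure] ext (edgeSol hq lam (α e, β e, g e)) := inclL_ae _
  have hhe : (h e : ℝ → ℂ) =ᵐ[edgeMeasure]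
      (potL hq lam (edgeSol hq lam (α e, β e, g e)) : ℝ → ℂ) - (g e : ℝ → ℂ) :=
    Lp.coeFn_sub (potL hq lam (edgeSol hq lam (α e, β e, g e))) (g e)
  filter_upwards [hadd, hsmul, hfe, hhe, potL_ae hq lam (edgeSol hq lam (α e, β e, g e))]
    with t h1 h2 h3 h4 h5
  rw [h1, h4, Pi.add_apply, h2, Pi.smul_apply, h3, Pi.sub_apply, h5, smul_eq_mul]
  ring

end

section

/-! ### Difference equations in `ℓ²(ℤ)` -/

/-- `ℓ²(ℤ)`. -/
abbrev SeqL2 : Type := lp (fun _ : ℤ => ℂ) 2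

theorem summable_seq (y : SeqL2) : Summable fun n => ‖y n‖ ^ 2 := by
  simpa using (lp.memℓp y).summable (by norm_num)

theorem norm_sq_seq (y : SeqL2) : ‖y‖ ^ 2 = ∑' n, ‖y n‖ ^ 2 := by
  have := lp.norm_rpow_eq_tsum (p := 2) (by norm_num) y
  simpa using this

/-- A square summable sequence as an element of `ℓ²(ℤ)`. -/
def mkSeq (y : ℤ → ℂ) (hy : Summable fun n => ‖y n‖ ^ 2) : SeqL2 :=
  ⟨y, memℓp_gen (by simpa using hy)⟩

/-- Translation by `d` in `ℓ²(ℤ)`. -/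
def shiftL (d : ℤ) : SeqL2 →L[ℂ] SeqL2 :=
  LinearMap.mkContinuous
    { toFun := fun y => mkSeq (fun n => y (n + d))
        ((Equiv.addRight d).summable_iff.2 (summable_seq y))
      map_add' := fun _ _ => rfl
      map_smul' := fun _ _ => rfl } 1 fun y => by
    rw [one_mul]
    refine le_of_eq ((sq_eq_sq₀ (norm_nonneg _) (norm_nonneg _)).1 ?_)
    rw [norm_sq_seq, norm_sq_seq]
    exact (Equiv.addRight d).tsum_eq fun n => ‖y n‖ ^ 2

theorem norm_shiftL_le (d : ℤ) : ‖shiftL d‖ ≤ 1 := LinearMap.mkContinuous_norm_le _ zero_le_one _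

theorem exists_sub_smul_eq {A : Type*} [NormedAddCommGroup A] [NormedSpace ℂ A] [CompleteSpace A]
    (L : A →L[ℂ] A) (hL : ‖L‖ ≤ 1) {c : ℂ} (hc : ‖c‖ < 1) (z : A) : ∃ y, y - c • L y = z := by
  have h1 : ‖c • L‖ < 1 := by
    rw [norm_smul]
    exact (mul_le_of_le_one_right (norm_nonneg _) hL).trans_lt hc
  obtain ⟨v, hv⟩ := isUnit_one_sub_of_norm_lt_one h1
  refine ⟨(↑v⁻¹ : A →L[ℂ] A) z, ?_⟩
  have h2 := congrArg (fun M : A →L[ℂ] A => M z) v.mul_inv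
  rw [hv] at h2
  exact h2

/-- The shift has norm at most one in both directions, so shift minus `τ` is inverted by a Neumann
series in the backward shift if `‖τ‖ < 1` and in the forward shift if `‖τ‖ > 1`. -/
theorem exists_first_order {τ : ℂ} (hτ : ‖τ‖ ≠ 1) {z : ℤ → ℂ}
    (hz : Summable fun n => ‖z n‖ ^ 2) :
    ∃ y : ℤ → ℂ, (Summable fun n => ‖y n‖ ^ 2) ∧ ∀ n, y (n + 1) - τ * y n = z n := by
  rcases lt_or_gt_of_ne hτ with h | h
  · obtain ⟨y, hy⟩ := exists_sub_smul_eq (shiftL (-1)) (norm_shiftL_le _) h (mkSeq z hz)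
    have hy' : ∀ n, y n - τ * y (n + -1) = z n := fun n => congrArg (fun v : SeqL2 => v n) hy
    refine ⟨fun n => y (n + -1), summable_seq (shiftL (-1) y), fun n => ?_⟩
    have := hy' n
    simpa using this
  · have hc : ‖τ⁻¹‖ < 1 := by
      rw [norm_inv]
      exact inv_lt_one_of_one_lt₀ h
    have hτ0 : τ ≠ 0 := by
      rintro rfl
      norm_num at h
    obtain ⟨y, hy⟩ := exists_sub_smul_eq (shiftL 1) (norm_shiftL_le _) hc ((-τ⁻¹) • mkSeq z hz)
    have hy' : ∀ n, y n - τ⁻¹ * y (n + 1) = -τ⁻¹ * z n := fun n =>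
      congrArg (fun v : SeqL2 => v n) hy
    refine ⟨fun n => y n, summable_seq y, fun n => ?_⟩
    have h1 := hy' n
    field_simp at h1
    linear_combination -h1

/-- The moduli do not decrease in one of the two directions, yet square summability makes them tend
to zero there. -/
theorem eq_zero_of_first_order {τ : ℂ} (hτ : ‖τ‖ ≠ 1) {y : ℤ → ℂ}
    (hy : Summable fun n => ‖y n‖ ^ 2) (h : ∀ n, y (n + 1) = τ * y n) (n : ℤ) : y n = 0 := by
  have key : ∀ (d : ℤ), d ≠ 0 → (∀ m, ‖y m‖ ≤ ‖y (m + d)‖) → y n = 0 := by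
    intro d hd hm
    have h1 : Function.Injective fun j : ℕ => n + j * d := fun i j hij => by
      have : (i : ℤ) * d = j * d := by simpa using hij
      exact_mod_cast mul_right_cancel₀ hd this
    have h2 := (hy.comp_injective h1).tendsto_atTop_zero
    have h3 : ∀ j : ℕ, ‖y n‖ ≤ ‖y (n + j * d)‖ := by
      intro j
      induction j with
      | zero => simp
      | succ j ih =>
        refine ih.trans ((hm _).trans_eq ?_)
        push_cast
        ring_nf
    have h4 : ‖y n‖ ^ 2 ≤ 0 := ge_of_tendsto' h2 fun j =>
      pow_le_pow_left₀ (norm_nonneg _) (h3 j) 2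
    have h5 : ‖y n‖ = 0 := by nlinarith [norm_nonneg (y n)]
    exact norm_eq_zero.1 h5
  rcases lt_or_gt_of_ne hτ with h1 | h1
  · refine key (-1) (by norm_num) fun m => ?_
    have h2 := h (m + -1)
    rw [neg_add_cancel_right] at h2
    rw [h2, norm_mul]
    exact mul_le_of_le_one_left (norm_nonneg _) h1.le
  · refine key 1 (by norm_num) fun m => ?_
    rw [h m, norm_mul]
    exact le_mul_of_one_le_left (norm_nonneg _) h1.le

theorem summable_norm_sq_add {ι : Type*} {x y : ι → ℂ} (hx : Summable fun n => ‖x n‖ ^ 2)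
    (hy : Summable fun n => ‖y n‖ ^ 2) : Summable fun n => ‖x n + y n‖ ^ 2 := by
  refine Summable.of_nonneg_of_le (fun _ => sq_nonneg _) (fun n => ?_) ((hx.add hy).mul_left 2)
  have h1 := norm_add_le (x n) (y n)
  nlinarith [sq_nonneg (‖x n‖ - ‖y n‖), norm_nonneg (x n + y n)]

theorem summable_norm_sq_mul {ι : Type*} {x : ι → ℂ} (c : ℂ)
    (hx : Summable fun n => ‖x n‖ ^ 2) : Summable fun n => ‖c * x n‖ ^ 2 := by
  simp only [norm_mul, mul_pow]
  exact hx.mul_left _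

theorem summable_norm_sq_shift {x : ℤ → ℂ} (hx : Summable fun n => ‖x n‖ ^ 2) :
    Summable fun n => ‖x (n + 1)‖ ^ 2 := (Equiv.addRight (1 : ℤ)).summable_iff.2 hx

/-- The second order difference operator `κ U² + m U + κ₂`. -/
def diffOp (κ m κ₂ : ℂ) (x : ℤ → ℂ) (n : ℤ) : ℂ := κ * x (n + 2) + m * x (n + 1) + κ₂ * x n

theorem exists_roots {κ m κ₂ : ℂ} (hκ : κ ≠ 0) :
    ∃ τ₁ τ₂ : ℂ, m = -κ * (τ₁ + τ₂) ∧ κ₂ = κ * (τ₁ * τ₂) ∧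
      κ * τ₁ ^ 2 + m * τ₁ + κ₂ = 0 ∧ κ * τ₂ ^ 2 + m * τ₂ + κ₂ = 0 := by
  obtain ⟨r, hr⟩ := IsAlgClosed.exists_pow_nat_eq (m ^ 2 - 4 * κ * κ₂) (n := 2) (by norm_num)
  refine ⟨(-m + r) / (2 * κ), (-m - r) / (2 * κ), ?_, ?_, ?_, ?_⟩
  · field_simp
    ring
  · field_simp
    linear_combination hr
  · field_simp
    linear_combination hr
  · field_simp
    linear_combination hr

/-- With `U` the shift, the operator factors as `κ (U - τ₁) (U - τ₂)`, and each factor is invertible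
on `ℓ²`. -/
theorem exists_diffOp_eq {κ m κ₂ : ℂ} (hκ : κ ≠ 0)
    (hr : ∀ τ : ℂ, κ * τ ^ 2 + m * τ + κ₂ = 0 → ‖τ‖ ≠ 1) {z : ℤ → ℂ}
    (hz : Summable fun n => ‖z n‖ ^ 2) :
    ∃ x : ℤ → ℂ, (Summable fun n => ‖x n‖ ^ 2) ∧ ∀ n, diffOp κ m κ₂ x n = z n := by
  obtain ⟨τ₁, τ₂, h1, h2, h3, h4⟩ := exists_roots (m := m) (κ₂ := κ₂) hκ
  obtain ⟨y, hy, hy'⟩ := exists_first_order (hr τ₁ h3) (summable_norm_sq_mul κ⁻¹ hz)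
  obtain ⟨x, hx, hx'⟩ := exists_first_order (hr τ₂ h4) hy
  refine ⟨x, hx, fun n => ?_⟩
  have e1 := hy' n
  have e2 := hx' n
  have e3 := hx' (n + 1)
  rw [add_assoc, one_add_one_eq_two] at e3
  field_simp at e1
  rw [diffOp, h1, h2]
  linear_combination e1 + κ * e3 - κ * τ₁ * e2

theorem eq_zero_of_diffOp {κ m κ₂ : ℂ} (hκ : κ ≠ 0)
    (hr : ∀ τ : ℂ, κ * τ ^ 2 + m * τ + κ₂ = 0 → ‖τ‖ ≠ 1) {x : ℤ → ℂ}
    (hx : Summable fun n => ‖x n‖ ^ 2) (h : ∀ n, diffOp κ m κ₂ x n = 0) (n : ℤ) : x n = 0 := by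
  obtain ⟨τ₁, τ₂, h1, h2, h3, h4⟩ := exists_roots (m := m) (κ₂ := κ₂) hκ
  refine eq_zero_of_first_order (hr τ₂ h4) hx (fun n => ?_) n
  have hy : Summable fun n => ‖x (n + 1) + -τ₂ * x n‖ ^ 2 :=
    summable_norm_sq_add (summable_norm_sq_shift hx) (summable_norm_sq_mul _ hx)
  have := eq_zero_of_first_order (hr τ₁ h3) hy (fun n => ?_) n
  · linear_combination this
  · have e := h n
    rw [diffOp, h1, h2] at e
    have e' : κ * (x (n + 2) + -τ₂ * x (n + 1) - τ₁ * (x (n + 1) + -τ₂ * x n)) = 0 := by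
      linear_combination e
    rw [add_assoc, one_add_one_eq_two]
    have := (mul_eq_zero.1 e').resolve_left hκ
    linear_combination this

/-- Solvability in `ℓ²` of the system of vertex equations. -/
theorem exists_vertex_solution {κ κ₂ P Q : ℂ} (hκ : κ ≠ 0)
    (hr : ∀ τ : ℂ, κ * τ ^ 2 + (1 + κ * κ₂ - P * Q) * τ + κ₂ = 0 → ‖τ‖ ≠ 1) {A B : ℤ → ℂ}
    (hA : Summable fun n => ‖A n‖ ^ 2) (hB : Summable fun n => ‖B n‖ ^ 2) :
    ∃ x y : ℤ → ℂ, (Summable fun n => ‖x n‖ ^ 2) ∧ (Summable fun n => ‖y n‖ ^ 2) ∧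
      (∀ n, x n + κ * x (n + 1) - P * y n = A n) ∧
      ∀ n, y (n + 1) + κ₂ * y n - Q * x (n + 1) = B n := by
  -- `x` and `y` are found separately, each from the second order equation obtained by eliminating
  -- the other. The residuals of the original system are then annihilated by the same second order
  -- operator, so they vanish.
  obtain ⟨x, hx, hx'⟩ := exists_diffOp_eq hκ hr (summable_norm_sq_add (summable_norm_sq_shift hA)
    (summable_norm_sq_add (summable_norm_sq_mul κ₂ hA) (summable_norm_sq_mul P hB)))
  obtain ⟨y, hy, hy'⟩ := exists_diffOp_eq hκ hr (summable_norm_sq_add hB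
    (summable_norm_sq_add (summable_norm_sq_mul κ (summable_norm_sq_shift hB))
      (summable_norm_sq_mul Q (summable_norm_sq_shift hA))))
  simp only [diffOp] at hx' hy'
  have e₂ : ∀ n : ℤ, n + 1 + 1 = n + 2 := fun n => by ring
  have e₃ : ∀ n : ℤ, n + 2 + 1 = n + 3 := fun n => by ring
  have e₄ : ∀ n : ℤ, n + 1 + 2 = n + 3 := fun n => by ring
  refine ⟨x, y, hx, hy, fun n => ?_, fun n => ?_⟩
  · have hs : Summable fun n => ‖x n + (κ * x (n + 1) + (-P * y n + -1 * A n))‖ ^ 2 :=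
      summable_norm_sq_add hx (summable_norm_sq_add
        (summable_norm_sq_mul κ (summable_norm_sq_shift hx))
        (summable_norm_sq_add (summable_norm_sq_mul (-P) hy) (summable_norm_sq_mul (-1) hA)))
    have := eq_zero_of_diffOp hκ hr hs (fun n => ?_) n
    · linear_combination this
    · have a1 := hx' n
      have a2 := hx' (n + 1)
      have a3 := hy' n
      simp only [diffOp, e₂, e₃, e₄] at a1 a2 a3 ⊢
      linear_combination a1 + κ * a2 - P * a3
  · have hs : Summable fun n => ‖y (n + 1) + (κ₂ * y n + (-Q * x (n + 1) + -1 * B n))‖ ^ 2 :=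
      summable_norm_sq_add (summable_norm_sq_shift hy) (summable_norm_sq_add
        (summable_norm_sq_mul κ₂ hy) (summable_norm_sq_add
          (summable_norm_sq_mul (-Q) (summable_norm_sq_shift hx)) (summable_norm_sq_mul (-1) hB)))
    have := eq_zero_of_diffOp hκ hr hs (fun n => ?_) n
    · linear_combination this
    · have a1 := hy' n
      have a2 := hy' (n + 1)
      have a3 := hx' (n + 1)
      simp only [diffOp, e₂, e₃, e₄] at a1 a2 a3 ⊢
      linear_combination κ₂ * a1 + a2 - Q * a3

theorem vertex_solution_unique {κ κ₂ P Q : ℂ} (hκ : κ ≠ 0)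
    (hr : ∀ τ : ℂ, κ * τ ^ 2 + (1 + κ * κ₂ - P * Q) * τ + κ₂ = 0 → ‖τ‖ ≠ 1) {x y : ℤ → ℂ}
    (hx : Summable fun n => ‖x n‖ ^ 2) (hy : Summable fun n => ‖y n‖ ^ 2)
    (h1 : ∀ n, x n + κ * x (n + 1) - P * y n = 0)
    (h2 : ∀ n, y (n + 1) + κ₂ * y n - Q * x (n + 1) = 0) :
    (∀ n, x n = 0) ∧ ∀ n, y n = 0 := by
  have e₂ : ∀ n : ℤ, n + 1 + 1 = n + 2 := fun n => by ring
  constructor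
  · refine eq_zero_of_diffOp hκ hr hx fun n => ?_
    have a1 := h1 n
    have a2 := h1 (n + 1)
    have a3 := h2 n
    simp only [diffOp, e₂] at a1 a2 a3 ⊢
    linear_combination a2 + κ₂ * a1 + P * a3
  · refine eq_zero_of_diffOp hκ hr hy fun n => ?_
    have a1 := h1 (n + 1)
    have a2 := h2 n
    have a3 := h2 (n + 1)
    simp only [diffOp, e₂] at a1 a2 a3 ⊢
    linear_combination a2 + κ * a3 + Q * a1

end

section

variable {q : ℝ → ℝ} {N : ℕ} {a : ℝ} {k : ℤ}

/-! ### The reduced problem on the vertices -/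

/-- `e^{ia}`. -/
def om (a : ℝ) : ℂ := Complex.exp (Complex.I * a)

/-- `e^{i π k / N}`. -/
def half (N : ℕ) (k : ℤ) : ℂ := Complex.exp (((Real.pi * k / N : ℝ) : ℂ) * Complex.I)

/-- The coupling constant `e^{-ia} + e^{ia} s^k = 2 c_k e^{iπk/N}`. -/
def kap (N : ℕ) (a : ℝ) (k : ℤ) : ℂ := (starRingEnd ℂ) (om a) + om a * sPow N k

theorem om_mul_conj (a : ℝ) : om a * (starRingEnd ℂ) (om a) = 1 := exp_mul_conj a

theorem om_eq (a : ℝ) : om a = Complex.exp ((a : ℂ) * Complex.I) := by rw [om, mul_comm]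

theorem half_mul_conj (N : ℕ) (k : ℤ) : half N k * (starRingEnd ℂ) (half N k) = 1 := by
  rw [half, Complex.mul_conj, Complex.normSq_eq_norm_sq, Complex.norm_exp_ofReal_mul_I]
  simp

theorem norm_half (N : ℕ) (k : ℤ) : ‖half N k‖ = 1 := Complex.norm_exp_ofReal_mul_I _

theorem kap_eq (N : ℕ) (a : ℝ) (k : ℤ) : kap N a k = 2 * cK N a k * half N k := by
  have h1 : (2 * cK N a k : ℂ) = Complex.exp (((a + Real.pi * k / N : ℝ) : ℂ) * Complex.I) +
      Complex.exp (-((a + Real.pi * k / N : ℝ) : ℂ) * Complex.I) := by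
    rw [cK, Complex.ofReal_cos, Complex.two_cos]
  rw [h1, kap, om_eq, ← Complex.exp_conj, sPow_eq, half, add_mul, ← Complex.exp_add,
    ← Complex.exp_add, ← Complex.exp_add, add_comm]
  simp only [map_mul, Complex.conj_ofReal, Complex.conj_I]
  congr 2
  · push_cast
    ring
  · push_cast
    ring

theorem conj_kap (N : ℕ) (a : ℝ) (k : ℤ) :
    (starRingEnd ℂ) (kap N a k) = 2 * cK N a k * (starRingEnd ℂ) (half N k) := by
  rw [kap_eq, map_mul, map_mul, Complex.conj_ofReal, map_ofNat]

theorem conj_kap' (N : ℕ) (a : ℝ) (k : ℤ) :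
    (starRingEnd ℂ) (kap N a k) = om a + (starRingEnd ℂ) (om a * sPow N k) := by
  rw [kap]
  simp

theorem kap_ne_zero (hc : cK N a k ≠ 0) : kap N a k ≠ 0 := by
  rw [kap_eq]
  have : half N k ≠ 0 := Complex.exp_ne_zero _
  have : (cK N a k : ℂ) ≠ 0 := by exact_mod_cast hc
  exact mul_ne_zero (mul_ne_zero two_ne_zero this) ‹_›

theorem kap_mul_conj (N : ℕ) (a : ℝ) (k : ℤ) :
    kap N a k * (starRingEnd ℂ) (kap N a k) = 4 * (cK N a k : ℂ) ^ 2 := by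
  rw [conj_kap, kap_eq]
  linear_combination 4 * (cK N a k : ℂ) ^ 2 * half_mul_conj N k

/-- `2 φ'(1) + ϑ(1)`. -/
def bigP (q : ℝ → ℝ) (lam : ℂ) : ℂ := 2 * phi1' q lam + theta1 q lam

/-- `2 ϑ(1) + φ'(1)`. -/
def bigQ (q : ℝ → ℝ) (lam : ℂ) : ℂ := 2 * theta1 q lam + phi1' q lam

/-- `(F + s_k²) / c_k`. -/
def wK (q : ℝ → ℝ) (N : ℕ) (a : ℝ) (k : ℤ) (lam : ℂ) : ℂ :=
  (bigF q lam + (sK N a k : ℂ) ^ 2) / (cK N a k : ℂ)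

/-- The source of the combination `bigF`: `P Q = 8 Δ² + ϑ(1) φ'(1)`, and the Wronskian replaces the
last product by `1 + φ(1) ϑ'(1)`. -/
theorem bigP_mul_bigQ (hq : MemLp q 2 edgeMeasure) (lam : ℂ) :
    bigP q lam * bigQ q lam = 4 * bigF q lam + 5 := by
  unfold bigP bigQ bigF hillDelta
  linear_combination wronskian hq lam

theorem sq_sK_add (N : ℕ) (a : ℝ) (k : ℤ) : (sK N a k : ℂ) ^ 2 + (cK N a k : ℂ) ^ 2 = 1 := by
  have := Real.sin_sq_add_cos_sq (a + Real.pi * k / N)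
  rw [sK, cK]
  exact_mod_cast this

theorem middle_coeff (hq : MemLp q 2 edgeMeasure) (hc : cK N a k ≠ 0) (lam : ℂ) :
    1 + kap N a k * (starRingEnd ℂ) (kap N a k) - bigP q lam * bigQ q lam =
      -4 * cK N a k * wK q N a k lam := by
  have h : (cK N a k : ℂ) ≠ 0 := by exact_mod_cast hc
  rw [kap_mul_conj, bigP_mul_bigQ hq, wK]
  field_simp
  linear_combination (4 : ℂ) * sq_sK_add N a k

/-- After division by `2 c_k`, and for `τ ≠ 0`, the multiplier equation says that `σ = half N k * τ`
satisfies `σ + 1/σ = 2 w`. -/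
theorem root_iff (hq : MemLp q 2 edgeMeasure) (hc : cK N a k ≠ 0) (lam τ : ℂ) :
    kap N a k * τ ^ 2 + (1 + kap N a k * (starRingEnd ℂ) (kap N a k) - bigP q lam * bigQ q lam) * τ
      + (starRingEnd ℂ) (kap N a k) = 0 ↔
    half N k * τ ^ 2 + (starRingEnd ℂ) (half N k) = 2 * wK q N a k lam * τ := by
  have h : (2 * cK N a k : ℂ) ≠ 0 := mul_ne_zero two_ne_zero (by exact_mod_cast hc)
  rw [middle_coeff hq hc, conj_kap, kap_eq]
  constructor
  · intro h1
    apply mul_left_cancel₀ h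
    linear_combination h1
  · intro h1
    linear_combination (2 * cK N a k : ℂ) * h1

/-- On the unit circle `σ + 1/σ` is twice the real part of `σ`, so `w` would be real and in
`[-1,1]`. -/
theorem norm_ne_one_of_root (hq : MemLp q 2 edgeMeasure) (hc : cK N a k ≠ 0) {lam : ℂ}
    (hw : ∀ x ∈ Set.Icc (-1 : ℝ) 1, wK q N a k lam ≠ x) (τ : ℂ)
    (hτ : kap N a k * τ ^ 2 + (1 + kap N a k * (starRingEnd ℂ) (kap N a k) -
      bigP q lam * bigQ q lam) * τ + (starRingEnd ℂ) (kap N a k) = 0) : ‖τ‖ ≠ 1 := by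
  intro h1
  rw [root_iff hq hc] at hτ
  have h2 : τ * (starRingEnd ℂ) τ = 1 := by
    rw [Complex.mul_conj, Complex.normSq_eq_norm_sq, h1]
    simp
  have h3 : wK q N a k lam = ((half N k * τ).re : ℂ) := by
    have h4 := Complex.add_conj (half N k * τ)
    rw [map_mul] at h4
    push_cast at h4
    linear_combination (1 / 2 : ℂ) * h4 - (1 / 2 : ℂ) * (starRingEnd ℂ) τ * hτ +
      (half N k * τ / 2 - wK q N a k lam) * h2
  have h5 : |(half N k * τ).re| ≤ 1 := by
    refine (Complex.abs_re_le_norm _).trans_eq ?_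
    rw [norm_mul, norm_half, h1, one_mul]
  exact hw _ (abs_le.1 h5) h3

/-! ### Kirchhoff conditions in terms of the vertex values -/

/-- The values at the initial points of the edges, given the vertex values. -/
def startVal (x y : ℤ → ℂ) (e : Edge) : ℂ := ![x e.1, y e.1, x (e.1 + 1)] e.2

/-- The values at the end points of the edges, given the vertex values. -/
def endVal (N : ℕ) (a : ℝ) (k : ℤ) (x y : ℤ → ℂ) (e : Edge) : ℂ :=
  ![y e.1, (starRingEnd ℂ) (om a) * x (e.1 + 1), (starRingEnd ℂ) (om a * sPow N k) * y e.1] e.2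

theorem Kirchhoff.vertex_values {u u' : Edge → ℝ → ℂ} (h : Kirchhoff N a k u u') (e : Edge) :
    u e 0 = startVal (fun n => u (n, 0) 0) (fun n => u (n, 0) 1) e ∧
      u e 1 = endVal N a k (fun n => u (n, 0) 0) (fun n => u (n, 0) 1) e := by
  obtain ⟨n, j⟩ := e
  have a1 := h.cont_lower n
  have a2 := h.cont_lower' n
  have a3 := h.cont_upper n
  have a4 := h.cont_upper' n
  have ho := om_mul_conj a
  have hs := sPow_mul_conj N k
  change _ = om a * _ * _ at a2
  change _ = om a * _ at a3
  change om a * _ = _ at a4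
  fin_cases j
  · exact ⟨rfl, rfl⟩
  · refine ⟨a1.symm, ?_⟩
    change u (n, 1) 1 = (starRingEnd ℂ) (om a) * u (n + 1, 0) 0
    rw [a3]
    linear_combination -u (n, 1) 1 * ho
  · refine ⟨(a3.trans a4).symm, ?_⟩
    change u (n, 2) 1 = (starRingEnd ℂ) (om a * sPow N k) * u (n, 0) 1
    rw [a1, a2, map_mul]
    linear_combination (-u (n, 2) 1) * ho -
      u (n, 2) 1 * (om a * (starRingEnd ℂ) (om a)) * hs

/-- Given the vertex values, the Kirchhoff conditions are two equations per cell. -/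
theorem kirchhoff_iff {u u' : Edge → ℝ → ℂ} {th th' ph ph' : ℂ} (hW : th * ph' - th' * ph = 1)
    (hph : ph ≠ 0) {l l' : Edge → ℂ} (h1 : ∀ e, u e 1 = u e 0 * th + u' e 0 * ph + l e)
    (h2 : ∀ e, u' e 1 = u e 0 * th' + u' e 0 * ph' + l' e) {x y : ℤ → ℂ}
    (hs : ∀ e, u e 0 = startVal x y e) (he : ∀ e, u e 1 = endVal N a k x y e) :
    Kirchhoff N a k u u' ↔
      (∀ n, x n + kap N a k * x (n + 1) - (2 * ph' + th) * y n =
        l (n, 1) - (ph' * l (n, 0) - ph * l' (n, 0)) -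
          om a * sPow N k * (ph' * l (n, 2) - ph * l' (n, 2))) ∧
      (∀ n, y (n + 1) + (starRingEnd ℂ) (kap N a k) * y n - (2 * th + ph') * x (n + 1) =
        l (n + 1, 0) - om a * (ph' * l (n, 1) - ph * l' (n, 1)) + l (n, 2)) := by
  have ho := om_mul_conj a
  have hS := sPow_mul_conj N k
  have s0 : ∀ n, u (n, 0) 0 = x n := fun n => hs (n, 0)
  have s1 : ∀ n, u (n, 1) 0 = y n := fun n => hs (n, 1)
  have s2 : ∀ n, u (n, 2) 0 = x (n + 1) := fun n => hs (n, 2)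
  have e0 : ∀ n, u (n, 0) 1 = y n := fun n => he (n, 0)
  have e1 : ∀ n, u (n, 1) 1 = (starRingEnd ℂ) (om a) * x (n + 1) := fun n => he (n, 1)
  have e2 : ∀ n, u (n, 2) 1 = (starRingEnd ℂ) (om a) * (starRingEnd ℂ) (sPow N k) * y n :=
    fun n => (he (n, 2)).trans (by simp [endVal])
  -- The slopes at both ends in terms of the end values, kept multiplied by `ph`. The numbers `l e`,
  -- `l' e` are the inhomogeneous contributions at the far end, and the Wronskian is needed only for
  -- the slope there.
  have d0 : ∀ e, ph * u' e 0 = u e 1 - u e 0 * th - l e := fun e => by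
    linear_combination -h1 e
  have d1 : ∀ e, ph * u' e 1 = ph' * u e 1 - u e 0 - ph' * l e + ph * l' e := fun e => by
    linear_combination ph * h2 e - ph' * h1 e - u e 0 * hW
  have hkap : kap N a k = (starRingEnd ℂ) (om a) + om a * sPow N k := rfl
  have hkap' : (starRingEnd ℂ) (kap N a k) =
      om a + (starRingEnd ℂ) (om a) * (starRingEnd ℂ) (sPow N k) := by rw [conj_kap', map_mul]
  constructor
  · intro h
    refine ⟨fun n => ?_, fun n => ?_⟩
    · have f := h.flux_lower n
      change -u' (n, 0) 1 + u' (n, 1) 0 - om a * sPow N k * u' (n, 2) 1 = 0 at f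
      have b0 := d1 (n, 0)
      have b1 := d0 (n, 1)
      have b2 := d1 (n, 2)
      rw [s0, e0] at b0
      rw [s1, e1] at b1
      rw [s2, e2] at b2
      rw [hkap]
      linear_combination ph * f + b0 - b1 + om a * sPow N k * b2 +
        ph' * y n * ho + ph' * y n * (om a * (starRingEnd ℂ) (om a)) * hS
    · have f := h.flux_upper n
      change u' (n + 1, 0) 0 - om a * u' (n, 1) 1 + u' (n, 2) 0 = 0 at f
      have b0 := d0 (n + 1, 0)
      have b1 := d1 (n, 1)
      have b2 := d0 (n, 2)
      rw [s0, e0] at b0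
      rw [s1, e1] at b1
      rw [s2, e2] at b2
      rw [hkap']
      linear_combination ph * f - b0 + om a * b1 - b2 + ph' * x (n + 1) * ho
  · rintro ⟨E1, E2⟩
    refine ⟨fun n => ?_, fun n => ?_, fun n => ?_, fun n => ?_, fun n => ?_, fun n => ?_⟩
    · rw [e0, s1]
    · change _ = om a * _ * _
      rw [s1, e2]
      linear_combination -y n * ho - y n * (om a * (starRingEnd ℂ) (om a)) * hS
    · change _ = om a * _
      rw [s0, e1]
      linear_combination -x (n + 1) * ho
    · change om a * _ = _
      rw [s2, e1]
      linear_combination x (n + 1) * ho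
    · change -u' (n, 0) 1 + u' (n, 1) 0 - om a * sPow N k * u' (n, 2) 1 = 0
      have b0 := d1 (n, 0)
      have b1 := d0 (n, 1)
      have b2 := d1 (n, 2)
      rw [s0, e0] at b0
      rw [s1, e1] at b1
      rw [s2, e2] at b2
      have E := E1 n
      rw [hkap] at E
      apply (mul_eq_zero.1 _).resolve_left hph
      linear_combination E - b0 + b1 - om a * sPow N k * b2 -
        ph' * y n * ho - ph' * y n * (om a * (starRingEnd ℂ) (om a)) * hS
    · change u' (n + 1, 0) 0 - om a * u' (n, 1) 1 + u' (n, 2) 0 = 0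
      have b0 := d0 (n + 1, 0)
      have b1 := d1 (n, 1)
      have b2 := d0 (n, 2)
      rw [s0, e0] at b0
      rw [s1, e1] at b1
      rw [s2, e2] at b2
      have E := E2 n
      rw [hkap'] at E
      apply (mul_eq_zero.1 _).resolve_left hph
      linear_combination E + b0 - om a * b1 + b2 - ph' * x (n + 1) * ho

/-- The initial slopes that produce prescribed vertex values. -/
def slope (q : ℝ → ℝ) (N : ℕ) (a : ℝ) (k : ℤ) (lam : ℂ) (x y : ℤ → ℂ) (l : Edge → ℂ) (e : Edge) :
    ℂ :=
  (endVal N a k x y e - startVal x y e * theta1 q lam - l e) / phi1 q lam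

/-- A family of edge solutions with vertex values solving the vertex equations satisfies the
Kirchhoff conditions. -/
theorem kirchhoff_edgeSol (hq : MemLp q 2 edgeMeasure) {lam : ℂ} (hph : phi1 q lam ≠ 0)
    (g : Edge → EdgeL2) {l l' : Edge → ℂ} (hl : l = fun e => ext (edgeSol hq lam (0, 0, g e)) 1)
    (hl' : l' = fun e => ext (edgeSol' hq lam (0, 0, g e)) 1) {x y : ℤ → ℂ}
    (E1 : ∀ n, x n + kap N a k * x (n + 1) - bigP q lam * y n =
        l (n, 1) - (phi1' q lam * l (n, 0) - phi1 q lam * l' (n, 0)) -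
          om a * sPow N k * (phi1' q lam * l (n, 2) - phi1 q lam * l' (n, 2)))
    (E2 : ∀ n, y (n + 1) + (starRingEnd ℂ) (kap N a k) * y n - bigQ q lam * x (n + 1) =
        l (n + 1, 0) - om a * (phi1' q lam * l (n, 1) - phi1 q lam * l' (n, 1)) + l (n, 2)) :
    Kirchhoff N a k
      (fun e => ext (edgeSol hq lam (startVal x y e, slope q N a k lam x y l e, g e)))
      (fun e => ext (edgeSol' hq lam (startVal x y e, slope q N a k lam x y l e, g e))) := by
  refine (kirchhoff_iff (wronskian hq lam) hph (l := l) (l' := l') (x := x) (y := y)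
    (fun e => ?_) (fun e => ?_) (fun e => ?_) (fun e => ?_)).2 ⟨E1, E2⟩
  · simp only [edgeSol_zero, edgeSol'_zero, hl]
    exact edgeSol_one hq lam _ _ _
  · simp only [edgeSol_zero, edgeSol'_zero, hl']
    exact edgeSol'_one hq lam _ _ _
  · simp only [edgeSol_zero]
  · have : l e = ext (edgeSol hq lam (0, 0, g e)) 1 := by rw [hl]
    rw [edgeSol_one hq lam, ← this, slope]
    field_simp
    ring

end

section

variable {q : ℝ → ℝ} {N : ℕ} {a : ℝ} {k : ℤ}

/-! ### Solutions on the graph and Bloch solutions -/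

theorem ext_edgeSol_zero (hq : MemLp q 2 edgeMeasure) (lam : ℂ) (t : ℝ) :
    ext (edgeSol hq lam (0, 0, 0)) t = 0 := by
  have : ((0, 0, 0) : ℂ × ℂ × EdgeL2) = 0 := rfl
  rw [this, map_zero, ext_zero]

theorem ext_edgeSol'_zero (hq : MemLp q 2 edgeMeasure) (lam : ℂ) (t : ℝ) :
    ext (edgeSol' hq lam (0, 0, 0)) t = 0 := by
  have : ((0, 0, 0) : ℂ × ℂ × EdgeL2) = 0 := rfl
  rw [this, map_zero, ext_zero]

theorem isGraphSolution_edgeSol (hq : MemLp q 2 edgeMeasure) {lam : ℂ} (hph : phi1 q lam ≠ 0)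
    {x y : ℤ → ℂ} (E1 : ∀ n, x n + kap N a k * x (n + 1) - bigP q lam * y n = 0)
    (E2 : ∀ n, y (n + 1) + (starRingEnd ℂ) (kap N a k) * y n - bigQ q lam * x (n + 1) = 0) :
    IsGraphSolution q N a k lam
      (fun e => ext (edgeSol hq lam (startVal x y e, slope q N a k lam x y 0 e, 0)))
      (fun e => ext (edgeSol' hq lam (startVal x y e, slope q N a k lam x y 0 e, 0))) :=
  ⟨fun e => isSolution_edgeSol hq lam _ _, kirchhoff_edgeSol hq hph (fun _ => 0) (l := 0) (l' := 0)
    (funext fun _ => (ext_edgeSol_zero hq lam 1).symm)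
    (funext fun _ => (ext_edgeSol'_zero hq lam 1).symm)
    (fun n => by rw [E1]; simp) fun n => by rw [E2]; simp⟩

/-- Vertex equations for solutions on the graph. -/
theorem IsGraphSolution.vertex_equations (hq : MemLp q 2 edgeMeasure) {lam : ℂ}
    (hph : phi1 q lam ≠ 0) {u u' : Edge → ℝ → ℂ} (h : IsGraphSolution q N a k lam u u') (n : ℤ) :
    u (n, 0) 0 + kap N a k * u (n + 1, 0) 0 - bigP q lam * u (n, 0) 1 = 0 ∧
      u (n + 1, 0) 1 + (starRingEnd ℂ) (kap N a k) * u (n, 0) 1 -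
        bigQ q lam * u (n + 1, 0) 0 = 0 := by
  have := (kirchhoff_iff (u := u) (u' := u') (N := N) (a := a) (k := k) (wronskian hq lam) hph
    (l := 0) (l' := 0)
    (fun e => by rw [((h.solves e).at_one hq).1]; simp)
    (fun e => by rw [((h.solves e).at_one hq).2]; simp)
    (fun e => (h.kirchhoff.vertex_values e).1)
    (fun e => (h.kirchhoff.vertex_values e).2)).1 h.kirchhoff
  have h1 := this.1 n
  have h2 := this.2 n
  simp only [Pi.zero_apply, mul_zero, sub_zero, add_zero] at h1 h2
  exact ⟨h1, h2⟩

/-- Green's identity for `u` and its conjugate, summed over a cell. The boundary form is multiplied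
by `|τ|² = 1` from one cell to the next, so the boundary terms cancel and the `L²` norm on the cell
vanishes. -/
theorem IsGraphSolution.cell_eq_zero (hq : MemLp q 2 edgeMeasure) {lam : ℂ} (hl : lam.im ≠ 0)
    {u u' : Edge → ℝ → ℂ} (h : IsGraphSolution q N a k lam u u') {τ : ℂ} (hτ : ‖τ‖ = 1)
    (h1 : u (0 + 1, 0) 0 = τ * u (0, 0) 0) (h2 : u' (0 + 1, 0) 0 = τ * u' (0, 0) 0) (j : Fin 3) :
    ∀ t ∈ Set.Icc (0 : ℝ) 1, u (0, j) t = 0 := by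
  have hne : lam - (starRingEnd ℂ) lam ≠ 0 := by
    rw [Complex.sub_conj]
    simpa using hl
  have hττ : τ * (starRingEnd ℂ) τ = 1 := by
    rw [Complex.mul_conj, Complex.normSq_eq_norm_sq, hτ]
    simp
  have hs := h.kirchhoff.sum_bdry h.kirchhoff 0
  have he : ∀ j : Fin 3, (lam - (starRingEnd ℂ) lam) *
      ((∫ t in (0 : ℝ)..1, ‖u (0, j) t‖ ^ 2 : ℝ) : ℂ) =
      -(bdry (u (0, j)) (u' (0, j)) (u (0, j)) (u' (0, j)) 1 -
        bdry (u (0, j)) (u' (0, j)) (u (0, j)) (u' (0, j)) 0) := by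
    intro j
    rw [(h.solves (0, j)).energy hq, bdry, bdry]
    ring
  have hb : bdry (u (0 + 1, 0)) (u' (0 + 1, 0)) (u (0 + 1, 0)) (u' (0 + 1, 0)) 0 =
      bdry (u (0, 0)) (u' (0, 0)) (u (0, 0)) (u' (0, 0)) 0 := by
    rw [bdry, bdry, h1, h2, map_mul, map_mul]
    linear_combination ((starRingEnd ℂ) (u (0, 0) 0) * u' (0, 0) 0 -
      (starRingEnd ℂ) (u' (0, 0) 0) * u (0, 0) 0) * hττ
  rw [hb, sub_self, ← neg_eq_zero, ← Finset.sum_neg_distrib] at hs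
  simp only [← he] at hs
  rw [← Finset.mul_sum, ← Complex.ofReal_sum] at hs
  have h3 := Complex.ofReal_eq_zero.1 ((mul_eq_zero.1 hs).resolve_left hne)
  have h4 : ∀ i ∈ (Finset.univ : Finset (Fin 3)), 0 ≤ ∫ t in (0 : ℝ)..1, ‖u (0, i) t‖ ^ 2 :=
    fun i _ => intervalIntegral.integral_nonneg zero_le_one fun t _ => sq_nonneg _
  have h5 := (Finset.sum_eq_zero_iff_of_nonneg h4).1 h3 j (Finset.mem_univ j)
  exact eq_zero_of_integral_norm_sq (fun t ht => ((h.solves (0, j)).deriv_eq t ht).continuousWithinAt)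
    h5.le

theorem startVal_bloch {τ x y : ℂ} (hτ : τ ≠ 0) (n : ℤ) (j : Fin 3) :
    startVal (fun n => τ ^ n * x) (fun n => τ ^ n * y) (n, j) =
      τ ^ n * ![x, y, τ * x] j := by
  fin_cases j
  · rfl
  · rfl
  · change τ ^ (n + 1) * x = τ ^ n * (τ * x)
    rw [zpow_add_one₀ hτ]
    ring

theorem endVal_bloch {τ x y : ℂ} (hτ : τ ≠ 0) (n : ℤ) (j : Fin 3) :
    endVal N a k (fun n => τ ^ n * x) (fun n => τ ^ n * y) (n, j) =
      τ ^ n * ![y, (starRingEnd ℂ) (om a) * (τ * x), (starRingEnd ℂ) (om a * sPow N k) * y] j := by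
  fin_cases j
  · rfl
  · change _ * (τ ^ (n + 1) * x) = τ ^ n * (_ * (τ * x))
    rw [zpow_add_one₀ hτ]
    ring
  · change _ * (τ ^ n * y) = τ ^ n * (_ * y)
    ring

/-- The slopes of a Bloch solution on the cell `n = 0`. -/
def blochSlope (q : ℝ → ℝ) (N : ℕ) (a : ℝ) (k : ℤ) (lam τ x y : ℂ) (j : Fin 3) : ℂ :=
  (![y, (starRingEnd ℂ) (om a) * (τ * x), (starRingEnd ℂ) (om a * sPow N k) * y] j -
    ![x, y, τ * x] j * theta1 q lam) / phi1 q lam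

theorem slope_bloch {lam τ x y : ℂ} (hτ : τ ≠ 0) (n : ℤ) (j : Fin 3) :
    slope q N a k lam (fun n => τ ^ n * x) (fun n => τ ^ n * y) 0 (n, j) =
      τ ^ n * blochSlope q N a k lam τ x y j := by
  rw [slope, startVal_bloch hτ, endVal_bloch hτ, blochSlope, Pi.zero_apply]
  ring

theorem isGraphSolution_bloch (hq : MemLp q 2 edgeMeasure) {lam : ℂ} (hph : phi1 q lam ≠ 0)
    {τ x y : ℂ} (hτ : τ ≠ 0) (E1 : (1 + kap N a k * τ) * x = bigP q lam * y)
    (E2 : (τ + (starRingEnd ℂ) (kap N a k)) * y = bigQ q lam * τ * x) :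
    IsGraphSolution q N a k lam
      (fun e => ext (edgeSol hq lam (τ ^ e.1 * ![x, y, τ * x] e.2,
        τ ^ e.1 * blochSlope q N a k lam τ x y e.2, 0)))
      (fun e => ext (edgeSol' hq lam (τ ^ e.1 * ![x, y, τ * x] e.2,
        τ ^ e.1 * blochSlope q N a k lam τ x y e.2, 0))) := by
  have := isGraphSolution_edgeSol (N := N) (a := a) (k := k) hq hph
    (x := fun n => τ ^ n * x) (y := fun n => τ ^ n * y)
    (fun n => by rw [zpow_add_one₀ hτ]; linear_combination τ ^ n * E1)
    (fun n => by rw [zpow_add_one₀ hτ]; linear_combination τ ^ n * E2)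
  have h1 : ∀ e : Edge, startVal (fun n => τ ^ n * x) (fun n => τ ^ n * y) e =
      τ ^ e.1 * ![x, y, τ * x] e.2 := fun e => startVal_bloch hτ e.1 e.2
  have h2 : ∀ e : Edge, slope q N a k lam (fun n => τ ^ n * x) (fun n => τ ^ n * y) 0 e =
      τ ^ e.1 * blochSlope q N a k lam τ x y e.2 := fun e => slope_bloch hτ e.1 e.2
  simp only [h1, h2] at this
  exact this

/-- A value of `w` in `[-1,1]` yields a unimodular multiplier, hence a nonzero Bloch solution, which
`IsGraphSolution.cell_eq_zero` forbids for non-real `lam`. -/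
theorem wK_ne_of_im (hq : MemLp q 2 edgeMeasure) (hc : cK N a k ≠ 0) {lam : ℂ}
    (hl : lam.im ≠ 0) : ∀ r ∈ Set.Icc (-1 : ℝ) 1, wK q N a k lam ≠ r := by
  intro r hr hw
  have hph := phi1_ne_zero_of_im hq hl
  -- A root of `σ² - 2rσ + 1` on the unit circle, since `|r| ≤ 1`.
  set σ : ℂ := (r : ℂ) + √(1 - r ^ 2) * Complex.I with hσ
  have hsq : (√(1 - r ^ 2) : ℂ) ^ 2 = 1 - (r : ℂ) ^ 2 := by
    have : √(1 - r ^ 2) ^ 2 = 1 - r ^ 2 := Real.sq_sqrt (by nlinarith [hr.1, hr.2])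
    exact_mod_cast this
  have hσ2 : σ ^ 2 + 1 = 2 * r * σ := by
    rw [hσ]
    linear_combination hsq * Complex.I ^ 2 + (1 - (r : ℂ) ^ 2) * Complex.I_sq
  have hσn : ‖σ‖ = 1 := by
    have h1 : Complex.normSq σ = 1 := by
      rw [hσ, Complex.normSq_add_mul_I]
      have : √(1 - r ^ 2) ^ 2 = 1 - r ^ 2 := Real.sq_sqrt (by nlinarith [hr.1, hr.2])
      linarith
    rw [Complex.normSq_eq_norm_sq] at h1
    nlinarith [norm_nonneg σ]
  set τ : ℂ := (starRingEnd ℂ) (half N k) * σ with hτd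
  have hτn : ‖τ‖ = 1 := by rw [hτd, norm_mul, RCLike.norm_conj, norm_half, hσn, one_mul]
  have hτ0 : τ ≠ 0 := by
    intro h
    rw [h, norm_zero] at hτn
    exact zero_ne_one hτn
  have hroot : half N k * τ ^ 2 + (starRingEnd ℂ) (half N k) = 2 * wK q N a k lam * τ := by
    rw [hw, hτd]
    linear_combination (starRingEnd ℂ) (half N k) * hσ2 +
      (starRingEnd ℂ) (half N k) * σ ^ 2 * half_mul_conj N k
  have hD := (root_iff hq hc lam τ).2 hroot
  obtain ⟨x, y, hxy, E1, E2⟩ : ∃ x y : ℂ, (x ≠ 0 ∨ y ≠ 0) ∧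
      (1 + kap N a k * τ) * x = bigP q lam * y ∧
      (τ + (starRingEnd ℂ) (kap N a k)) * y = bigQ q lam * τ * x := by
    -- The `2 × 2` Bloch system is singular and `(P, 1 + κ τ)` lies in its kernel. If that vector
    -- vanishes, `(0, 1)` does, because `|τ| = 1` turns `1 + κ τ = 0` into `τ + κ̄ = 0`.
    by_cases h0 : bigP q lam = 0 ∧ 1 + kap N a k * τ = 0
    · refine ⟨0, 1, Or.inr one_ne_zero, by rw [h0.1]; ring, ?_⟩
      have h1 := congrArg (starRingEnd ℂ) h0.2
      have h2 : τ * (starRingEnd ℂ) τ = 1 := by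
        rw [Complex.mul_conj, Complex.normSq_eq_norm_sq, hτn]
        simp
      simp only [map_add, map_one, map_mul, map_zero] at h1
      linear_combination τ * h1 - (starRingEnd ℂ) (kap N a k) * h2
    · refine ⟨bigP q lam, 1 + kap N a k * τ, ?_, by ring, by linear_combination hD⟩
      by_contra! h
      exact h0 h
  have hG := isGraphSolution_bloch hq hph hτ0 E1 E2
  have hz := hG.cell_eq_zero hq hl hτn (by simp) (by simp)
  have hx := hz 0 0 zero_mem_Icc
  have hy := hz 1 0 zero_mem_Icc
  simp only [edgeSol_zero] at hx hy
  rcases hxy with h | h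
  · exact h (by simpa using hx)
  · exact h (by simpa using hy)

/-! ### Self-adjointness and the resolvent set -/

theorem summable_edge {h : Edge → ℝ} (h0 : ∀ e, 0 ≤ h e)
    (hs : ∀ j, Summable fun n => h (n, j)) : Summable h := by
  rw [← (Equiv.prodComm (Fin 3) ℤ).summable_iff]
  exact (summable_prod_of_nonneg fun e => h0 _).2 ⟨hs, Summable.of_finite⟩

theorem summable_norm_sq_functional (L : EdgeL2 →L[ℂ] ℂ) (g : L2Graph) (j : Fin 3) :
    Summable fun n : ℤ => ‖L (g (n, j))‖ ^ 2 := by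
  refine Summable.of_nonneg_of_le (fun _ => sq_nonneg _) (fun n => ?_)
    ((summable_norm_sq_row g j).mul_left (‖L‖ ^ 2))
  rw [← mul_pow]
  exact pow_le_pow_left₀ (norm_nonneg _) (L.le_opNorm _) 2

theorem summable_startVal {x y : ℤ → ℂ} (hx : Summable fun n => ‖x n‖ ^ 2)
    (hy : Summable fun n => ‖y n‖ ^ 2) : Summable fun e => ‖startVal x y e‖ ^ 2 := by
  refine summable_edge (fun _ => sq_nonneg _) fun j => ?_
  fin_cases j
  · exact hx
  · exact hy
  · exact summable_norm_sq_shift hx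

theorem summable_endVal {x y : ℤ → ℂ} (hx : Summable fun n => ‖x n‖ ^ 2)
    (hy : Summable fun n => ‖y n‖ ^ 2) : Summable fun e => ‖endVal N a k x y e‖ ^ 2 := by
  refine summable_edge (fun _ => sq_nonneg _) fun j => ?_
  fin_cases j
  · exact hy
  · exact summable_norm_sq_mul _ (summable_norm_sq_shift hx)
  · exact summable_norm_sq_mul _ hy

theorem summable_slope {x y : ℤ → ℂ} (lam : ℂ) (hx : Summable fun n => ‖x n‖ ^ 2)
    (hy : Summable fun n => ‖y n‖ ^ 2) {l : Edge → ℂ} (hl : Summable fun e => ‖l e‖ ^ 2) :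
    Summable fun e => ‖slope q N a k lam x y l e‖ ^ 2 := by
  have h1 := summable_norm_sq_mul (phi1 q lam)⁻¹ (summable_norm_sq_add
    (summable_endVal (N := N) (a := a) (k := k) hx hy)
    (summable_norm_sq_add (summable_norm_sq_mul (-theta1 q lam) (summable_startVal hx hy))
      (summable_norm_sq_mul (-1) hl)))
  refine h1.congr fun e => ?_
  rw [slope]
  congr 2
  ring

/-- The inhomogeneity enters the vertex equations only through the end values `l`, `l'` of the
particular solutions with zero initial data. These are square summable, so the `ℓ²` theory of the
vertex system applies. -/
theorem exists_HRel (hq : MemLp q 2 edgeMeasure) (hc : cK N a k ≠ 0) {lam : ℂ}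
    (hph : phi1 q lam ≠ 0) (hw : ∀ x ∈ Set.Icc (-1 : ℝ) 1, wK q N a k lam ≠ x) (g : L2Graph) :
    ∃ f, HRel q N a k f (g + lam • f) := by
  set L : EdgeL2 →L[ℂ] ℂ := (evalL ⟨1, one_mem_Icc⟩).comp ((edgeSol hq lam).comp
    ((ContinuousLinearMap.inr ℂ ℂ (ℂ × EdgeL2)).comp (ContinuousLinearMap.inr ℂ ℂ EdgeL2)))
  set L' : EdgeL2 →L[ℂ] ℂ := (evalL ⟨1, one_mem_Icc⟩).comp ((edgeSol' hq lam).comp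
    ((ContinuousLinearMap.inr ℂ ℂ (ℂ × EdgeL2)).comp (ContinuousLinearMap.inr ℂ ℂ EdgeL2)))
  set l : Edge → ℂ := fun e => L (g e) with hl
  set l' : Edge → ℂ := fun e => L' (g e) with hl'
  have hl1 : l = fun e => ext (edgeSol hq lam (0, 0, g e)) 1 := by
    funext e
    rw [ext_of_mem _ one_mem_Icc]
    rfl
  have hl1' : l' = fun e => ext (edgeSol' hq lam (0, 0, g e)) 1 := by
    funext e
    rw [ext_of_mem _ one_mem_Icc]
    rfl
  have sl : ∀ j, Summable fun n => ‖l (n, j)‖ ^ 2 := summable_norm_sq_functional L g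
  have sl' : ∀ j, Summable fun n => ‖l' (n, j)‖ ^ 2 := summable_norm_sq_functional L' g
  have hsl : Summable fun e => ‖l e‖ ^ 2 := summable_edge (fun _ => sq_nonneg _) sl
  clear_value l l' L L'
  have sm : ∀ j, Summable fun n => ‖phi1' q lam * l (n, j) + -phi1 q lam * l' (n, j)‖ ^ 2 :=
    fun j => summable_norm_sq_add (summable_norm_sq_mul _ (sl j)) (summable_norm_sq_mul _ (sl' j))
  have hA : Summable fun n => ‖l (n, 1) - (phi1' q lam * l (n, 0) - phi1 q lam * l' (n, 0)) -
      om a * sPow N k * (phi1' q lam * l (n, 2) - phi1 q lam * l' (n, 2))‖ ^ 2 := by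
    refine (summable_norm_sq_add (sl 1) (summable_norm_sq_add (summable_norm_sq_mul (-1) (sm 0))
      (summable_norm_sq_mul (-(om a * sPow N k)) (sm 2)))).congr fun n => ?_
    congr 2
    ring
  have hB : Summable fun n => ‖l (n + 1, 0) -
      om a * (phi1' q lam * l (n, 1) - phi1 q lam * l' (n, 1)) + l (n, 2)‖ ^ 2 := by
    refine (summable_norm_sq_add (summable_norm_sq_shift (sl 0))
      (summable_norm_sq_add (summable_norm_sq_mul (-om a) (sm 1)) (sl 2))).congr fun n => ?_
    congr 2
    ring
  obtain ⟨x, y, hx, hy, E1, E2⟩ := exists_vertex_solution (kap_ne_zero hc)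
    (norm_ne_one_of_root hq hc hw) hA hB
  obtain ⟨f, -, hf⟩ := HRel_of_edgeSol hq lam (summable_startVal hx hy)
    (summable_slope (q := q) (N := N) (a := a) (k := k) lam hx hy hsl) g
    (kirchhoff_edgeSol hq hph g hl1 hl1' E1 E2)
  exact ⟨f, hf⟩

theorem ae_eq_of_HRel_smul {lam : ℂ} {f w : L2Graph} {u : ℝ → ℂ} {e : Edge}
    (hf : f e =ᵐ[edgeMeasure] u)
    (hg : (lam • f : L2Graph) e =ᵐ[edgeMeasure] fun t => -(w e t) + (q t : ℂ) * u t) :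
    w e =ᵐ[edgeMeasure] fun t => ((q t : ℂ) - lam) * u t := by
  have hsmul : ((lam • f : L2Graph) e : ℝ → ℂ) =ᵐ[edgeMeasure] lam • (f e : ℝ → ℂ) :=
    Lp.coeFn_smul lam (f e)
  filter_upwards [hsmul, hf, hg] with t h1 h2 h3
  rw [h1, Pi.smul_apply, h2, smul_eq_mul] at h3
  linear_combination h3

/-- An eigenfunction is represented by a solution on the graph with square summable values. -/
theorem exists_isGraphSolution_of_HRel {lam : ℂ} {f : L2Graph} (h : HRel q N a k f (lam • f)) :
    ∃ u u' : Edge → ℝ → ℂ, IsGraphSolution q N a k lam u u' ∧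
      (∀ e, f e =ᵐ[edgeMeasure] u e) ∧ Summable fun e => ‖u e 0‖ ^ 2 := by
  obtain ⟨u, u', w, hW, hK, hf, hg⟩ := h
  refine ⟨u, u', ⟨fun e => (hW e).isSolution (ae_eq_of_HRel_smul (hf e) (hg e)), hK⟩, hf, ?_⟩
  obtain ⟨C, hC, hT⟩ := exists_trace_bound_Lp
  refine Summable.of_nonneg_of_le (fun _ => sq_nonneg _) (fun e => ?_)
    (((summable_norm_sq f).add (summable_norm_sq w)).mul_left (C ^ 2 * 2))
  have h1 := (hT (hW e) (hf e)).1
  calc ‖u e 0‖ ^ 2 ≤ (C * (‖f e‖ + ‖w e‖)) ^ 2 := pow_le_pow_left₀ (norm_nonneg _) h1 2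
    _ = C ^ 2 * (‖f e‖ + ‖w e‖) ^ 2 := by ring
    _ ≤ C ^ 2 * (2 * (‖f e‖ ^ 2 + ‖w e‖ ^ 2)) :=
      mul_le_mul_of_nonneg_left (by nlinarith [sq_nonneg (‖f e‖ - ‖w e‖)]) (sq_nonneg C)
    _ = _ := by ring

/-- A solution on the graph whose vertex values vanish is zero. -/
theorem IsGraphSolution.eq_zero (hq : MemLp q 2 edgeMeasure) {lam : ℂ} (hph : phi1 q lam ≠ 0)
    {u u' : Edge → ℝ → ℂ} (h : IsGraphSolution q N a k lam u u')
    (h0 : ∀ n, u (n, 0) 0 = 0) (h1 : ∀ n, u (n, 0) 1 = 0) (e : Edge) :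
    ∀ t ∈ Set.Icc (0 : ℝ) 1, u e t = 0 := by
  intro t ht
  obtain ⟨hs, he⟩ := h.kirchhoff.vertex_values e
  have hs0 : u e 0 = 0 := by
    rw [hs, funext h0, funext h1]
    obtain ⟨n, j⟩ := e
    fin_cases j <;> simp [startVal]
  have he0 : u e 1 = 0 := by
    rw [he, funext h0, funext h1]
    obtain ⟨n, j⟩ := e
    fin_cases j <;> simp [endVal]
  have h2 := ((h.solves e).at_one hq).1
  rw [hs0, he0, zero_mul, zero_add] at h2
  have h3 : u' e 0 = 0 := (mul_eq_zero.1 h2.symm).resolve_right hph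
  have h4 := ((h.solves e).eq_edgeSol hq t ht).1
  rw [h4, hs0, h3, ext_edgeSol_zero]

theorem eq_zero_of_edges {f : L2Graph} {u : Edge → ℝ → ℂ} (hf : ∀ e, f e =ᵐ[edgeMeasure] u e)
    (hu : ∀ e, ∀ t ∈ Set.Icc (0 : ℝ) 1, u e t = 0) : f = 0 := by
  apply lp.ext
  funext e
  change f e = (0 : Lp ℂ 2 edgeMeasure)
  rw [Lp.eq_zero_iff_ae_eq_zero]
  filter_upwards [hf e, ae_mem_Icc] with t h1 h2
  rw [h1, hu e t h2]
  rfl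

theorem eq_zero_of_HRel (hq : MemLp q 2 edgeMeasure) (hc : cK N a k ≠ 0) {lam : ℂ}
    (hph : phi1 q lam ≠ 0) (hw : ∀ x ∈ Set.Icc (-1 : ℝ) 1, wK q N a k lam ≠ x) {f : L2Graph}
    (h : HRel q N a k f (lam • f)) : f = 0 := by
  obtain ⟨u, u', hG, hf, hs⟩ := exists_isGraphSolution_of_HRel h
  have hrow : ∀ j : Fin 3, Summable fun n : ℤ => ‖u (n, j) 0‖ ^ 2 := fun j =>
    hs.comp_injective (i := fun n : ℤ => ((n, j) : Edge)) fun _ _ h => (Prod.mk.inj h).1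
  have hy : Summable fun n : ℤ => ‖u (n, 0) 1‖ ^ 2 := by
    refine (hrow 1).congr fun n => ?_
    rw [hG.kirchhoff.cont_lower]
  obtain ⟨h0, h1⟩ := vertex_solution_unique (kap_ne_zero hc) (norm_ne_one_of_root hq hc hw)
    (hrow 0) hy (fun n => (hG.vertex_equations hq hph n).1)
    (fun n => (hG.vertex_equations hq hph n).2)
  exact eq_zero_of_edges hf (hG.eq_zero hq hph h0 h1)

/-- Both conditions of `exists_HRel` hold automatically off the real axis. -/
theorem isSelfAdj_opH (hq : MemLp q 2 edgeMeasure) (hc : cK N a k ≠ 0) :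
    IsSelfAdj (opH q N a k) := by
  refine ⟨fun f g => (HRel_apply f).symm (HRel_apply g), fun z hz ψ => ?_⟩
  obtain ⟨f, hf⟩ := exists_HRel hq hc (phi1_ne_zero_of_im hq hz) (wK_ne_of_im hq hc hz) ψ
  obtain ⟨x, rfl, hx⟩ := exists_domain_of_HRel hf
  exact ⟨x, by rw [hx, add_sub_cancel_right]⟩

theorem inResolventOn_opH (hq : MemLp q 2 edgeMeasure) (hc : cK N a k ≠ 0) {lam : ℂ}
    (hph : phi1 q lam ≠ 0) (hw : ∀ x ∈ Set.Icc (-1 : ℝ) 1, wK q N a k lam ≠ x) :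
    InResolventOn (opH q N a k) Set.univ lam := by
  refine (isSelfAdj_opH hq hc).inResolventOn_univ lam (fun g => ?_) fun f hf => ?_
  · obtain ⟨f, hf⟩ := exists_HRel hq hc hph hw g
    obtain ⟨x, rfl, hx⟩ := exists_domain_of_HRel hf
    exact ⟨x, by rw [hx, add_sub_cancel_right]⟩
  · have h := HRel_apply f
    rw [sub_eq_zero.1 hf] at h
    exact Subtype.ext (eq_zero_of_HRel hq hc hph hw h)

end

section

/-! ### Entire functions with real preimages of `[-1,1]` -/

/-- An entire function, real on the real axis, all of whose preimages of points of `[-1,1]` are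
real. -/
structure BandFunction (w : ℂ → ℂ) : Prop where
  diff : Differentiable ℂ w
  real : ∀ x : ℝ, ∃ y : ℝ, w x = y
  ne : ∀ z : ℂ, z.im ≠ 0 → ∀ r ∈ Set.Icc (-1 : ℝ) 1, w z ≠ r

/-- Local `n`-th root of a zero of order `n`, real on the real axis. -/
theorem exists_local_root {g : ℂ → ℂ} {x₀ : ℝ} (hg : AnalyticAt ℂ g x₀) (h0 : g x₀ ≠ 0) {n : ℕ}
    (hn : n ≠ 0) (hr : ∀ᶠ z in 𝓝 (x₀ : ℂ), z.im = 0 → (g z).im = 0) :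
    ∃ G : ℂ → ℂ, (𝓝 (0 : ℂ) ≤ Filter.map G (𝓝 (x₀ : ℂ))) ∧
      (∀ z, g z ≠ 0 → (z - x₀) ^ n * g z = g x₀ * G z ^ n) ∧
      ∀ᶠ z in 𝓝 (x₀ : ℂ), z.im = 0 → (G z).im = 0 := by
  -- The branch of the `n`-th root of `g / g x₀` with value `1` at `x₀`. The quotient is positive on
  -- the real axis near `x₀`, so the root is real there.
  set E : ℂ → ℂ := fun z => Complex.exp (Complex.log (g z / g x₀) / n) with hE
  have hn' : (n : ℂ) ≠ 0 := Nat.cast_ne_zero.2 hn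
  have hq : AnalyticAt ℂ (fun z => g z / g x₀) x₀ := hg.div analyticAt_const h0
  have hEa : AnalyticAt ℂ E x₀ := by
    refine AnalyticAt.cexp (AnalyticAt.div (hq.clog ?_) analyticAt_const hn')
    rw [div_self h0]
    exact Complex.one_mem_slitPlane
  have hE1 : E x₀ = 1 := by simp [hE, div_self h0]
  refine ⟨fun z => (z - x₀) * E z, ?_, fun z hz => ?_, ?_⟩
  -- `(z - x₀) E z` has derivative `1` at `x₀`, so it maps neighbourhoods of `x₀` onto
  -- neighbourhoods of `0`.
  · have hd : HasStrictDerivAt (fun z : ℂ => (z - x₀) * E z) 1 x₀ := by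
      have h1 : HasStrictDerivAt (fun z : ℂ => z - x₀) 1 x₀ :=
        (hasStrictDerivAt_id (x₀ : ℂ)).sub_const (x₀ : ℂ)
      have h2 := h1.mul hEa.hasStrictDerivAt
      simp only [sub_self, zero_mul, add_zero, one_mul, hE1] at h2
      exact h2
    have h2 := hd.map_nhds_eq one_ne_zero
    rw [h2, sub_self, zero_mul]
  · have h1 : E z ^ n = g z / g x₀ := by
      rw [hE, ← Complex.exp_nat_mul, mul_div_cancel₀ _ hn', Complex.exp_log (div_ne_zero hz h0)]
    rw [mul_pow, h1]
    field_simp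
  · have hpos : ∀ᶠ z in 𝓝 (x₀ : ℂ), 0 < (g z / g x₀).re := by
      have hc : ContinuousAt (fun z => (g z / g x₀).re) (x₀ : ℂ) :=
        Complex.continuous_re.continuousAt.comp hq.continuousAt
      refine hc.eventually (lt_mem_nhds ?_)
      dsimp only
      rw [div_self h0]
      norm_num
    have hg0 := hr.self_of_nhds (Complex.ofReal_im x₀)
    filter_upwards [hpos, hr] with z h1 h2 hz
    have h3 : g z / g x₀ = (((g z / g x₀).re : ℝ) : ℂ) := by
      apply Complex.ext
      · simp
      · rw [Complex.div_im, h2 hz, hg0]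
        simp
    have h4 : E z = ((Real.exp (Real.log (g z / g x₀).re / n) : ℝ) : ℂ) := by
      rw [Complex.ofReal_exp, Complex.ofReal_div, Complex.ofReal_log h1.le, ← h3, hE]
      rfl
    rw [h4, Complex.im_mul_ofReal]
    simp [hz]

namespace BandFunction

variable {w : ℂ → ℂ}

theorem eq_ofReal_re (h : BandFunction w) (x : ℝ) : w x = ((w x).re : ℂ) := by
  obtain ⟨y, hy⟩ := h.real x
  rw [hy, Complex.ofReal_re]

theorem not_eventually_const (h : BandFunction w) {x₀ : ℝ} {r : ℝ} (hr : r ∈ Set.Icc (-1 : ℝ) 1) :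
    ¬ ∀ᶠ z in 𝓝 (x₀ : ℂ), w z = r := by
  intro he
  obtain ⟨ε, hε, hb⟩ := Metric.eventually_nhds_iff.1 he
  refine h.ne (x₀ + ((ε / 2 : ℝ) : ℂ) * Complex.I) ?_ r hr (hb ?_)
  · simp [hε.ne']
  · rw [dist_eq_norm, add_sub_cancel_left, norm_mul, Complex.norm_I, mul_one, Complex.norm_real,
      Real.norm_of_nonneg (by linarith)]
    linarith

/-- Near a point of the closed band there are points of the open band. -/
theorem exists_near (h : BandFunction w) {x₀ r : ℝ} (hr : r ∈ Set.Icc (-1 : ℝ) 1)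
    (h0 : w x₀ = r) {ε : ℝ} (hε : 0 < ε) :
    ∃ x : ℝ, |x - x₀| < ε ∧ ∃ y ∈ Set.Ioo (-1 : ℝ) 1, w x = y := by
  -- Open mapping: points of `(-1,1)` close to `r` are attained close to `x₀`, and the points
  -- attaining them must be real.
  have h1 := ((h.diff.analyticAt (x₀ : ℂ)).eventually_constant_or_nhds_le_map_nhds).resolve_left
    (by rw [h0]; exact h.not_eventually_const hr)
  have h2 := h1 (Filter.image_mem_map (Metric.ball_mem_nhds (x₀ : ℂ) hε))
  rw [h0] at h2
  obtain ⟨δ, hδ, hb⟩ := Metric.mem_nhds_iff.1 h2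
  obtain ⟨y, hy, hyr⟩ : ∃ y ∈ Set.Ioo (-1 : ℝ) 1, |y - r| < δ := by
    obtain ⟨y, hy1, hy2⟩ := Metric.mem_closure_iff.1 (show r ∈ closure (Set.Ioo (-1 : ℝ) 1) by
      rw [closure_Ioo (by norm_num)]; exact hr) δ hδ
    exact ⟨y, hy1, by rwa [dist_comm, Real.dist_eq] at hy2⟩
  obtain ⟨z, hz, hzy⟩ := hb (show (y : ℂ) ∈ Metric.ball (r : ℂ) δ by
    rw [Metric.mem_ball, Complex.dist_eq, ← Complex.ofReal_sub, Complex.norm_real]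
    exact hyr)
  have him : z.im = 0 := by
    by_contra hne
    exact h.ne z hne y ⟨hy.1.le, hy.2.le⟩ hzy
  have hzr : z = (z.re : ℂ) := Complex.ext rfl (by simp [him])
  refine ⟨z.re, ?_, y, hy, by rw [← hzr]; exact hzy⟩
  rw [Metric.mem_ball, hzr, Complex.dist_eq, ← Complex.ofReal_sub, Complex.norm_real] at hz
  exact hz

/-- The local order of `w` at a point of the band, with a bound by the number of directions in which
`w` leaves the band. -/
theorem exists_order (h : BandFunction w) {x₀ r : ℝ} (hr : r ∈ Set.Icc (-1 : ℝ) 1)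
    (h0 : w x₀ = r) :
    ∃ n : ℕ, ∃ g : ℂ → ℂ, n ≠ 0 ∧ AnalyticAt ℂ g x₀ ∧ g x₀ ≠ 0 ∧
      (∀ᶠ z in 𝓝 (x₀ : ℂ), w z - r = (z - x₀) ^ n * g z) ∧
      ∃ γ : ℝ, γ ≠ 0 ∧ ∀ j : ℕ, 0 < j → j < n →
        ∃ ε > 0, ∀ s ∈ Set.Ioo (0 : ℝ) ε, r + s * γ * (-1) ^ j ∉ Set.Icc (-1 : ℝ) 1 := by
  have ha : AnalyticAt ℂ (fun z => w z - r) x₀ := (h.diff.analyticAt _).sub analyticAt_const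
  obtain ⟨n, g, hg, hg0, he⟩ := ha.exists_eventuallyEq_pow_smul_nonzero_iff.2 fun he =>
    h.not_eventually_const hr (he.mono fun z hz => sub_eq_zero.1 hz)
  simp only [smul_eq_mul] at he
  have hn : n ≠ 0 := by
    rintro rfl
    have := he.self_of_nhds
    rw [h0, sub_self, pow_zero, one_mul] at this
    exact hg0 this.symm
  have hcr : ContinuousAt (fun t : ℝ => (g (t : ℂ)).im) x₀ :=
    Complex.continuous_im.continuousAt.comp
      (ContinuousAt.comp (f := fun t : ℝ => (t : ℂ)) hg.continuousAt
        Complex.continuous_ofReal.continuousAt)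
  have het : ∀ᶠ t : ℝ in 𝓝 x₀, w t - r = ((t : ℂ) - x₀) ^ n * g t :=
    Complex.continuous_ofReal.continuousAt.eventually he
  -- Off `x₀` the cofactor is a quotient of real numbers; at `x₀` it is real by continuity.
  have hne : (fun t : ℝ => (g (t : ℂ)).im) =ᶠ[𝓝[≠] x₀] fun _ => 0 := by
    rw [Filter.EventuallyEq, eventually_nhdsWithin_iff]
    filter_upwards [het] with t ht htne
    have h1 : (((t - x₀ : ℝ) ^ n : ℝ) : ℂ) ≠ 0 := by
      rw [Complex.ofReal_ne_zero]
      exact pow_ne_zero _ (sub_ne_zero.2 htne)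
    have h2 : g t = (((w t).re - r) / (t - x₀) ^ n : ℝ) := by
      rw [h.eq_ofReal_re t] at ht
      push_cast at h1 ⊢
      rw [eq_div_iff h1, ht, mul_comm]
    rw [h2, Complex.ofReal_im]
  have hgr : (fun t : ℝ => (g (t : ℂ)).im) =ᶠ[𝓝 x₀] fun _ => 0 :=
    (hcr.eventuallyEq_nhds_iff_eventuallyEq_nhdsNE continuousAt_const).1 hne
  have hgz : ∀ᶠ z in 𝓝 (x₀ : ℂ), z.im = 0 → (g z).im = 0 := by
    have h1 : Filter.Tendsto Complex.re (𝓝 (x₀ : ℂ)) (𝓝 x₀) := by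
      simpa using Complex.continuous_re.tendsto (x₀ : ℂ)
    filter_upwards [h1.eventually hgr] with z hz him
    have hzr : z = (z.re : ℂ) := Complex.ext rfl (by simp [him])
    rw [hzr]
    exact hz
  obtain ⟨G, hG1, hG2, hG3⟩ := exists_local_root hg hg0 hn hgz
  have hg0r : g x₀ = ((g x₀).re : ℂ) :=
    Complex.ext rfl (by simpa using hgz.self_of_nhds (Complex.ofReal_im x₀))
  refine ⟨n, g, hn, hg, hg0, he, (g x₀).re, fun hz => hg0 (by rw [hg0r, hz, Complex.ofReal_zero]),
    fun j hj hjn => ?_⟩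
  have hset := hG1 (Filter.image_mem_map (he.and ((hg.continuousAt.eventually_ne hg0).and hG3)))
  obtain ⟨δ, hδ, hb⟩ := Metric.mem_nhds_iff.1 hset
  refine ⟨δ ^ n, pow_pos hδ n, fun s hs hmem => ?_⟩
  obtain ⟨ρ, hρ, hρs⟩ : ∃ ρ : ℝ, ρ ∈ Set.Ioo 0 δ ∧ ρ ^ n = s := by
    refine ⟨s ^ ((n : ℝ)⁻¹), ⟨Real.rpow_pos_of_pos hs.1 _, ?_⟩, Real.rpow_inv_natCast_pow hs.1.le hn⟩
    refine lt_of_pow_lt_pow_left₀ n hδ.le ?_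
    rw [Real.rpow_inv_natCast_pow hs.1.le hn]
    exact hs.2
  -- On the ray of angle `πj/n` the power `t ^ n = s (-1)^j` is real while `t` is not, as `0 < j <
  -- n`. The local root attains `t` at a point that cannot be real, and there `w` equals `r + s γ
  -- (-1)^j`, which must therefore lie outside `[-1,1]`.
  set t : ℂ := (ρ : ℂ) * Complex.exp (((Real.pi * j / n : ℝ) : ℂ) * Complex.I) with ht
  obtain ⟨z, ⟨hz1, hz2, hz3⟩, hzt⟩ := hb (show t ∈ Metric.ball (0 : ℂ) δ by
    rw [Metric.mem_ball, dist_zero_right, ht, norm_mul, Complex.norm_exp_ofReal_mul_I, mul_one,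
      Complex.norm_real, Real.norm_of_nonneg hρ.1.le]
    exact hρ.2)
  have hnpos : (0 : ℝ) < n := Nat.cast_pos.2 (Nat.pos_of_ne_zero hn)
  have htn : t ^ n = (s * (-1) ^ j : ℝ) := by
    rw [ht, mul_pow, ← Complex.exp_nat_mul, ← hρs]
    have : (n : ℂ) * (((Real.pi * j / n : ℝ) : ℂ) * Complex.I) = j * (Real.pi * Complex.I) := by
      push_cast
      have : (n : ℂ) ≠ 0 := Nat.cast_ne_zero.2 hn
      field_simp
    rw [this, Complex.exp_nat_mul, Complex.exp_pi_mul_I]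
    push_cast
    ring
  have htim : t.im ≠ 0 := by
    rw [ht, Complex.im_ofReal_mul, Complex.exp_ofReal_mul_I_im]
    have hj' : (0 : ℝ) < j := Nat.cast_pos.2 hj
    refine (mul_pos hρ.1 (Real.sin_pos_of_pos_of_lt_pi (by positivity) ?_)).ne'
    rw [div_lt_iff₀ hnpos]
    exact mul_lt_mul_of_pos_left (Nat.cast_lt.2 hjn) Real.pi_pos
  have hzim : z.im ≠ 0 := fun hzr => htim (by rw [← hzt]; exact hz3 hzr)
  refine h.ne z hzim _ hmem ?_
  have h5 := hG2 z hz2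
  rw [hzt, htn, ← hz1, hg0r] at h5
  push_cast at h5 ⊢
  linear_combination h5

/-- Order at least two would leave the direction `j = 1`, along which values close to `r` are
excluded from `[-1,1]`; this is impossible when `r` is an interior point. -/
theorem deriv_ne_zero (h : BandFunction w) {x₀ r : ℝ} (hr : r ∈ Set.Ioo (-1 : ℝ) 1)
    (h0 : w x₀ = r) : deriv w x₀ ≠ 0 := by
  obtain ⟨n, g, hn, hg, hg0, he, γ, hγ, hj⟩ := h.exists_order ⟨hr.1.le, hr.2.le⟩ h0
  have hn1 : n = 1 := by
    by_contra hne
    obtain ⟨ε, hε, hs⟩ := hj 1 one_pos (by omega)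
    have hc : ContinuousAt (fun s : ℝ => r + s * γ * (-1) ^ 1) 0 := by fun_prop
    have h1 : ∀ᶠ s : ℝ in 𝓝 0, r + s * γ * (-1) ^ 1 ∈ Set.Icc (-1 : ℝ) 1 :=
      hc.eventually_mem (by simpa using Icc_mem_nhds hr.1 hr.2)
    obtain ⟨s, h2, h3⟩ := ((h1.filter_mono nhdsWithin_le_nhds).and (Ioo_mem_nhdsGT hε)).exists
    exact hs s h3 h2
  subst hn1
  have hd : HasDerivAt (fun z : ℂ => (r : ℂ) + (z - x₀) ^ 1 * g z) (g x₀) x₀ := by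
    have h1 : HasDerivAt (fun z : ℂ => z - x₀) 1 x₀ := (hasDerivAt_id (x₀ : ℂ)).sub_const (x₀ : ℂ)
    have h2 := (h1.mul hg.differentiableAt.hasDerivAt).const_add (r : ℂ)
    simp only [sub_self, zero_mul, add_zero, one_mul] at h2
    simp only [pow_one]
    exact h2
  have he' : w =ᶠ[𝓝 (x₀ : ℂ)] fun z : ℂ => (r : ℂ) + (z - x₀) ^ 1 * g z := by
    filter_upwards [he] with z hz
    rw [← hz]
    ring
  rw [(hd.congr_of_eventuallyEq he').deriv]
  exact hg0

/-- With order three or more both `j = 1` and `j = 2` are available, so `w - r` takes both signs at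
non-real points, and one of them points into the band. -/
theorem order_le_two (h : BandFunction w) {x₀ r : ℝ} (hr : r ^ 2 = 1) (h0 : w x₀ = r) :
    ∃ n : ℕ, ∃ g : ℂ → ℂ, n ≤ 2 ∧ AnalyticAt ℂ g x₀ ∧ g x₀ ≠ 0 ∧
      ∀ᶠ z in 𝓝 (x₀ : ℂ), w z - r = (z - x₀) ^ n * g z := by
  have hr' : r = 1 ∨ r = -1 := by
    have h1 : (r - 1) * (r + 1) = 0 := by linear_combination hr
    rcases mul_eq_zero.1 h1 with h2 | h2
    · exact Or.inl (by linarith)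
    · exact Or.inr (by linarith)
  obtain ⟨n, g, hn, hg, hg0, he, γ, hγ, hj⟩ := h.exists_order
    (abs_le.1 (abs_le_one_iff_mul_self_le_one.2 (by nlinarith))) h0
  refine ⟨n, g, ?_, hg, hg0, he⟩
  by_contra! hlt
  obtain ⟨j, hj0, hj2, hjs⟩ : ∃ j : ℕ, 0 < j ∧ j ≤ 2 ∧ γ * (-1) ^ j = -r * |γ| := by
    rcases hr' with rfl | rfl <;> rcases le_total 0 γ with h1 | h1
    · exact ⟨1, by norm_num, by norm_num, by rw [abs_of_nonneg h1]; ring⟩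
    · exact ⟨2, by norm_num, by norm_num, by rw [abs_of_nonpos h1]; ring⟩
    · exact ⟨2, by norm_num, by norm_num, by rw [abs_of_nonneg h1]; ring⟩
    · exact ⟨1, by norm_num, by norm_num, by rw [abs_of_nonpos h1]; ring⟩
  obtain ⟨ε, hε, hs⟩ := hj j hj0 (by omega)
  have hγp : 0 < |γ| := abs_pos.2 hγ
  have hc : ContinuousAt (fun s : ℝ => s * |γ|) 0 := by fun_prop
  have h1 : ∀ᶠ s : ℝ in 𝓝 0, s * |γ| < 1 := hc.eventually_lt_const (by simp)
  obtain ⟨s, h2, h3⟩ := ((h1.filter_mono nhdsWithin_le_nhds).and (Ioo_mem_nhdsGT hε)).exists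
  refine hs s h3 ?_
  have h4 : 0 < s * |γ| := mul_pos h3.1 hγp
  have h5 : r + s * γ * (-1) ^ j = r * (1 - s * |γ|) := by linear_combination s * hjs
  rw [h5]
  rcases hr' with rfl | rfl <;> constructor <;> linarith

end BandFunction

end

section

variable {q : ℝ → ℝ} {N : ℕ} {a : ℝ} {k : ℤ}

/-! ### The Lyapunov function -/

theorem differentiable_wK (hq : MemLp q 2 edgeMeasure) : Differentiable ℂ (wK q N a k) := by
  have h := differentiable_bigF hq
  unfold wK
  fun_prop

theorem bigF_real (hq : MemLp q 2 edgeMeasure) (x : ℝ) : ∃ y : ℝ, bigF q x = y := by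
  obtain ⟨t, ht⟩ := theta1_real hq x
  obtain ⟨t', ht'⟩ := theta1'_real hq x
  obtain ⟨p, hp⟩ := phi1_real hq x
  obtain ⟨p', hp'⟩ := phi1'_real hq x
  refine ⟨2 * ((p' + t) / 2) ^ 2 + p * t' / 4 - 1, ?_⟩
  rw [bigF, hillDelta, ht, ht', hp, hp']
  push_cast
  ring

theorem bandFunction_wK (hq : MemLp q 2 edgeMeasure) (hc : cK N a k ≠ 0) :
    BandFunction (wK q N a k) := by
  refine ⟨differentiable_wK hq, fun x => ?_, fun z hz => wK_ne_of_im hq hc hz⟩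
  obtain ⟨y, hy⟩ := bigF_real hq x
  refine ⟨(y + sK N a k ^ 2) / cK N a k, ?_⟩
  rw [wK, hy]
  push_cast
  ring

theorem sq_s0K_add (N : ℕ) (k : ℤ) : (s0K N k) ^ 2 + (c0K N k) ^ 2 = 1 :=
  Real.sin_sq_add_cos_sq _

theorem TK_eq (lam : ℂ) : TK q N a k lam = c0K N k * wK q N a k lam := by
  rw [TK, wK]
  ring

theorem RK_eq (hc : cK N a k ≠ 0) (lam : ℂ) :
    RK q N a k lam = (s0K N k : ℂ) ^ 2 * (1 - wK q N a k lam ^ 2) := by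
  have h : (cK N a k : ℂ) ≠ 0 := by exact_mod_cast hc
  rw [RK, wK]
  field_simp

/-- In this form, with `w = cos θ`, the two values are visibly `cos (θ ± πk/N)`. -/
theorem mem_lyapunovValues (hc : cK N a k ≠ 0) (lam z : ℂ) : z ∈ lyapunovValues q N a k lam ↔
    (z - c0K N k * wK q N a k lam) ^ 2 = (s0K N k : ℂ) ^ 2 * (1 - wK q N a k lam ^ 2) := by
  rw [lyapunovValues, Set.mem_ofPred_eq, TK_eq, RK_eq hc]

theorem exists_mem_lyapunovValues (lam : ℂ) : ∃ z, z ∈ lyapunovValues q N a k lam := by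
  obtain ⟨r, hr⟩ := IsAlgClosed.exists_pow_nat_eq (RK q N a k lam) (n := 2) (by norm_num)
  exact ⟨TK q N a k lam + r, by rw [lyapunovValues, Set.mem_ofPred_eq, add_sub_cancel_left, hr]⟩

/-- A point `r` of the real line, and a value `z` of `c₀ r + s₀ √(1 - r²)` in `[-1,1]`. -/
theorem abs_le_one_of_value {s c r x : ℝ} (hsc : s ^ 2 + c ^ 2 = 1) (hx : |x| ≤ 1)
    (h : (x - c * r) ^ 2 = s ^ 2 * (1 - r ^ 2)) : |r| ≤ 1 := by
  by_contra! hr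
  have hr2 : 1 < r ^ 2 := by nlinarith [sq_abs r, abs_nonneg r]
  have hx2 : x ^ 2 ≤ 1 := by nlinarith [sq_abs x, abs_nonneg x]
  -- For `|r| > 1` the right-hand side of `h` is non-positive, which forces `s = 0` and then `x =
  -- ±r`.
  have hs : s = 0 := by
    by_contra hs
    have : 0 < s ^ 2 := by positivity
    nlinarith [sq_nonneg (x - c * r)]
  have hc2 : c ^ 2 = 1 := by rw [hs] at hsc; linarith
  have h0 : x = c * r := by
    have : (x - c * r) ^ 2 = 0 := by rw [h, hs]; ring
    have := pow_eq_zero_iff (two_ne_zero) |>.1 this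
    linarith
  have : x ^ 2 = r ^ 2 := by rw [h0, mul_pow, hc2, one_mul]
  linarith

/-- The roots are `c r ± s √(1 - r²)`, inner products of unit vectors in the plane. -/
theorem value_mem_of_abs_le_one {s c r : ℝ} (hsc : s ^ 2 + c ^ 2 = 1) (hr : |r| ≤ 1) {z : ℂ}
    (h : (z - c * r) ^ 2 = (s : ℂ) ^ 2 * (1 - (r : ℂ) ^ 2)) :
    ∃ x ∈ Set.Icc (-1 : ℝ) 1, z = (x : ℂ) := by
  have hr2 : r ^ 2 ≤ 1 := by nlinarith [sq_abs r, abs_nonneg r]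
  have hsq : √(1 - r ^ 2) ^ 2 = 1 - r ^ 2 := Real.sq_sqrt (by linarith)
  set y := √(1 - r ^ 2)
  have h1 : (z - c * r - s * y) * (z - c * r + s * y) = 0 := by
    have : (y : ℂ) ^ 2 = 1 - (r : ℂ) ^ 2 := by exact_mod_cast hsq
    linear_combination h - (s : ℂ) ^ 2 * this
  have key : ∀ x : ℝ, x = c * r + s * y ∨ x = c * r - s * y → x ∈ Set.Icc (-1 : ℝ) 1 := by
    rintro x (rfl | rfl) <;> rw [Set.mem_Icc, ← abs_le, abs_le_one_iff_mul_self_le_one] <;>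
      nlinarith [sq_nonneg (c * y - s * r), sq_nonneg (c * y + s * r)]
  rcases mul_eq_zero.1 h1 with h2 | h2
  · exact ⟨c * r + s * y, key _ (Or.inl rfl), by push_cast; linear_combination h2⟩
  · exact ⟨c * r - s * y, key _ (Or.inr rfl), by push_cast; linear_combination h2⟩

/-- The bands of the spectrum. -/
def bands (q : ℝ → ℝ) (N : ℕ) (a : ℝ) (k : ℤ) : Set ℂ :=
  {lam | lam.im = 0 ∧ ∃ r ∈ Set.Icc (-1 : ℝ) 1, wK q N a k lam = r}

/-- One value in `[-1,1]` forces `|w| ≤ 1`, and `|w| ≤ 1` puts every value in `[-1,1]`. Since at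
least one value exists, the two descriptions coincide. -/
theorem bands_eq (hq : MemLp q 2 edgeMeasure) (hc : cK N a k ≠ 0) :
    bands q N a k = {lam : ℂ | lam.im = 0 ∧ ∃ z ∈ lyapunovValues q N a k lam,
        ∃ x ∈ Set.Icc (-1 : ℝ) 1, z = (x : ℂ)} ∧
    bands q N a k = {lam : ℂ | lam.im = 0 ∧ ∀ z ∈ lyapunovValues q N a k lam,
        ∃ x ∈ Set.Icc (-1 : ℝ) 1, z = (x : ℂ)} := by
  have h1 : ∀ lam ∈ bands q N a k, ∀ z ∈ lyapunovValues q N a k lam,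
      ∃ x ∈ Set.Icc (-1 : ℝ) 1, z = (x : ℂ) := by
    rintro lam ⟨-, r, hr, hw⟩ z hz
    rw [mem_lyapunovValues hc, hw] at hz
    exact value_mem_of_abs_le_one (sq_s0K_add N k) (abs_le.2 hr) hz
  have h2 : ∀ lam : ℂ, lam.im = 0 → (∃ z ∈ lyapunovValues q N a k lam,
      ∃ x ∈ Set.Icc (-1 : ℝ) 1, z = (x : ℂ)) → lam ∈ bands q N a k := by
    rintro lam him ⟨z, hz, x, hx, rfl⟩
    have hlam : lam = (lam.re : ℂ) := Complex.ext rfl (by simp [him])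
    obtain ⟨r, hr⟩ := (bandFunction_wK (q := q) hq hc).real lam.re
    rw [← hlam] at hr
    rw [mem_lyapunovValues hc, hr] at hz
    exact ⟨him, r, abs_le.1 (abs_le_one_of_value (sq_s0K_add N k) (abs_le.2 hx)
      (by exact_mod_cast hz)), hr⟩
  constructor
  · ext lam
    refine ⟨fun h => ⟨h.1, ?_⟩, fun h => h2 lam h.1 h.2⟩
    obtain ⟨z, hz⟩ := exists_mem_lyapunovValues (q := q) (N := N) (a := a) (k := k) lam
    exact ⟨z, hz, h1 lam h z hz⟩
  · ext lam
    refine ⟨fun h => ⟨h.1, h1 lam h⟩, fun h => h2 lam h.1 ?_⟩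
    obtain ⟨z, hz⟩ := exists_mem_lyapunovValues (q := q) (N := N) (a := a) (k := k) lam
    exact ⟨z, hz, h.2 z hz⟩

/-! ### Derivative of the Lyapunov function inside the bands -/

namespace BandFunction

variable {w : ℂ → ℂ}

/-- A square root of `s² (1 - w²)` that vanishes at a point has non-zero derivative there, and
`w' = 0` there. -/
theorem deriv_sqrt_ne_zero (h : BandFunction w) {x₀ r : ℝ} (hr : r ^ 2 = 1) (h0 : w x₀ = r)
    {s : ℂ} (hs : s ≠ 0) {d : ℂ → ℂ} (hd : AnalyticAt ℂ d x₀)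
    (he : ∀ᶠ z in 𝓝 (x₀ : ℂ), d z ^ 2 = s ^ 2 * (1 - w z ^ 2)) :
    deriv d x₀ ≠ 0 ∧ deriv w x₀ = 0 := by
  have hr1 : (r : ℂ) ^ 2 = 1 := by exact_mod_cast hr
  have hr0 : (r : ℂ) ≠ 0 := by
    intro h
    rw [h] at hr1
    norm_num at hr1
  have hd0 : d x₀ = 0 := by
    have := he.self_of_nhds
    rw [h0, hr1, sub_self, mul_zero] at this
    exact pow_eq_zero_iff two_ne_zero |>.1 this
  have hdd := hd.differentiableAt.hasDerivAt
  have hwd := (h.diff (x₀ : ℂ)).hasDerivAt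
  constructor
  · intro hz
    -- If the derivative of `d` vanished, `d²` would be of smaller order than `(z - x₀)²`, whereas
    -- `1 - w²` has a zero of order at most two.
    obtain ⟨n, g, hn, hg, hg0, heq⟩ := h.order_le_two hr h0
    rw [hz] at hdd
    have ho : (fun z => d z) =o[𝓝 (x₀ : ℂ)] fun z => z - x₀ := by
      have := hdd.isLittleO
      simpa [hd0] using this
    set G : ℂ → ℂ := fun z => -(s ^ 2 * (g z * (w z + r))) with hG
    have hGc : ContinuousAt G x₀ := by
      have h1 := hg.continuousAt
      have h2 := (h.diff (x₀ : ℂ)).continuousAt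
      fun_prop
    have hGne : G x₀ ≠ 0 := by
      rw [hG]
      dsimp only
      rw [h0, neg_ne_zero, ← two_mul]
      exact mul_ne_zero (pow_ne_zero 2 hs) (mul_ne_zero hg0 (mul_ne_zero two_ne_zero hr0))
    have hdG : ∀ᶠ z in 𝓝 (x₀ : ℂ), d z ^ 2 = (z - x₀) ^ n * G z := by
      filter_upwards [he, heq] with z h1 h2
      rw [h1, hG]
      linear_combination -s ^ 2 * (w z + r) * h2 - s ^ 2 * hr1
    have hpos : 0 < ‖G x₀‖ := norm_pos_iff.2 hGne
    have h1 : ∀ᶠ z in 𝓝 (x₀ : ℂ), ‖G x₀‖ / 2 < ‖G z‖ :=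
      hGc.norm.eventually (lt_mem_nhds (half_lt_self hpos))
    set c := √(‖G x₀‖ / 4) with hc
    have hcp : 0 < c := Real.sqrt_pos.2 (by positivity)
    have h2 := ho.bound hcp
    have h3 : ∀ᶠ z : ℂ in 𝓝 (x₀ : ℂ), ‖z - (x₀ : ℂ)‖ < 1 := by
      have := Metric.ball_mem_nhds (x₀ : ℂ) one_pos
      filter_upwards [this] with z hz
      rwa [Metric.mem_ball, dist_eq_norm] at hz
    have h4 : ∀ᶠ z in 𝓝[≠] (x₀ : ℂ), False := by
      filter_upwards [self_mem_nhdsWithin, (hdG.and (h1.and (h2.and h3))).filter_mono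
        nhdsWithin_le_nhds] with z hne ⟨e1, e2, e3, e4⟩
      have hzp : 0 < ‖z - x₀‖ := norm_pos_iff.2 (sub_ne_zero.2 hne)
      have e5 : ‖d z‖ ^ 2 ≤ ‖G x₀‖ / 4 * ‖z - x₀‖ ^ 2 := by
        calc ‖d z‖ ^ 2 ≤ (c * ‖z - x₀‖) ^ 2 := pow_le_pow_left₀ (norm_nonneg _) e3 2
          _ = _ := by rw [mul_pow, hc, Real.sq_sqrt (by positivity)]
      have e6 : ‖d z‖ ^ 2 = ‖z - x₀‖ ^ n * ‖G z‖ := by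
        rw [← norm_pow, e1, norm_mul, norm_pow]
      have e7 : ‖z - x₀‖ ^ 2 ≤ ‖z - x₀‖ ^ n :=
        pow_le_pow_of_le_one hzp.le e4.le hn
      have e8 : ‖z - x₀‖ ^ 2 * (‖G x₀‖ / 2) ≤ ‖z - x₀‖ ^ n * ‖G z‖ :=
        mul_le_mul e7 e2.le (by positivity) (by positivity)
      have e9 : 0 < ‖z - x₀‖ ^ 2 * ‖G x₀‖ := by positivity
      nlinarith
    exact h4.exists.elim fun _ h => h
  · have h1 : HasDerivAt (fun z => d z ^ 2) (2 * d x₀ * deriv d x₀) x₀ := by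
      simpa using hdd.fun_pow 2
    have h2 : HasDerivAt (fun z => s ^ 2 * (1 - w z ^ 2)) (s ^ 2 * (-(2 * w x₀ * deriv w x₀))) x₀ := by
      simpa using ((hwd.pow 2).const_sub 1).const_mul (s ^ 2)
    have h3 := h1.unique (h2.congr_of_eventuallyEq he)
    rw [hd0, h0] at h3
    have h4 : s ^ 2 * r * deriv w x₀ = 0 := by linear_combination (1 / 2 : ℂ) * h3
    exact (mul_eq_zero.1 h4).resolve_left (mul_ne_zero (pow_ne_zero 2 hs) hr0)

/-- Three cases. If `s = 0`, then `f = c w` and `|w| < 1`. If `w = ±1`, the term `c w` has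
derivative zero and the square root does not. If `|w| < 1` and `s ≠ 0`, a zero of `f'` would give `c
(f - c w) = s² w`, which together with the defining relation yields `f² = 1`. -/
theorem deriv_branch_ne_zero (h : BandFunction w) {s c : ℝ} (hsc : s ^ 2 + c ^ 2 = 1) {x₀ x : ℝ}
    (hx : x ∈ Set.Ioo (-1 : ℝ) 1) {f : ℂ → ℂ} (hf : AnalyticAt ℂ f x₀) (hfx : f x₀ = x)
    (he : ∀ᶠ z in 𝓝 (x₀ : ℂ), (f z - c * w z) ^ 2 = (s : ℂ) ^ 2 * (1 - w z ^ 2)) :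
    deriv f x₀ ≠ 0 := by
  obtain ⟨r, hr⟩ := h.real x₀
  have hx1 : x ^ 2 < 1 := by nlinarith [hx.1, hx.2]
  have hval : (x - c * r) ^ 2 = s ^ 2 * (1 - r ^ 2) := by
    have := he.self_of_nhds
    rw [hfx, hr] at this
    exact_mod_cast this
  have hr1 := abs_le_one_of_value hsc (abs_le.2 ⟨hx.1.le, hx.2.le⟩) hval
  have hwd := (h.diff (x₀ : ℂ)).hasDerivAt
  have hdan : AnalyticAt ℂ (fun z => f z - c * w z) x₀ :=
    hf.sub (analyticAt_const.mul (h.diff.analyticAt _))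
  have hfd : deriv f x₀ = deriv (fun z => f z - c * w z) x₀ + c * deriv w x₀ := by
    have := hf.differentiableAt.hasDerivAt.sub (hwd.const_mul (c : ℂ))
    have h2 : deriv (fun z => f z - c * w z) x₀ = deriv f x₀ - c * deriv w x₀ := this.deriv
    rw [h2]
    ring
  by_cases hs : s = 0
  · have hc2 : c ^ 2 = 1 := by rw [hs] at hsc; linarith
    have hc0 : (c : ℂ) ≠ 0 := by
      intro h
      rw [Complex.ofReal_eq_zero.1 h] at hc2
      norm_num at hc2
    have hr2 : x = c * r := by
      have : (x - c * r) ^ 2 = 0 := by rw [hval, hs]; ring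
      linarith [pow_eq_zero_iff two_ne_zero |>.1 this]
    have hr3 : r ^ 2 < 1 := by
      have : x ^ 2 = r ^ 2 := by rw [hr2, mul_pow, hc2, one_mul]
      linarith
    have hz : (fun z => f z - c * w z) =ᶠ[𝓝 (x₀ : ℂ)] fun _ => 0 := by
      filter_upwards [he] with z hz
      rw [hs] at hz
      exact pow_eq_zero_iff two_ne_zero |>.1 (hz.trans (by simp))
    rw [hfd, hz.deriv_eq, deriv_const, zero_add]
    exact mul_ne_zero hc0 (h.deriv_ne_zero (abs_lt.1 ((sq_lt_one_iff_abs_lt_one r).1 hr3)) hr)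
  · have hsC : (s : ℂ) ≠ 0 := by exact_mod_cast hs
    rcases eq_or_lt_of_le ((sq_le_one_iff_abs_le_one r).2 hr1) with hr2 | hr2
    · obtain ⟨h1, h2⟩ := h.deriv_sqrt_ne_zero hr2 hr hsC hdan he
      rw [hfd, h2, mul_zero, add_zero]
      exact h1
    · have hw' := h.deriv_ne_zero (abs_lt.1 ((sq_lt_one_iff_abs_lt_one r).1 hr2)) hr
      set d : ℂ → ℂ := fun z => f z - c * w z with hd
      have h1 : HasDerivAt (fun z => d z ^ 2) (2 * d x₀ * deriv d x₀) x₀ := by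
        simpa using hdan.differentiableAt.hasDerivAt.fun_pow 2
      have h2 : HasDerivAt (fun z => (s : ℂ) ^ 2 * (1 - w z ^ 2))
          ((s : ℂ) ^ 2 * (-(2 * w x₀ * deriv w x₀))) x₀ := by
        simpa using ((hwd.pow 2).const_sub 1).const_mul ((s : ℂ) ^ 2)
      have h3 := h1.unique (h2.congr_of_eventuallyEq he)
      have hdx : d x₀ = ((x - c * r : ℝ) : ℂ) := by
        rw [hd]
        dsimp only
        rw [hfx, hr]
        push_cast
        ring
      intro hf0
      rw [hfd] at hf0
      rw [hdx, hr] at h3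
      have h4 : deriv w x₀ * ((c * (x - c * r) - s ^ 2 * r : ℝ) : ℂ) = 0 := by
        push_cast at h3 ⊢
        linear_combination ((x : ℂ) - c * r) * hf0 - (1 / 2 : ℂ) * h3
      have h5 := Complex.ofReal_eq_zero.1 ((mul_eq_zero.1 h4).resolve_left hw')
      have hs2 : 0 < s ^ 2 := by positivity
      have h6 : r ^ 2 = c ^ 2 := by
        apply mul_left_cancel₀ hs2.ne'
        have e1 : c * (x - c * r) = s ^ 2 * r := by linear_combination h5
        have e2 : c ^ 2 * (x - c * r) ^ 2 = s ^ 4 * r ^ 2 := by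
          linear_combination (c * (x - c * r) + s ^ 2 * r) * e1
        rw [hval] at e2
        have e3 : s ^ 2 * (c ^ 2 * (1 - r ^ 2)) = s ^ 2 * (s ^ 2 * r ^ 2) := by
          linear_combination e2
        have e4 := mul_left_cancel₀ hs2.ne' e3
        have e5 : c ^ 2 = r ^ 2 := by linear_combination e4 + r ^ 2 * hsc
        rw [e5]
      have h7 : x ^ 2 = 1 := by
        linear_combination hval + 2 * r * h5 + r ^ 2 * hsc + h6 + hsc
      linarith

end BandFunction

theorem deriv_lyapunov_ne_zero (hq : MemLp q 2 edgeMeasure) (hc : cK N a k ≠ 0) (lam : ℝ)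
    (f : ℂ → ℂ) (hf : IsLyapunovBranchAt q N a k f (lam : ℂ))
    (hx : ∃ x ∈ Set.Ioo (-1 : ℝ) 1, f (lam : ℂ) = (x : ℂ)) : deriv f (lam : ℂ) ≠ 0 := by
  obtain ⟨x, hx, hfx⟩ := hx
  refine (bandFunction_wK (q := q) hq hc).deriv_branch_ne_zero (sq_s0K_add N k) hx hf.1 hfx ?_
  filter_upwards [hf.2] with z hz
  exact (mem_lyapunovValues hc z _).1 hz

/-! ### Real points of the open bands -/

/-- In an open band `P Q = 1 + 4c_k² + 4c_k r` lies strictly between `(1 - 2|c_k|)²` and `9`. The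
lower bound gives `P ≠ 0`. At a Dirichlet point `ϑ(1) φ'(1) = 1` with real factors, so `P Q = 5 +
2(ϑ(1)² + φ'(1)²) ≥ 9`. -/
theorem phi1_ne_zero_and_bigP_ne_zero (hq : MemLp q 2 edgeMeasure) (hc : cK N a k ≠ 0) {lam r : ℝ}
    (hr : r ∈ Set.Ioo (-1 : ℝ) 1) (hw : wK q N a k lam = r) :
    phi1 q lam ≠ 0 ∧ bigP q lam ≠ 0 := by
  have h1 : bigP q lam * bigQ q lam = 1 + 4 * (cK N a k : ℂ) ^ 2 + 4 * cK N a k * r := by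
    rw [← hw]
    linear_combination -middle_coeff (q := q) hq hc lam + kap_mul_conj N a k
  have hc1 : |cK N a k| ≤ 1 := Real.abs_cos_le_one _
  have hcp : 0 < |cK N a k| := abs_pos.2 hc
  have hcr : |cK N a k * r| < |cK N a k| := by
    rw [abs_mul]
    exact mul_lt_of_lt_one_right hcp (abs_lt.2 hr)
  have hcr' := abs_lt.1 hcr
  have hsq := sq_abs (cK N a k)
  constructor
  · intro h0
    obtain ⟨t, ht⟩ := theta1_real hq lam
    obtain ⟨p', hp'⟩ := phi1'_real hq lam
    have hW := wronskian hq (lam : ℂ)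
    rw [h0, mul_zero, sub_zero, ht, hp'] at hW
    rw [bigP, bigQ, ht, hp'] at h1
    norm_cast at hW h1
    nlinarith [sq_nonneg (t - p')]
  · intro h0
    rw [h0, zero_mul] at h1
    norm_cast at h1
    nlinarith [sq_nonneg (2 * |cK N a k| - 1)]

/-- By the identity theorem, since `phi1` is entire and does not vanish at `i`. -/
theorem eventually_phi1_ne_zero (hq : MemLp q 2 edgeMeasure) (lam : ℂ) :
    ∀ᶠ z in 𝓝[≠] lam, phi1 q z ≠ 0 := by
  rcases ((differentiable_phi1 hq).analyticAt lam).eventually_eq_zero_or_eventually_ne_zero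
    with h | h
  · exfalso
    have hz := ((differentiable_phi1 hq).differentiableOn.analyticOnNhd isOpen_univ
      ).eqOn_zero_of_preconnected_of_eventuallyEq_zero isPreconnected_univ (Set.mem_univ lam) h
    exact phi1_ne_zero_of_im hq (lam := Complex.I) (by simp) (hz (Set.mem_univ _))
  · exact h

end

section

variable {q : ℝ → ℝ} {N : ℕ} {a : ℝ} {k : ℤ}

/-! ### Fundamental solutions and the monodromy matrix -/

/-- The vertex recursion as a permutation of the space of vertex values of one cell. -/
def vertexStep (κ κ₂ P Q : ℂ) (hκ : κ ≠ 0) (hκ₂ : κ₂ ≠ 0) : Equiv.Perm (ℂ × ℂ) where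
  toFun v := ((P * v.2 - v.1) / κ, Q * ((P * v.2 - v.1) / κ) - κ₂ * v.2)
  invFun v := (P * ((Q * v.1 - v.2) / κ₂) - κ * v.1, (Q * v.1 - v.2) / κ₂)
  left_inv v := by
    ext
    · field_simp
      ring
    · field_simp
      ring
  right_inv v := by
    ext
    · field_simp
      ring
    · field_simp
      ring

/-- Both coupling constants are nonzero, so the recursion runs in both directions: the sequence is
the orbit of `(x₀, y₀)` under the integer powers of an invertible map. -/
theorem exists_vertex_sequence {κ κ₂ P Q : ℂ} (hκ : κ ≠ 0) (hκ₂ : κ₂ ≠ 0) (x₀ y₀ : ℂ) :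
    ∃ x y : ℤ → ℂ, x 0 = x₀ ∧ y 0 = y₀ ∧ (∀ n, x n + κ * x (n + 1) - P * y n = 0) ∧
      ∀ n, y (n + 1) + κ₂ * y n - Q * x (n + 1) = 0 := by
  set e := vertexStep κ κ₂ P Q hκ hκ₂ with he
  have hstep : ∀ n : ℤ, (e ^ (n + 1)) (x₀, y₀) = e ((e ^ n) (x₀, y₀)) := fun n => by
    rw [add_comm, zpow_one_add, Equiv.Perm.mul_apply]
  have hfst : ∀ v : ℂ × ℂ, (e v).1 = (P * v.2 - v.1) / κ := fun _ => rfl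
  have hsnd : ∀ v : ℂ × ℂ, (e v).2 = Q * (e v).1 - κ₂ * v.2 := fun _ => rfl
  refine ⟨fun n => ((e ^ n) (x₀, y₀)).1, fun n => ((e ^ n) (x₀, y₀)).2, by simp, by simp,
    fun n => ?_, fun n => ?_⟩
  · dsimp only
    rw [hstep, hfst]
    field_simp
    ring
  · dsimp only
    rw [hstep, hsnd]
    ring

theorem exists_isGraphSolution (hq : MemLp q 2 edgeMeasure) (hc : cK N a k ≠ 0) {lam : ℂ}
    (hph : phi1 q lam ≠ 0) (α β : ℂ) : ∃ u u' : Edge → ℝ → ℂ,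
      IsGraphSolution q N a k lam u u' ∧ u (0, 0) 0 = α ∧ u' (0, 0) 0 = β := by
  have hκ := kap_ne_zero hc
  have hκ₂ : (starRingEnd ℂ) (kap N a k) ≠ 0 := (map_ne_zero _).2 hκ
  -- The starting value of `y` is the far end value on the edge `(0, 0)` of the solution with data
  -- `(α, β)`; `slope` then recovers `β`.
  obtain ⟨x, y, hx, hy, E1, E2⟩ := exists_vertex_sequence (P := bigP q lam) (Q := bigQ q lam)
    hκ hκ₂ α (α * theta1 q lam + β * phi1 q lam)
  refine ⟨_, _, isGraphSolution_edgeSol hq hph E1 E2, ?_, ?_⟩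
  · simpa [startVal] using hx
  · simp only [edgeSol'_zero, slope, endVal, startVal, Matrix.cons_val_zero, hx, hy, Pi.zero_apply]
    field_simp
    ring

theorem exists_isFundamentalPair (hq : MemLp q 2 edgeMeasure) (hc : cK N a k ≠ 0) {lam : ℂ}
    (hph : phi1 q lam ≠ 0) : ∃ Θ Θ' Φ Φ' : Edge → ℝ → ℂ,
      IsFundamentalPair q N a k lam Θ Θ' Φ Φ' := by
  obtain ⟨Θ, Θ', h1, h2, h3⟩ := exists_isGraphSolution (N := N) (a := a) (k := k) hq hc hph 1 0
  obtain ⟨Φ, Φ', h4, h5, h6⟩ := exists_isGraphSolution (N := N) (a := a) (k := k) hq hc hph 0 1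
  exact ⟨Θ, Θ', Φ, Φ', h1, h4, h2, h3, h5, h6⟩

/-- Cauchy data at the initial point of the edge `(1, 0)`. -/
theorem IsGraphSolution.next_cell (hq : MemLp q 2 edgeMeasure) {lam : ℂ}
    (hph : phi1 q lam ≠ 0) {u u' : Edge → ℝ → ℂ} (h : IsGraphSolution q N a k lam u u') :
    kap N a k * u (1, 0) 0 =
      bigP q lam * (u (0, 0) 0 * theta1 q lam + u' (0, 0) 0 * phi1 q lam) - u (0, 0) 0 ∧
    phi1 q lam * u' (1, 0) 0 = (theta1 q lam + phi1' q lam) * u (1, 0) 0 -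
      (starRingEnd ℂ) (kap N a k) * (u (0, 0) 0 * theta1 q lam + u' (0, 0) 0 * phi1 q lam) := by
  obtain ⟨h1, h2⟩ := h.vertex_equations hq hph 0
  rw [zero_add] at h1 h2
  rw [((h.solves (0, 0)).at_one hq).1] at h1 h2
  rw [((h.solves (1, 0)).at_one hq).1, bigQ] at h2
  exact ⟨by linear_combination h1, by linear_combination h2⟩

theorem half_eq (N : ℕ) (k : ℤ) : half N k = c0K N k + s0K N k * Complex.I := by
  rw [half, Complex.exp_mul_I, ← Complex.ofReal_cos, ← Complex.ofReal_sin]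
  rfl

theorem conj_half_eq (N : ℕ) (k : ℤ) :
    (starRingEnd ℂ) (half N k) = c0K N k - s0K N k * Complex.I := by
  rw [half_eq, map_add, map_mul, Complex.conj_ofReal, Complex.conj_ofReal, Complex.conj_I]
  ring

/-- The eigenvalues are therefore `σ^{±1}` times the conjugate of `half N k`, where `σ + 1/σ = 2w`.
The determinant is a phase, in general not one, which is why two different Lyapunov functions arise.
-/
theorem trace_det_monodromy (hq : MemLp q 2 edgeMeasure) (hc : cK N a k ≠ 0) {lam : ℂ}
    (hph : phi1 q lam ≠ 0) {Θ Θ' Φ Φ' : Edge → ℝ → ℂ}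
    (h : IsFundamentalPair q N a k lam Θ Θ' Φ Φ') :
    (monodromy Θ Θ' Φ Φ').trace = 2 * wK q N a k lam * (starRingEnd ℂ) (half N k) ∧
      (monodromy Θ Θ' Φ Φ').det = (starRingEnd ℂ) (half N k) ^ 2 := by
  obtain ⟨a1, a2⟩ := h.solTheta.next_cell hq hph
  obtain ⟨b1, b2⟩ := h.solPhi.next_cell hq hph
  rw [h.theta_init, h.theta_init'] at a1 a2
  rw [h.phi_init, h.phi_init'] at b1 b2
  have hm := middle_coeff (q := q) hq hc lam
  have he := half_mul_conj N k
  have hc0 : (2 * cK N a k : ℂ) ≠ 0 := mul_ne_zero two_ne_zero (by exact_mod_cast hc)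
  rw [monodromy, Matrix.trace_fin_two_of, Matrix.det_fin_two_of]
  set X := Θ (1, 0) 0
  set X' := Θ' (1, 0) 0
  set Y := Φ (1, 0) 0
  set Y' := Φ' (1, 0) 0
  have hQ : bigQ q lam = 2 * theta1 q lam + phi1' q lam := rfl
  have ht : kap N a k * (X + Y') = 4 * cK N a k * wK q N a k lam := by
    apply mul_left_cancel₀ hph
    rw [hQ] at hm
    linear_combination phi1 q lam * a1 + kap N a k * b2 + (theta1 q lam + phi1' q lam) * b1 -
      phi1 q lam * hm
  have hd : kap N a k * (X * Y' - Y * X') = (starRingEnd ℂ) (kap N a k) := by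
    apply mul_left_cancel₀ hph
    linear_combination kap N a k * X * b2 - kap N a k * Y * a2 +
      (starRingEnd ℂ) (kap N a k) * (theta1 q lam * b1 - phi1 q lam * a1)
  rw [kap_eq] at ht
  rw [conj_kap, kap_eq] at hd
  constructor
  · have h1 : half N k * (X + Y') = 2 * wK q N a k lam := by
      apply mul_left_cancel₀ hc0
      linear_combination ht
    linear_combination (starRingEnd ℂ) (half N k) * h1 - (X + Y') * he
  · have h1 : half N k * (X * Y' - Y * X') = (starRingEnd ℂ) (half N k) := by
      apply mul_left_cancel₀ hc0
      linear_combination hd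
    linear_combination (starRingEnd ℂ) (half N k) * h1 - (X * Y' - Y * X') * he

theorem lyapunov_of_monodromy (hq : MemLp q 2 edgeMeasure) (hc : cK N a k ≠ 0) {lam : ℂ}
    (hph : phi1 q lam ≠ 0) {Θ Θ' Φ Φ' : Edge → ℝ → ℂ}
    (h : IsFundamentalPair q N a k lam Θ Θ' Φ Φ') {τp τm : ℂ}
    (hτ : (monodromy Θ Θ' Φ Φ').charpoly.roots = {τp, τm}) :
    τp ≠ 0 ∧ τm ≠ 0 ∧ ∃ r : ℂ, r ^ 2 = RK q N a k lam ∧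
      (τp + 1 / τp) / 2 = TK q N a k lam + r ∧ (τm + 1 / τm) / 2 = TK q N a k lam - r := by
  obtain ⟨ht, hd⟩ := trace_det_monodromy hq hc hph h
  rw [Matrix.trace_eq_sum_roots_charpoly, hτ] at ht
  rw [Matrix.det_eq_prod_roots_charpoly, hτ] at hd
  simp only [Multiset.insert_eq_cons, Multiset.sum_cons, Multiset.sum_singleton,
    Multiset.prod_cons, Multiset.prod_singleton] at ht hd
  have he := half_mul_conj N k
  have h0 := half_eq N k
  have h1 := conj_half_eq N k
  set e := half N k
  set e₂ := (starRingEnd ℂ) e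
  have he₂ : e₂ ≠ 0 := right_ne_zero_of_mul (he.trans_ne one_ne_zero)
  have hp : τp ≠ 0 := left_ne_zero_of_mul (hd.trans_ne (pow_ne_zero 2 he₂))
  have hm : τm ≠ 0 := right_ne_zero_of_mul (hd.trans_ne (pow_ne_zero 2 he₂))
  -- The determinant makes each reciprocal a phase times the other eigenvalue.
  have hip : 1 / τp = τm * e ^ 2 := by
    rw [div_eq_iff hp]
    linear_combination -e ^ 2 * hd - (e * e₂ + 1) * he
  have him : 1 / τm = τp * e ^ 2 := by
    rw [div_eq_iff hm]
    linear_combination -e ^ 2 * hd - (e * e₂ + 1) * he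
  have hsum : e * (τp + τm) = 2 * wK q N a k lam := by
    linear_combination e * ht + 2 * wK q N a k lam * he
  have hprod : e ^ 2 * (τp * τm) = 1 := by
    linear_combination e ^ 2 * hd + (e * e₂ + 1) * he
  -- With `e = c₀ + i s₀`, `(τp + τm e²)/2` splits into `c₀ e (τp + τm)/2`, which is `T_k`, and this
  -- witness.
  refine ⟨hp, hm, (s0K N k : ℂ) * Complex.I * (e * (τm - τp)) / 2, ?_, ?_, ?_⟩
  · rw [RK_eq hc]
    linear_combination (s0K N k : ℂ) ^ 2 * (e * (τm - τp)) ^ 2 / 4 * Complex.I_sq -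
      (s0K N k : ℂ) ^ 2 / 4 * (e * (τp + τm) + 2 * wK q N a k lam) * hsum +
      (s0K N k : ℂ) ^ 2 * hprod
  · rw [hip, TK_eq]
    linear_combination (c0K N k : ℂ) / 2 * hsum + e * τm / 2 * h0 + e * τp / 2 * h1 - τp / 2 * he
  · rw [him, TK_eq]
    linear_combination (c0K N k : ℂ) / 2 * hsum + e * τp / 2 * h0 + e * τm / 2 * h1 - τm / 2 * he

end

section

variable {q : ℝ → ℝ} {N : ℕ} {a : ℝ} {k : ℤ}

/-! ### Finite multiplicity away from the Dirichlet spectrum -/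

theorem IsSolution.combination (hq : MemLp q 2 edgeMeasure) {lam : ℂ} {u u' v v' z z' : ℝ → ℂ}
    (h : IsSolution q lam u u') (h₁ : IsSolution q lam v v') (h₂ : IsSolution q lam z z')
    (c d : ℂ) : IsSolution q lam (u + (c • v + d • z)) (u' + (c • v' + d • z')) :=
  ((h.isW2 hq).add (((h₁.isW2 hq).smul c).add ((h₂.isW2 hq).smul d))).isSolution
    (Filter.Eventually.of_forall fun t => by
      simp only [Pi.add_apply, Pi.smul_apply, smul_eq_mul]
      ring)

theorem Kirchhoff.combination {u u' v v' z z' : Edge → ℝ → ℂ} (h : Kirchhoff N a k u u')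
    (h₁ : Kirchhoff N a k v v') (h₂ : Kirchhoff N a k z z') (c d : ℂ) :
    Kirchhoff N a k (u + (c • v + d • z)) (u' + (c • v' + d • z')) := by
  constructor <;> intro n <;> simp only [Pi.add_apply, Pi.smul_apply, smul_eq_mul]
  · linear_combination h.cont_lower n + c * h₁.cont_lower n + d * h₂.cont_lower n
  · linear_combination h.cont_lower' n + c * h₁.cont_lower' n + d * h₂.cont_lower' n
  · linear_combination h.cont_upper n + c * h₁.cont_upper n + d * h₂.cont_upper n
  · linear_combination h.cont_upper' n + c * h₁.cont_upper' n + d * h₂.cont_upper' n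
  · linear_combination h.flux_lower n + c * h₁.flux_lower n + d * h₂.flux_lower n
  · linear_combination h.flux_upper n + c * h₁.flux_upper n + d * h₂.flux_upper n

theorem vertex_sequence_eq_zero {κ κ₂ P Q : ℂ} (hκ : κ ≠ 0) (hκ₂ : κ₂ ≠ 0) {x y : ℤ → ℂ}
    (hx : x 0 = 0) (hy : y 0 = 0) (h1 : ∀ n, x n + κ * x (n + 1) - P * y n = 0)
    (h2 : ∀ n, y (n + 1) + κ₂ * y n - Q * x (n + 1) = 0) (n : ℤ) : x n = 0 ∧ y n = 0 := by
  induction n using Int.induction_on with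
  | zero => exact ⟨hx, hy⟩
  | succ n ih =>
    have e1 := h1 n
    have e2 := h2 n
    rw [ih.1, ih.2] at e1
    have hx1 : x (n + 1) = 0 := (mul_eq_zero.1 (show κ * x (n + 1) = 0 by
      linear_combination e1)).resolve_left hκ
    rw [ih.2, hx1] at e2
    exact ⟨hx1, by linear_combination e2⟩
  | pred n ih =>
    have e1 := h1 (-n - 1)
    have e2 := h2 (-n - 1)
    rw [sub_add_cancel] at e1 e2
    rw [ih.1, ih.2] at e2
    have hy1 : y (-n - 1) = 0 := (mul_eq_zero.1 (show κ₂ * y (-n - 1) = 0 by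
      linear_combination e2)).resolve_left hκ₂
    rw [ih.1, hy1] at e1
    exact ⟨by linear_combination e1, hy1⟩

theorem IsGraphSolution.eq_zero_of_init (hq : MemLp q 2 edgeMeasure) (hc : cK N a k ≠ 0) {lam : ℂ}
    (hph : phi1 q lam ≠ 0) {u u' : Edge → ℝ → ℂ} (h : IsGraphSolution q N a k lam u u')
    (h0 : u (0, 0) 0 = 0) (h1 : u' (0, 0) 0 = 0) (e : Edge) :
    ∀ t ∈ Set.Icc (0 : ℝ) 1, u e t = 0 := by
  have hκ := kap_ne_zero hc
  have hy : u (0, 0) 1 = 0 := by rw [((h.solves (0, 0)).at_one hq).1, h0, h1]; ring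
  have := vertex_sequence_eq_zero hκ ((map_ne_zero (starRingEnd ℂ)).2 hκ) h0 hy
    (fun n => (h.vertex_equations hq hph n).1) (fun n => (h.vertex_equations hq hph n).2)
  exact h.eq_zero hq hph (fun n => (this n).1) (fun n => (this n).2) e

theorem mem_eigenspace {E : Type*} [NormedAddCommGroup E] [InnerProductSpace ℂ E]
    {T : E →ₗ.[ℂ] E} {lam : ℂ} {x : T.domain} :
    x ∈ eigenspace T lam ↔ T x = lam • (x : E) := by
  rw [eigenspace, LinearMap.mem_ker, LinearMap.sub_apply, sub_eq_zero]
  rfl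

/-- The values of an eigenvector on the edges. -/
def edgeValues (T : L2Graph →ₗ.[ℂ] L2Graph) (lam : ℂ) : eigenspace T lam →ₗ[ℂ] (Edge → EdgeL2) where
  toFun x := fun e => (x : L2Graph) e
  map_add' _ _ := rfl
  map_smul' _ _ := rfl

theorem edgeValues_injective (T : L2Graph →ₗ.[ℂ] L2Graph) (lam : ℂ) :
    Function.Injective (edgeValues T lam) := by
  intro x y h
  exact Subtype.ext (Subtype.ext (lp.ext h))

/-- An eigenfunction is a graph solution determined by its two Cauchy data on the edge `(0, 0)`. The
span of `Θ` and `Φ` is taken edge by edge, since neither need be square integrable on the graph. -/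
theorem finiteDimensional_eigenspace (hq : MemLp q 2 edgeMeasure) (hc : cK N a k ≠ 0) {lam : ℂ}
    (hph : phi1 q lam ≠ 0) : FiniteDimensional ℂ (eigenspace (opH q N a k) lam) := by
  obtain ⟨Θ, Θ', Φ, Φ', hF⟩ := exists_isFundamentalPair (N := N) (a := a) (k := k) hq hc hph
  have hmem : ∀ {u u' : Edge → ℝ → ℂ}, IsGraphSolution q N a k lam u u' →
      ∀ e, MemLp (u e) 2 edgeMeasure := fun h e => ((h.solves e).isW2 hq).memLp_self
  set B : Fin 2 → Edge → EdgeL2 := ![fun e => (hmem hF.solTheta e).toLp,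
    fun e => (hmem hF.solPhi e).toLp] with hB
  have hfin : FiniteDimensional ℂ (Submodule.span ℂ (Set.range B)) :=
    FiniteDimensional.span_of_finite ℂ (Set.finite_range B)
  have hle : ∀ x, edgeValues (opH q N a k) lam x ∈ Submodule.span ℂ (Set.range B) := by
    intro x
    have hx := HRel_apply (x : (opH q N a k).domain)
    rw [mem_eigenspace.1 x.2] at hx
    obtain ⟨u, u', hG, hf, -⟩ := exists_isGraphSolution_of_HRel hx
    have hD : IsGraphSolution q N a k lam
        (u + ((-u (0, 0) 0) • Θ + (-u' (0, 0) 0) • Φ))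
        (u' + ((-u (0, 0) 0) • Θ' + (-u' (0, 0) 0) • Φ')) :=
      ⟨fun e => (hG.solves e).combination hq (hF.solTheta.solves e) (hF.solPhi.solves e) _ _,
        hG.kirchhoff.combination hF.solTheta.kirchhoff hF.solPhi.kirchhoff _ _⟩
    have hz := hD.eq_zero_of_init hq hc hph
      (by simp [hF.theta_init, hF.phi_init]) (by simp [hF.theta_init', hF.phi_init'])
    have heq : edgeValues (opH q N a k) lam x = u (0, 0) 0 • B 0 + u' (0, 0) 0 • B 1 := by
      funext e
      change (x : L2Graph) e = u (0, 0) 0 • (hmem hF.solTheta e).toLp +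
        u' (0, 0) 0 • (hmem hF.solPhi e).toLp
      apply Lp.ext
      filter_upwards [hf e, Lp.coeFn_add (u (0, 0) 0 • (hmem hF.solTheta e).toLp)
        (u' (0, 0) 0 • (hmem hF.solPhi e).toLp),
        Lp.coeFn_smul (u (0, 0) 0) (hmem hF.solTheta e).toLp,
        Lp.coeFn_smul (u' (0, 0) 0) (hmem hF.solPhi e).toLp,
        (hmem hF.solTheta e).coeFn_toLp, (hmem hF.solPhi e).coeFn_toLp, ae_mem_Icc]
        with t h1 h2 h3 h4 h5 h6 h7
      have h8 := hz e t h7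
      simp only [Pi.add_apply, Pi.smul_apply, smul_eq_mul] at h8
      rw [h1, h2, Pi.add_apply, h3, h4, Pi.smul_apply, Pi.smul_apply, h5, h6, smul_eq_mul,
        smul_eq_mul]
      linear_combination h8
    rw [heq]
    exact Submodule.add_mem _ (Submodule.smul_mem _ _ (Submodule.subset_span ⟨0, rfl⟩))
      (Submodule.smul_mem _ _ (Submodule.subset_span ⟨1, rfl⟩))
  exact Module.Finite.of_injective ((edgeValues (opH q N a k) lam).codRestrict _ hle)
    fun x y h => by
      have h2 := congrArg Subtype.val h
      exact edgeValues_injective (opH q N a k) lam h2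

/-! ### Infinite multiplicity on the Dirichlet spectrum -/

/-- The slopes of a Dirichlet eigenfunction supported on the cells `0` and `1`. -/
def loopCoef (o p m : ℂ) (n : ℤ) : Fin 3 → ℂ :=
  if n = 0 then ![0, m * p, 1] else
    if n = 1 then ![o * p * m ^ 2 - 1, m * (o * p * m ^ 2 - 1 + p * (-o * m ^ 2)), -o * m ^ 2]
    else 0

/-- With zero vertex values only the flux conditions remain, and the end slope of each edge is `m`
times its initial slope. Starting with slope `1` on edge `(0, 2)` and `0` on edge `(0, 0)`, the
recursion gives cell `0` and the first slope of cell `1`. The last slope `-o m²` then makes the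
slope on edge `(1, 1)` equal to `-m`, which closes the loop: nothing enters cell `2`. -/
theorem loopCoef_lower (o p m : ℂ) (n : ℤ) :
    -(loopCoef o p m n 0 * m) + loopCoef o p m n 1 - p * (loopCoef o p m n 2 * m) = 0 := by
  unfold loopCoef
  split_ifs
  · simp
    ring
  · simp
    ring
  · simp

theorem loopCoef_upper (o p m : ℂ) (n : ℤ) :
    loopCoef o p m (n + 1) 0 - o * (loopCoef o p m n 1 * m) + loopCoef o p m n 2 = 0 := by
  unfold loopCoef
  split_ifs <;> first | omega | (simp; try ring)

theorem inclL_edgeSol_ne_zero (hq : MemLp q 2 edgeMeasure) (lam : ℂ) :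
    inclL (edgeSol hq lam (0, 1, 0)) ≠ 0 := by
  intro h
  have hW := isW2_edgeSol hq lam 0 1 0
  have h0 := (inclL_ae (edgeSol hq lam (0, 1, 0))).symm.trans
    ((Lp.eq_zero_iff_ae_eq_zero).1 h)
  have hw := (Lp.eq_zero_iff_ae_eq_zero).2 (hW.eq_zero h0).2
  obtain ⟨C, -, hT⟩ := exists_trace_bound_Lp
  have h1 := (hT hW (inclL_ae _)).2
  rw [h, hw, edgeSol'_zero] at h1
  norm_num at h1

/-- Translates by `2d` have disjoint supports, and the edge `(2d, 2)` sees exactly one of them;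
evaluation there gives linear independence. -/
theorem exists_loop_eigenvector (hq : MemLp q 2 edgeMeasure) {lam : ℂ} (hph : phi1 q lam = 0)
    (d : ℤ) : ∃ x : eigenspace (opH q N a k) lam, ∀ d' : ℤ,
      edgeValues (opH q N a k) lam x (2 * d', 2) =
        if d' = d then inclL (edgeSol hq lam (0, 1, 0)) else 0 := by
  set β : Edge → ℂ := fun e => loopCoef (om a) (om a * sPow N k) (phi1' q lam) (e.1 - 2 * d) e.2
    with hβ
  have hfin : Summable fun e => ‖β e‖ ^ 2 := by
    refine summable_of_ne_finset_zero (s := {2 * d, 2 * d + 1} ×ˢ Finset.univ) fun e he => ?_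
    have h1 : e.1 - 2 * d ≠ 0 := fun h => he (by
      simp only [Finset.mem_product, Finset.mem_insert, Finset.mem_univ, and_true]
      left; omega)
    have h2 : e.1 - 2 * d ≠ 1 := fun h => he (by
      simp only [Finset.mem_product, Finset.mem_insert, Finset.mem_singleton, Finset.mem_univ,
        and_true]
      right; omega)
    simp [hβ, loopCoef, h1, h2]
  have hK : Kirchhoff N a k (fun e => ext (edgeSol hq lam (0, β e, (0 : L2Graph) e)))
      (fun e => ext (edgeSol' hq lam (0, β e, (0 : L2Graph) e))) := by
    have e0 : ∀ e, ext (edgeSol hq lam (0, β e, (0 : L2Graph) e)) 1 = 0 := fun e => by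
      have := edgeSol_hom_one hq lam 0 (β e)
      rw [hph, zero_mul, mul_zero, add_zero] at this
      exact this
    have e1 : ∀ e, ext (edgeSol' hq lam (0, β e, (0 : L2Graph) e)) 1 = β e * phi1' q lam :=
      fun e => by
        have := edgeSol'_hom_one hq lam 0 (β e)
        rw [zero_mul, zero_add] at this
        exact this
    constructor <;> intro n <;> simp only [edgeSol_zero, edgeSol'_zero, e0, e1, mul_zero]
    · exact loopCoef_lower _ _ _ (n - 2 * d)
    · have := loopCoef_upper (om a) (om a * sPow N k) (phi1' q lam) (n - 2 * d)
      rw [show n - 2 * d + 1 = n + 1 - 2 * d by ring] at this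
      exact this
  obtain ⟨f, hf, hH⟩ := HRel_of_edgeSol hq lam (α := 0) (by simp) hfin 0 hK
  rw [zero_add] at hH
  obtain ⟨x, rfl, hx⟩ := exists_domain_of_HRel hH
  refine ⟨⟨x, mem_eigenspace.2 hx⟩, fun d' => ?_⟩
  change (x : L2Graph) (2 * d', 2) = _
  rw [hf]
  have h2 : (0 : L2Graph) (2 * d', 2) = 0 := rfl
  split_ifs with h
  · have h1 : β (2 * d', 2) = 1 := by simp [hβ, loopCoef, h]
    rw [h1, h2]
    rfl
  · have h1 : β (2 * d', 2) = 0 := by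
      have e1 : 2 * d' - 2 * d ≠ 0 := by omega
      have e2 : 2 * d' - 2 * d ≠ 1 := by omega
      simp [hβ, loopCoef, e1, e2]
    rw [h1, h2]
    have : (((0 : Edge → ℂ) (2 * d', 2), 0, 0) : ℂ × ℂ × EdgeL2) = 0 := rfl
    rw [this, map_zero, map_zero]

theorem not_finiteDimensional_eigenspace (hq : MemLp q 2 edgeMeasure) {lam : ℂ}
    (hph : phi1 q lam = 0) : ¬ FiniteDimensional ℂ (eigenspace (opH q N a k) lam) := by
  intro hfd
  choose x hx using exists_loop_eigenvector (N := N) (a := a) (k := k) hq hph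
  have hli : LinearIndependent ℂ x := by
    rw [linearIndependent_iff']
    intro s g hg d hd
    have h1 := congrArg (fun y => edgeValues (opH q N a k) lam y (2 * d, 2)) hg
    simp only [map_sum, map_smul, Finset.sum_apply, Pi.smul_apply, hx, map_zero,
      Pi.zero_apply] at h1
    rw [Finset.sum_eq_single d (fun b _ hb => by rw [if_neg hb.symm, smul_zero])
      (fun h => absurd hd h), if_pos rfl] at h1
    exact (smul_eq_zero.1 h1).resolve_right (inclL_edgeSol_ne_zero hq lam)
  have := hli.finite
  exact not_finite ℤ

theorem infSpectrum_opH (hq : MemLp q 2 edgeMeasure) (hc : cK N a k ≠ 0) :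
    infSpectrum (opH q N a k) = dirichletSpectrum q := by
  ext lam
  rw [mem_dirichletSpectrum_iff hq]
  refine ⟨fun h => ?_, fun h => not_finiteDimensional_eigenspace hq h⟩
  by_contra hph
  exact h (finiteDimensional_eigenspace hq hc hph)

theorem infSpectrum_subset_opSpectrum {E : Type*} [NormedAddCommGroup E] [InnerProductSpace ℂ E]
    (T : E →ₗ.[ℂ] E) : infSpectrum T ⊆ opSpectrum T := by
  intro lam h hr
  obtain ⟨C, hC⟩ := hr
  obtain ⟨f, -, -, -, hu⟩ := hC 0 trivial
  have hz : ∀ x ∈ eigenspace T lam, x = f := fun x hx =>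
    hu x trivial (by rw [mem_eigenspace.1 hx, sub_self])
  apply h
  have hs : Subsingleton (eigenspace T lam) :=
    ⟨fun x y => Subtype.ext ((hz x x.2).trans (hz y y.2).symm)⟩
  infer_instance

end

section

/-! ### Parseval's identity on an arc -/

/-- Parseval on the circle for `f` cut off outside the arc. The integrals are `2π` times the Fourier
coefficients of index `-n`, whence the reflection of the index set. -/
theorem hasSum_norm_sq_fourier {c d : ℝ} (hc : 0 ≤ c) (hd : d ≤ 2 * Real.pi) {f : ℝ → ℂ}
    (hf : Continuous f) :
    HasSum (fun n : ℤ => ‖∫ θ in Set.Icc c d, Complex.exp (θ * Complex.I) ^ n * f θ‖ ^ 2)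
      (2 * Real.pi * ∫ θ in Set.Icc c d, ‖f θ‖ ^ 2) := by
  have h2π : (0 : ℝ) < 2 * Real.pi := Real.two_pi_pos
  set F : ℝ → ℂ := (Set.Ioc c d).indicator f with hF
  have hsub : Set.Ioc 0 (2 * Real.pi) ∩ Set.Ioc c d = Set.Ioc c d :=
    Set.inter_eq_self_of_subset_right fun x hx => ⟨hc.trans_lt hx.1, hx.2.trans hd⟩
  obtain ⟨M, hM⟩ := (isCompact_Icc (a := c) (b := d)).exists_bound_of_continuousOn hf.continuousOn
  have hL2 : MemLp F 2 (volume.restrict (Set.Ioc 0 (2 * Real.pi))) := by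
    refine MemLp.of_bound (hf.aestronglyMeasurable.indicator measurableSet_Ioc) |M|
      (Filter.Eventually.of_forall fun x => ?_)
    by_cases hx : x ∈ Set.Ioc c d
    · rw [hF, Set.indicator_of_mem hx]
      exact (hM x ⟨hx.1.le, hx.2⟩).trans (le_abs_self M)
    · rw [hF, Set.indicator_of_notMem hx, norm_zero]
      exact abs_nonneg M
  have h := hasSum_sq_fourierCoeffOn h2π hL2
  have h1 : ∀ n : ℤ, fourierCoeffOn h2π F (-n) = (1 / (2 * Real.pi) : ℝ) •
      ∫ θ in Set.Icc c d, Complex.exp (θ * Complex.I) ^ n * f θ := by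
    intro n
    rw [fourierCoeffOn_eq_integral, sub_zero, neg_neg]
    congr 1
    have e1 : ∀ x : ℝ, fourier n (x : AddCircle (2 * Real.pi)) • F x =
        (Set.Ioc c d).indicator (fun θ : ℝ => Complex.exp (θ * Complex.I) ^ n * f θ) x := by
      intro x
      by_cases hx : x ∈ Set.Ioc c d
      · rw [hF, Set.indicator_of_mem hx, Set.indicator_of_mem hx, fourier_coe_apply,
          ← Complex.exp_int_mul, smul_eq_mul]
        congr 2
        have : (Real.pi : ℂ) ≠ 0 := Complex.ofReal_ne_zero.2 Real.pi_ne_zero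
        push_cast
        field_simp
      · rw [hF, Set.indicator_of_notMem hx, Set.indicator_of_notMem hx, smul_zero]
    rw [intervalIntegral.integral_of_le h2π.le]
    simp only [e1]
    rw [setIntegral_indicator measurableSet_Ioc, hsub, integral_Icc_eq_integral_Ioc]
  have h2 : ∫ x in (0 : ℝ)..2 * Real.pi, ‖F x‖ ^ 2 = ∫ θ in Set.Icc c d, ‖f θ‖ ^ 2 := by
    rw [intervalIntegral.integral_of_le h2π.le]
    have e1 : ∀ x, ‖F x‖ ^ 2 = (Set.Ioc c d).indicator (fun θ => ‖f θ‖ ^ 2) x := by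
      intro x
      by_cases hx : x ∈ Set.Ioc c d
      · rw [hF, Set.indicator_of_mem hx, Set.indicator_of_mem hx]
      · rw [hF, Set.indicator_of_notMem hx, Set.indicator_of_notMem hx]
        simp
    simp only [e1]
    rw [setIntegral_indicator measurableSet_Ioc, hsub, integral_Icc_eq_integral_Ioc]
  rw [h2, ← (Equiv.neg ℤ).hasSum_iff] at h
  have h3 := h.mul_left ((2 * Real.pi) ^ 2)
  have h4 : (fun n : ℤ => ‖∫ θ in Set.Icc c d, Complex.exp (θ * Complex.I) ^ n * f θ‖ ^ 2) =
      fun i => (2 * Real.pi) ^ 2 * ((fun i => ‖fourierCoeffOn h2π F i‖ ^ 2) ∘ Equiv.neg ℤ) i := by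
    funext n
    rw [Function.comp_apply, Equiv.neg_apply, h1, norm_smul, mul_pow, Real.norm_of_nonneg
      (by positivity)]
    generalize (∫ θ in Set.Icc c d, Complex.exp (θ * Complex.I) ^ n * f θ) = z
    field_simp
  have h5 : 2 * Real.pi * ∫ θ in Set.Icc c d, ‖f θ‖ ^ 2 =
      (2 * Real.pi) ^ 2 * (2 * Real.pi - 0)⁻¹ • ∫ θ in Set.Icc c d, ‖f θ‖ ^ 2 := by
    rw [smul_eq_mul, sub_zero]
    field_simp
  rw [h4, h5]
  exact h3

theorem norm_sq_inclL (u : EdgeC) : ‖inclL u‖ ^ 2 = ∫ s, ‖ext u s‖ ^ 2 ∂edgeMeasure := by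
  have h1 : ((‖inclL u‖ ^ 2 : ℝ) : ℂ) = ((∫ s, ‖ext u s‖ ^ 2 ∂edgeMeasure : ℝ) : ℂ) := by
    rw [← inner_self_ofReal, L2.inner_def, ← integral_complex_ofReal]
    apply integral_congr_ae
    filter_upwards [inclL_ae u] with s hs
    rw [hs]
    simp [inner_self_eq_norm_sq_to_K]
  exact_mod_cast h1

theorem ext_integral {c d : ℝ} {V : ℝ → EdgeC} (hV : Continuous V) (s : ℝ) :
    ext (∫ θ in Set.Icc c d, V θ) s = ∫ θ in Set.Icc c d, ext (V θ) s := by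
  have h := (evalL (Set.projIcc 0 1 zero_le_one s)).integral_comp_comm
    (hV.integrableOn_Icc (a := c) (b := d) (μ := volume))
  exact h.symm

theorem continuous_ext_prod {V : ℝ → EdgeC} (hV : Continuous V) :
    Continuous fun p : ℝ × ℝ => ext (V p.2) p.1 := by
  have h1 : Continuous fun p : ℝ × ℝ => Set.projIcc (0 : ℝ) 1 zero_le_one p.1 :=
    continuous_projIcc.comp continuous_fst
  have h2 : Continuous fun p : ℝ × ℝ => V p.2 := hV.comp continuous_snd
  exact h2.eval h1

/-- Parseval's identity for functions with values in `C[0,1]`, in the `L²`-norm. -/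
theorem hasSum_norm_sq_inclL {c d : ℝ} (hc : 0 ≤ c) (hd : d ≤ 2 * Real.pi) {V : ℝ → EdgeC}
    (hV : Continuous V) :
    HasSum (fun n : ℤ =>
        ‖inclL (∫ θ in Set.Icc c d, Complex.exp (θ * Complex.I) ^ n • V θ)‖ ^ 2)
      (2 * Real.pi * ∫ θ in Set.Icc c d, ‖inclL (V θ)‖ ^ 2) := by
  set U : ℤ → EdgeC := fun n => ∫ θ in Set.Icc c d, Complex.exp (θ * Complex.I) ^ n • V θ with hU
  have hexp : ∀ n : ℤ, Continuous fun θ : ℝ => Complex.exp (θ * Complex.I) ^ n := fun n =>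
    Continuous.zpow₀ (by fun_prop) n fun θ => Or.inl (Complex.exp_ne_zero _)
  have hcs : ∀ s : ℝ, Continuous fun θ => ext (V θ) s := fun s =>
    (evalL (Set.projIcc 0 1 zero_le_one s)).continuous.comp hV
  have hp : ∀ s : ℝ, HasSum (fun n : ℤ => ‖ext (U n) s‖ ^ 2)
      (2 * Real.pi * ∫ θ in Set.Icc c d, ‖ext (V θ) s‖ ^ 2) := by
    intro s
    have h := hasSum_norm_sq_fourier hc hd (hcs s)
    have e : ∀ n : ℤ, ext (U n) s =
        ∫ θ in Set.Icc c d, Complex.exp (θ * Complex.I) ^ n * ext (V θ) s := fun n => by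
      exact ext_integral (V := fun θ : ℝ => Complex.exp (θ * Complex.I) ^ n • V θ)
        ((hexp n).smul hV) s
    simpa only [e] using h
  have hint : Integrable (fun p : ℝ × ℝ => ‖ext (V p.2) p.1‖ ^ 2)
      (edgeMeasure.prod (volume.restrict (Set.Icc c d))) := by
    rw [edgeMeasure, Measure.prod_restrict]
    exact ((continuous_ext_prod hV).norm.pow 2).continuousOn.integrableOn_compact
      (isCompact_Icc.prod isCompact_Icc)
  have hcU : ∀ n, Integrable (fun s => ‖ext (U n) s‖ ^ 2) edgeMeasure := fun n =>
    ((continuous_ext (U n)).norm.pow 2).integrableOn_Icc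
  -- Parseval holds pointwise in `s`; it bounds every finite partial sum of the integrals, which
  -- justifies exchanging sum and integral.
  have hsum : Summable fun n : ℤ => ∫ s, ‖ext (U n) s‖ ^ 2 ∂edgeMeasure := by
    refine summable_of_sum_le (c := ∫ s, (2 * Real.pi * ∫ θ in Set.Icc c d, ‖ext (V θ) s‖ ^ 2)
      ∂edgeMeasure) (fun n => integral_nonneg fun s => sq_nonneg _) fun S => ?_
    rw [← integral_finsetSum _ fun n _ => hcU n]
    refine integral_mono (integrable_finsetSum _ fun n _ => hcU n)
      (hint.integral_prod_left.const_mul _) fun s => ?_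
    exact sum_le_hasSum S (fun n _ => sq_nonneg _) (hp s)
  have hmain := hasSum_integral_of_summable_integral_norm (μ := edgeMeasure)
    (F := fun (n : ℤ) s => ‖ext (U n) s‖ ^ 2) hcU (by simpa using hsum)
  simp only [fun s => (hp s).tsum_eq] at hmain
  rw [integral_const_mul, integral_integral_swap hint] at hmain
  simpa only [norm_sq_inclL] using hmain

/-! ### The spectral parameter as a function of the quasimomentum -/

namespace BandFunction

variable {w : ℂ → ℂ}

/-- By the inverse function theorem `w` is locally invertible along the real axis near `x₀`, and `L`
is this inverse composed with `cos` near `arccos r`. Clamping `θ` to `[c, d]` makes `L` continuous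
on the whole line with values in the open band. -/
theorem exists_parametrization (h : BandFunction w) {x₀ r : ℝ} (hr : r ∈ Set.Ioo (-1 : ℝ) 1)
    (h0 : w x₀ = r) {ε : ℝ} (hε : 0 < ε) :
    ∃ c d : ℝ, ∃ L : ℝ → ℝ, 0 < c ∧ c < d ∧ d < Real.pi ∧ Continuous L ∧
      (∀ θ, |L θ - x₀| < ε) ∧ (∀ θ, ∃ y ∈ Set.Ioo (-1 : ℝ) 1, w (L θ) = y) ∧
      ∀ θ ∈ Set.Icc c d, w (L θ) = Real.cos θ := by
  have hs := (h.diff.analyticAt (x₀ : ℂ)).hasStrictDerivAt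
  have hsr := hs.real_of_complex
  have him : (deriv w x₀).im = 0 := by
    have h1 : HasDerivAt (fun z => -Complex.I * w z) (-Complex.I * deriv w x₀) x₀ :=
      hs.hasDerivAt.const_mul _
    have h2 := h1.real_of_complex
    have h3 : (fun x : ℝ => (-Complex.I * w x).re) = fun _ => 0 := by
      funext x
      rw [h.eq_ofReal_re x]
      simp
    rw [h3] at h2
    have := h2.unique (hasDerivAt_const x₀ (0 : ℝ))
    simpa using this
  have hne : (deriv w x₀).re ≠ 0 := by
    intro hre
    exact h.deriv_ne_zero hr h0 (Complex.ext hre him)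
  have hreal : ∀ x : ℝ, w x = ((w x).re : ℂ) := h.eq_ofReal_re
  set f : ℝ → ℝ := fun x => (w x).re with hf
  have hf0 : f x₀ = r := by rw [hf]; dsimp only; rw [h0, Complex.ofReal_re]
  set e := (hsr.hasStrictFDerivAt_equiv hne).toOpenPartialHomeomorph f with he
  have hsrc : x₀ ∈ e.source :=
    (hsr.hasStrictFDerivAt_equiv hne).mem_toOpenPartialHomeomorph_source
  have hcoe : ∀ x, e x = f x := fun x => rfl
  have htgt : r ∈ e.target := by
    rw [← hf0, ← hcoe]
    exact e.map_source hsrc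
  have hinv : e.symm r = x₀ := by
    rw [← hf0, ← hcoe]
    exact e.left_inv hsrc
  set θ₀ := Real.arccos r with hθ₀
  have hcos : Real.cos θ₀ = r := Real.cos_arccos hr.1.le hr.2.le
  have hθpos : 0 < θ₀ := Real.arccos_pos.2 hr.2
  have hθpi : θ₀ < Real.pi := by
    refine lt_of_le_of_ne (Real.arccos_le_pi r) fun h => ?_
    rw [h, Real.cos_pi] at hcos
    exact hr.1.ne hcos
  have hnb : ∀ᶠ θ in 𝓝 θ₀, (0 < θ ∧ θ < Real.pi) ∧ Real.cos θ ∈ e.target ∧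
      |e.symm (Real.cos θ) - x₀| < ε := by
    have h1 : ∀ᶠ y in 𝓝 r, y ∈ e.target ∧ |e.symm y - x₀| < ε := by
      refine (e.open_target.eventually_mem htgt).and ?_
      have h2 := (e.continuousAt_symm htgt).eventually
        (Metric.ball_mem_nhds (e.symm r) hε)
      rw [hinv] at h2
      filter_upwards [h2] with y hy
      rwa [Real.dist_eq] at hy
    have h3 : Filter.Tendsto Real.cos (𝓝 θ₀) (𝓝 r) := by
      rw [← hcos]
      exact Real.continuous_cos.continuousAt
    have h4 : ∀ᶠ θ in 𝓝 θ₀, 0 < θ ∧ θ < Real.pi := Ioo_mem_nhds hθpos hθpi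
    exact h4.and (h3.eventually h1)
  obtain ⟨δ, hδ, hb⟩ := Metric.eventually_nhds_iff.1 hnb
  have hcd : θ₀ - δ / 2 ≤ θ₀ + δ / 2 := by linarith
  have hK : ∀ θ ∈ Set.Icc (θ₀ - δ / 2) (θ₀ + δ / 2), (0 < θ ∧ θ < Real.pi) ∧
      Real.cos θ ∈ e.target ∧ |e.symm (Real.cos θ) - x₀| < ε := by
    intro θ hθ
    refine hb ?_
    rw [Real.dist_eq, abs_lt]
    constructor <;> linarith [hθ.1, hθ.2]
  set pr : ℝ → ℝ := fun θ => Set.projIcc (θ₀ - δ / 2) (θ₀ + δ / 2) hcd θ with hpr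
  have hprm : ∀ θ, pr θ ∈ Set.Icc (θ₀ - δ / 2) (θ₀ + δ / 2) := fun θ => Subtype.mem _
  have hprc : Continuous pr := continuous_subtype_val.comp continuous_projIcc
  have hval : ∀ θ, w (e.symm (Real.cos (pr θ)) : ℝ) = Real.cos (pr θ) := by
    intro θ
    rw [hreal]
    congr 1
    exact e.right_inv (hK _ (hprm θ)).2.1
  refine ⟨θ₀ - δ / 2, θ₀ + δ / 2, fun θ => e.symm (Real.cos (pr θ)),
    (hK _ (Set.left_mem_Icc.2 hcd)).1.1, by linarith, (hK _ (Set.right_mem_Icc.2 hcd)).1.2,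
    ?_, fun θ => (hK _ (hprm θ)).2.2, fun θ => ⟨_, ?_, hval θ⟩, fun θ hθ => ?_⟩
  · exact e.continuousOn_symm.comp_continuous (Real.continuous_cos.comp hprc)
      fun θ => (hK _ (hprm θ)).2.1
  · obtain ⟨⟨h1, h2⟩, -, -⟩ := hK _ (hprm θ)
    constructor
    · rw [← Real.cos_pi]
      exact Real.cos_lt_cos_of_nonneg_of_le_pi h1.le le_rfl h2
    · rw [← Real.cos_zero]
      exact Real.cos_lt_cos_of_nonneg_of_le_pi le_rfl h2.le h1
  · have h1 : pr θ = θ := by rw [hpr]; dsimp only; rw [Set.projIcc_of_mem hcd hθ]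
    have := hval θ
    rw [h1] at this
    dsimp only
    rw [h1]
    exact this

/-- Null sets of the spectral parameter correspond to null sets of the quasimomentum. -/
theorem volume_preimage_eq_zero (h : BandFunction w) {c d : ℝ} {L : ℝ → ℝ} (hc : 0 < c)
    (hd : d < Real.pi) (hL : ∀ θ ∈ Set.Icc c d, w (L θ) = Real.cos θ) {S : Set ℝ}
    (hS : volume S = 0) : volume (L ⁻¹' S ∩ Set.Icc c d) = 0 := by
  -- `θ = arccos (w (L θ))` on the arc, so the preimage lies in the image of `S` under a map
  -- differentiable where `w ≠ ±1`; such maps preserve null sets.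
  set f : ℝ → ℝ := fun x => Real.arccos (w x).re with hf
  set S' := S ∩ {x : ℝ | (w x).re ≠ -1 ∧ (w x).re ≠ 1} with hS'
  have h1 : DifferentiableOn ℝ f S' := by
    intro x hx
    have h2 := ((h.diff (x : ℂ)).hasDerivAt.real_of_complex).differentiableAt
    exact ((Real.differentiableAt_arccos.2 hx.2).comp x h2).differentiableWithinAt
  have h2 : volume (f '' S') = 0 :=
    addHaar_image_eq_zero_of_differentiableOn_of_addHaar_eq_zero volume h1
      (measure_mono_null Set.inter_subset_left hS)
  refine measure_mono_null ?_ h2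
  rintro θ ⟨hθS, hθ⟩
  have h3 : (w (L θ)).re = Real.cos θ := by rw [hL θ hθ, Complex.ofReal_re]
  have h4 : 0 < θ := hc.trans_le hθ.1
  have h5 : θ < Real.pi := hθ.2.trans_lt hd
  refine ⟨L θ, ⟨hθS, ?_, ?_⟩, ?_⟩
  · rw [h3, ← Real.cos_pi]
    exact (Real.cos_lt_cos_of_nonneg_of_le_pi h4.le le_rfl h5).ne'
  · rw [h3, ← Real.cos_zero]
    exact (Real.cos_lt_cos_of_nonneg_of_le_pi le_rfl h5.le h4).ne
  · rw [hf]
    dsimp only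
    rw [h3, Real.arccos_cos h4.le h5.le]

end BandFunction

end

section

variable {q : ℝ → ℝ} {N : ℕ} {a : ℝ} {k : ℤ}

/-! ### Superpositions of Bloch waves -/

/-- Profiles `V j` of Bloch waves with multipliers `σ e^{iθ}`, for quasimomenta in `[c, d]`. -/
structure BlochFamily where
  c : ℝ
  d : ℝ
  σ : ℂ
  V : Fin 3 → C(ℝ, EdgeC)
  c_nonneg : 0 ≤ c
  c_lt_d : c < d
  d_le : d ≤ 2 * Real.pi
  norm_σ : ‖σ‖ = 1

namespace BlochFamily

variable (D : BlochFamily)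

/-- The Floquet multiplier. -/
def mult (θ : ℝ) : ℂ := D.σ * Complex.exp (θ * Complex.I)

theorem σ_ne_zero : D.σ ≠ 0 := by
  intro h
  have := D.norm_σ
  rw [h, norm_zero] at this
  exact zero_ne_one this

theorem mult_ne_zero (θ : ℝ) : D.mult θ ≠ 0 := mul_ne_zero D.σ_ne_zero (Complex.exp_ne_zero _)

theorem continuous_mult : Continuous D.mult := by
  unfold mult
  fun_prop

theorem continuous_mult_zpow (n : ℤ) : Continuous fun θ => D.mult θ ^ n :=
  D.continuous_mult.zpow₀ n fun θ => Or.inl (D.mult_ne_zero θ)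

/-- The superposition with amplitude `G`, on the edge `e`. -/
def edge (G : C(ℝ, ℂ)) (e : Edge) : EdgeC :=
  ∫ θ in Set.Icc D.c D.d, (G θ * D.mult θ ^ e.1) • D.V e.2 θ

theorem continuous_integrand (G : C(ℝ, ℂ)) (e : Edge) :
    Continuous fun θ => (G θ * D.mult θ ^ e.1) • D.V e.2 θ :=
  (G.continuous.mul (D.continuous_mult_zpow e.1)).smul (D.V e.2).continuous

theorem edge_eq (G : C(ℝ, ℂ)) (e : Edge) : D.edge G e = D.σ ^ e.1 •
    ∫ θ in Set.Icc D.c D.d, Complex.exp (θ * Complex.I) ^ e.1 • (G θ • D.V e.2 θ) := by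
  rw [edge, ← integral_smul]
  congr 1
  funext θ
  rw [mult, mul_zpow, smul_smul, smul_smul]
  congr 1
  ring

theorem hasSum_row (G : C(ℝ, ℂ)) (j : Fin 3) :
    HasSum (fun n : ℤ => ‖inclL (D.edge G (n, j))‖ ^ 2)
      (2 * Real.pi * ∫ θ in Set.Icc D.c D.d, ‖G θ‖ ^ 2 * ‖inclL (D.V j θ)‖ ^ 2) := by
  have h := hasSum_norm_sq_inclL D.c_nonneg D.d_le
    (G.continuous.smul (D.V j).continuous)
  have h1 : ∀ n : ℤ, ‖inclL (D.edge G (n, j))‖ ^ 2 = ‖inclL (∫ θ in Set.Icc D.c D.d,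
      Complex.exp (θ * Complex.I) ^ n • (G θ • D.V j θ))‖ ^ 2 := by
    intro n
    rw [edge_eq, map_smul, norm_smul, norm_zpow, D.norm_σ, one_zpow, one_mul]
  have h2 : ∀ θ : ℝ, ‖inclL (G θ • D.V j θ)‖ ^ 2 = ‖G θ‖ ^ 2 * ‖inclL (D.V j θ)‖ ^ 2 := by
    intro θ
    rw [map_smul, norm_smul, mul_pow]
  simp only [h1]
  simpa only [Pi.smul_apply', h2] using h

theorem summable_edge_norm (G : C(ℝ, ℂ)) : Summable fun e => ‖inclL (D.edge G e)‖ ^ 2 :=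
  summable_edge (fun _ => sq_nonneg _) fun j => (D.hasSum_row G j).summable

theorem edge_add (G₁ G₂ : C(ℝ, ℂ)) (e : Edge) :
    D.edge (G₁ + G₂) e = D.edge G₁ e + D.edge G₂ e := by
  rw [edge, edge, edge, ← integral_add (D.continuous_integrand G₁ e).integrableOn_Icc
    (D.continuous_integrand G₂ e).integrableOn_Icc]
  congr 1
  funext θ
  rw [ContinuousMap.add_apply, add_mul]
  exact add_smul (G₁ θ * D.mult θ ^ e.1) (G₂ θ * D.mult θ ^ e.1) (D.V e.2 θ)

theorem edge_smul (z : ℂ) (G : C(ℝ, ℂ)) (e : Edge) : D.edge (z • G) e = z • D.edge G e := by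
  rw [edge, edge, ← integral_smul]
  congr 1
  funext θ
  rw [ContinuousMap.smul_apply, smul_eq_mul, smul_smul, mul_assoc]

/-- The superposition of Bloch waves with amplitude `G`. -/
def packet : C(ℝ, ℂ) →ₗ[ℂ] L2Graph where
  toFun G := mkL2 (fun e => inclL (D.edge G e)) (D.summable_edge_norm G)
  map_add' G₁ G₂ := by
    apply lp.ext
    funext e
    change inclL (D.edge (G₁ + G₂) e) = inclL (D.edge G₁ e) + inclL (D.edge G₂ e)
    rw [edge_add, map_add]
  map_smul' z G := by
    apply lp.ext
    funext e
    change inclL (D.edge (z • G) e) = z • inclL (D.edge G e)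
    rw [edge_smul, map_smul]

theorem packet_apply (G : C(ℝ, ℂ)) (e : Edge) : D.packet G e = inclL (D.edge G e) := rfl

/-- The spectral density with respect to the quasimomentum. -/
def density (θ : ℝ) : ℝ := 2 * Real.pi * ∑ j, ‖inclL (D.V j θ)‖ ^ 2

theorem continuous_density : Continuous D.density := by
  unfold density
  have h : ∀ j, Continuous fun θ => ‖inclL (D.V j θ)‖ ^ 2 := fun j =>
    (inclL.continuous.comp (D.V j).continuous).norm.pow 2
  exact continuous_const.mul (continuous_finsetSum _ fun j _ => h j)

theorem density_nonneg (θ : ℝ) : 0 ≤ D.density θ :=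
  mul_nonneg Real.two_pi_pos.le (Finset.sum_nonneg fun _ _ => sq_nonneg _)

theorem norm_sq_packet (G : C(ℝ, ℂ)) :
    ‖D.packet G‖ ^ 2 = ∫ θ in Set.Icc D.c D.d, ‖G θ‖ ^ 2 * D.density θ := by
  have h1 : ‖D.packet G‖ ^ 2 = ∑' e, ‖inclL (D.edge G e)‖ ^ 2 := by
    have := lp.norm_rpow_eq_tsum (p := 2) (by norm_num) (D.packet G)
    simpa [packet_apply] using this
  have h2 : Summable fun p : Fin 3 × ℤ => ‖inclL (D.edge G (p.2, p.1))‖ ^ 2 :=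
    (Equiv.prodComm (Fin 3) ℤ).summable_iff.2 (D.summable_edge_norm G)
  have h3 : ∑' e, ‖inclL (D.edge G e)‖ ^ 2 =
      ∑' p : Fin 3 × ℤ, ‖inclL (D.edge G (p.2, p.1))‖ ^ 2 :=
    ((Equiv.prodComm (Fin 3) ℤ).tsum_eq fun e => ‖inclL (D.edge G e)‖ ^ 2).symm
  have h4 : ∀ j, Continuous fun θ => ‖G θ‖ ^ 2 * ‖inclL (D.V j θ)‖ ^ 2 := fun j =>
    (G.continuous.norm.pow 2).mul ((inclL.continuous.comp (D.V j).continuous).norm.pow 2)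
  rw [h1, h3, h2.tsum_prod, tsum_fintype]
  simp only [fun j => (D.hasSum_row G j).tsum_eq]
  rw [← Finset.mul_sum, ← integral_finsetSum _ fun j _ => (h4 j).integrableOn_Icc,
    ← integral_const_mul]
  congr 1
  funext θ
  rw [density, ← Finset.mul_sum]
  ring

/-- Polarization, applied to the norm identity on one side and to the pointwise product on the
other. -/
theorem inner_packet (G : C(ℝ, ℂ)) :
    inner ℂ (D.packet 1) (D.packet G) = ∫ θ in Set.Icc D.c D.d, G θ * D.density θ := by
  have hn : ∀ H : C(ℝ, ℂ), ((‖D.packet H‖ : ℂ)) ^ 2 =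
      ∫ θ in Set.Icc D.c D.d, ((‖H θ‖ ^ 2 * D.density θ : ℝ) : ℂ) := by
    intro H
    rw [integral_complex_ofReal, ← norm_sq_packet]
    push_cast
    rfl
  have hi : ∀ H : C(ℝ, ℂ), IntegrableOn (fun θ => ((‖H θ‖ ^ 2 * D.density θ : ℝ) : ℂ))
      (Set.Icc D.c D.d) volume := fun H =>
    (Complex.continuous_ofReal.comp ((H.continuous.norm.pow 2).mul
      D.continuous_density)).integrableOn_Icc
  have h := inner_eq_sum_norm_sq_div_four (𝕜 := ℂ) (D.packet 1) (D.packet G)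
  rw [h, ← map_smul, ← map_add, ← map_add, ← map_sub, ← map_sub]
  have hcoe : ∀ v : L2Graph, (RCLike.ofReal ‖v‖ : ℂ) = (‖v‖ : ℂ) := fun v => rfl
  simp only [hcoe, hn]
  have hs : ∀ H₁ H₂ : C(ℝ, ℂ), Integrable (fun θ => ((‖H₁ θ‖ ^ 2 * D.density θ : ℝ) : ℂ) -
      ((‖H₂ θ‖ ^ 2 * D.density θ : ℝ) : ℂ)) (volume.restrict (Set.Icc D.c D.d)) :=
    fun H₁ H₂ => (hi H₁).sub (hi H₂)
  have hm : ∀ H₁ H₂ : C(ℝ, ℂ), Integrable (fun θ => (((‖H₁ θ‖ ^ 2 * D.density θ : ℝ) : ℂ) -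
      ((‖H₂ θ‖ ^ 2 * D.density θ : ℝ) : ℂ)) * (RCLike.I : ℂ))
      (volume.restrict (Set.Icc D.c D.d)) := fun H₁ H₂ => (hs H₁ H₂).mul_const _
  rw [← integral_sub (hi _) (hi _), ← integral_sub (hi _) (hi _), ← integral_mul_const,
    ← integral_add (hs _ _) (hm _ _), ← integral_div]
  congr 1
  funext θ
  have h2 := inner_eq_sum_norm_sq_div_four (𝕜 := ℂ) (1 : ℂ) (G θ)
  have h3 : inner ℂ (1 : ℂ) (G θ) = G θ := by simp
  rw [h3] at h2
  have hcoe2 : ∀ x : ℂ, (RCLike.ofReal ‖x‖ : ℂ) = (‖x‖ : ℂ) := fun v => rfl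
  simp only [hcoe2, smul_eq_mul] at h2
  conv_rhs => rw [h2]
  simp only [ContinuousMap.add_apply, ContinuousMap.sub_apply, ContinuousMap.smul_apply,
    ContinuousMap.one_apply, smul_eq_mul]
  push_cast
  ring

/-- The measure of the packet with amplitude `1`, in terms of the spectral parameter `L θ`. -/
def spectralMeasure (L : ℝ → ℝ) : Measure ℝ :=
  ((volume.restrict (Set.Icc D.c D.d)).withDensity fun θ => ENNReal.ofReal (D.density θ)).map L

theorem isFiniteMeasure_spectralMeasure (L : ℝ → ℝ) : IsFiniteMeasure (D.spectralMeasure L) := by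
  have h : IsFiniteMeasure ((volume.restrict (Set.Icc D.c D.d)).withDensity fun θ =>
      ENNReal.ofReal (D.density θ)) := by
    have h1 : IntegrableOn D.density (Set.Icc D.c D.d) volume :=
      D.continuous_density.integrableOn_Icc
    exact isFiniteMeasure_withDensity_ofReal h1.2
  unfold spectralMeasure
  infer_instance

/-- Since the operator multiplies amplitudes by `L`, the resolvent of the packet is the packet with
amplitude `1 / (L - z)`. -/
theorem isSpectralMeasure {L : ℝ → ℝ} (hL : Continuous L)
    (hH : ∀ G H : C(ℝ, ℂ), (∀ θ, H θ = L θ * G θ) → HRel q N a k (D.packet G) (D.packet H)) :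
    IsSpectralMeasure (opH q N a k) (D.packet 1) (D.spectralMeasure L) := by
  refine ⟨D.isFiniteMeasure_spectralMeasure L, fun z hz => ?_⟩
  have hne : ∀ θ, (L θ : ℂ) - z ≠ 0 := fun θ => sub_ne_zero_of_im hz (L θ)
  set G : C(ℝ, ℂ) := ⟨fun θ => ((L θ : ℂ) - z)⁻¹,
    Continuous.inv₀ (by fun_prop) hne⟩ with hG
  have hGθ : ∀ θ, G θ = ((L θ : ℂ) - z)⁻¹ := fun θ => rfl
  obtain ⟨f, hf, hTf⟩ := exists_domain_of_HRel (hH G (1 + z • G) fun θ => by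
    rw [ContinuousMap.add_apply, ContinuousMap.one_apply, ContinuousMap.smul_apply, smul_eq_mul,
      hGθ]
    have := hne θ
    field_simp
    ring)
  refine ⟨f, ?_, ?_⟩
  · rw [hTf, hf, map_add, map_smul, add_sub_cancel_right]
  · have hcont : Continuous fun t : ℝ => ((t : ℂ) - z)⁻¹ := continuous_cauchyKer hz
    rw [hf, inner_packet, spectralMeasure, integral_map hL.aemeasurable
      hcont.aestronglyMeasurable, integral_withDensity_eq_integral_toReal_smul
      D.continuous_density.measurable.ennreal_ofReal
      (Filter.Eventually.of_forall fun _ => ENNReal.ofReal_lt_top)]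
    congr 1
    funext θ
    rw [ENNReal.toReal_ofReal (D.density_nonneg θ), hGθ, Complex.real_smul, mul_comm]

theorem spectralMeasure_ac {L : ℝ → ℝ} (hL : Continuous L)
    (h0 : ∀ S : Set ℝ, volume S = 0 → volume (L ⁻¹' S ∩ Set.Icc D.c D.d) = 0) :
    D.spectralMeasure L ≪ volume := by
  refine Measure.AbsolutelyContinuous.mk fun S hS hS0 => ?_
  rw [spectralMeasure, Measure.map_apply hL.measurable hS]
  refine withDensity_absolutelyContinuous _ _ ?_
  rw [Measure.restrict_apply (hL.measurable hS)]
  exact h0 S hS0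

theorem spectralMeasure_ne_zero {L : ℝ → ℝ} (hL : Continuous L) {S : Set ℝ}
    (hS : MeasurableSet S) (hLS : ∀ θ, L θ ∈ S) (hpos : ∀ θ ∈ Set.Icc D.c D.d, 0 < D.density θ) :
    D.spectralMeasure L S ≠ 0 := by
  intro h
  have h1 : L ⁻¹' S = Set.univ := Set.eq_univ_of_forall hLS
  rw [spectralMeasure, Measure.map_apply hL.measurable hS, h1, withDensity_apply _ MeasurableSet.univ,
    Measure.restrict_univ, lintegral_eq_zero_iff D.continuous_density.measurable.ennreal_ofReal] at h
  have h2 := (ae_restrict_iff' measurableSet_Icc).1 h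
  have h3 : volume (Set.Icc D.c D.d) = 0 := by
    refine measure_mono_null (fun θ hθ => ?_) h2
    intro h4
    have h5 := ENNReal.ofReal_eq_zero.1 (h4 hθ)
    exact absurd (hpos θ hθ) (not_lt.2 h5)
  rw [Real.volume_Icc, ENNReal.ofReal_eq_zero] at h3
  linarith [D.c_lt_d]

end BlochFamily

end

section

variable {q : ℝ → ℝ} {N : ℕ} {a : ℝ} {k : ℤ}

/-! ### Wave packets in the interior of a band -/

/-- Moving `lam u` to the right-hand side makes the solution operator independent of `lam`, so
integration over the quasimomentum commutes with a single bounded operator. -/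
theorem edgeSol_eq_edgeSol_zero (hq : MemLp q 2 edgeMeasure) (lam α β : ℂ) :
    edgeSol hq lam (α, β, 0) =
      edgeSol hq 0 (α, β, lam • inclL (edgeSol hq lam (α, β, 0))) ∧
    edgeSol' hq lam (α, β, 0) =
      edgeSol' hq 0 (α, β, lam • inclL (edgeSol hq lam (α, β, 0))) := by
  have h := ((isSolution_edgeSol hq lam α β).isW2 hq).eq_edgeSol hq 0
    (lam • inclL (edgeSol hq lam (α, β, 0))) (by
      filter_upwards [Lp.coeFn_smul lam (inclL (edgeSol hq lam (α, β, 0))),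
        inclL_ae (edgeSol hq lam (α, β, 0))] with t h1 h2
      rw [h1, Pi.smul_apply, h2, smul_eq_mul]
      ring)
  rw [edgeSol_zero, edgeSol'_zero] at h
  constructor
  · ext t
    have := (h t t.2).1
    rwa [ext_of_mem _ t.2, ext_of_mem _ t.2] at this
  · ext t
    have := (h t t.2).2
    rwa [ext_of_mem _ t.2, ext_of_mem _ t.2] at this

theorem Kirchhoff.integral {S : Set ℝ} (hS : MeasurableSet S) {u u' : ℝ → Edge → ℝ → ℂ}
    (hu' : ∀ e t, IntegrableOn (fun θ => u' θ e t) S)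
    (h : ∀ θ ∈ S, Kirchhoff N a k (u θ) (u' θ)) :
    Kirchhoff N a k (fun e t => ∫ θ in S, u θ e t) (fun e t => ∫ θ in S, u' θ e t) := by
  constructor <;> intro n
  · exact setIntegral_congr_fun hS fun θ hθ => (h θ hθ).cont_lower n
  · rw [← integral_const_mul]
    exact setIntegral_congr_fun hS fun θ hθ => (h θ hθ).cont_lower' n
  · rw [← integral_const_mul]
    exact setIntegral_congr_fun hS fun θ hθ => (h θ hθ).cont_upper n
  · rw [← integral_const_mul]
    exact setIntegral_congr_fun hS fun θ hθ => (h θ hθ).cont_upper' n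
  · have h1 : IntegrableOn (fun θ => -u' θ (n, 0) 1 + u' θ (n, 1) 0) S :=
      (hu' (n, 0) 1).neg.add (hu' (n, 1) 0)
    have h0 : IntegrableOn (fun θ => -u' θ (n, 0) 1) S := (hu' (n, 0) 1).neg
    rw [← integral_const_mul, ← integral_neg, ← integral_add h0 (hu' (n, 1) 0),
      ← integral_sub h1 ((hu' (n, 2) 1).const_mul _)]
    rw [setIntegral_congr_fun hS fun θ hθ => (h θ hθ).flux_lower n]
    exact integral_zero _ _
  · have h0 : IntegrableOn (fun θ => Complex.exp (Complex.I * a) * u' θ (n, 1) 1) S :=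
      (hu' (n, 1) 1).const_mul _
    have h1 : IntegrableOn (fun θ => u' θ (n + 1, 0) 0 -
      Complex.exp (Complex.I * a) * u' θ (n, 1) 1) S := (hu' (n + 1, 0) 0).sub h0
    rw [← integral_const_mul, ← integral_sub (hu' (n + 1, 0) 0) h0,
      ← integral_add h1 (hu' (n, 2) 0)]
    rw [setIntegral_congr_fun hS fun θ hθ => (h θ hθ).flux_upper n]
    exact integral_zero _ _

theorem Kirchhoff.const_mul {u u' : Edge → ℝ → ℂ} (h : Kirchhoff N a k u u') (z : ℂ) :
    Kirchhoff N a k (fun e t => z * u e t) (fun e t => z * u' e t) := by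
  constructor <;> intro n
  · linear_combination z * h.cont_lower n
  · linear_combination z * h.cont_lower' n
  · linear_combination z * h.cont_upper n
  · linear_combination z * h.cont_upper' n
  · linear_combination z * h.flux_lower n
  · linear_combination z * h.flux_upper n

theorem smul_data (z α β : ℂ) : ((z * α, z * β, 0) : ℂ × ℂ × EdgeL2) = z • (α, β, 0) := by
  simp

namespace BlochFamily

variable (D : BlochFamily)

theorem summable_coeff (G : C(ℝ, ℂ)) {s : Fin 3 → ℝ → ℂ} (hs : ∀ j, Continuous (s j)) :
    Summable fun e : Edge => ‖∫ θ in Set.Icc D.c D.d, G θ * D.mult θ ^ e.1 * s e.2 θ‖ ^ 2 := by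
  refine summable_edge (fun _ => sq_nonneg _) fun j => ?_
  have h := (hasSum_norm_sq_fourier D.c_nonneg D.d_le (G.continuous.mul (hs j))).summable
  refine h.congr fun n => ?_
  have h1 : ∫ θ in Set.Icc D.c D.d, G θ * D.mult θ ^ n * s j θ = D.σ ^ n *
      ∫ θ in Set.Icc D.c D.d, Complex.exp (θ * Complex.I) ^ n * (G θ * s j θ) := by
    rw [← integral_const_mul]
    congr 1
    funext θ
    rw [mult, mul_zpow]
    ring
  rw [h1, norm_mul, norm_zpow, D.norm_σ, one_zpow, one_mul]
  rfl

/-- `H_k` acts on superpositions of Bloch solutions by multiplication of the amplitude. -/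
theorem HRel_packet (hq : MemLp q 2 edgeMeasure) {L : ℝ → ℝ} (hL : Continuous L)
    {s β : Fin 3 → ℝ → ℂ} (hs : ∀ j, Continuous (s j)) (hβ : ∀ j, Continuous (β j))
    (hV : ∀ j θ, D.V j θ = edgeSol hq (L θ) (s j θ, β j θ, 0))
    (hK : ∀ θ ∈ Set.Icc D.c D.d, Kirchhoff N a k
      (fun e => ext (edgeSol hq (L θ) (D.mult θ ^ e.1 * s e.2 θ, D.mult θ ^ e.1 * β e.2 θ, 0)))
      (fun e => ext (edgeSol' hq (L θ) (D.mult θ ^ e.1 * s e.2 θ, D.mult θ ^ e.1 * β e.2 θ, 0))))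
    {G H : C(ℝ, ℂ)} (hGH : ∀ θ, H θ = L θ * G θ) : HRel q N a k (D.packet G) (D.packet H) := by
  set A : Edge → ℝ → ℂ × ℂ × EdgeL2 := fun e θ =>
    (s e.2 θ, β e.2 θ, (L θ : ℂ) • inclL (D.V e.2 θ)) with hA
  have hAc : ∀ e, Continuous (A e) := fun e => (hs e.2).prodMk ((hβ e.2).prodMk
    ((Complex.continuous_ofReal.comp hL).smul (inclL.continuous.comp (D.V e.2).continuous)))
  have hm : ∀ e : Edge, Continuous fun θ => G θ * D.mult θ ^ e.1 := fun e =>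
    G.continuous.mul (D.continuous_mult_zpow e.1)
  have hV0 : ∀ e θ, D.V e.2 θ = edgeSol hq 0 (A e θ) := fun e θ => by
    have := (edgeSol_eq_edgeSol_zero hq (L θ) (s e.2 θ) (β e.2 θ)).1
    rw [← hV] at this
    exact this
  have hV0' : ∀ e θ, edgeSol' hq (L θ) (s e.2 θ, β e.2 θ, 0) = edgeSol' hq 0 (A e θ) := fun e θ => by
    have := (edgeSol_eq_edgeSol_zero hq (L θ) (s e.2 θ) (β e.2 θ)).2
    rw [← hV] at this
    exact this
  have hint : ∀ e, IntegrableOn (fun θ => (G θ * D.mult θ ^ e.1) • A e θ) (Set.Icc D.c D.d) :=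
    fun e => ((hm e).smul (hAc e)).integrableOn_Icc
  set α : Edge → ℂ := fun e => ∫ θ in Set.Icc D.c D.d, G θ * D.mult θ ^ e.1 * s e.2 θ with hα
  set b : Edge → ℂ := fun e => ∫ θ in Set.Icc D.c D.d, G θ * D.mult θ ^ e.1 * β e.2 θ with hb
  -- Because `H = L G`, the integrated right-hand side is the packet with amplitude `H`. Hence the
  -- superposed functions are the solutions at spectral parameter zero with source `D.packet H`.
  have hdata : ∀ e, ∫ θ in Set.Icc D.c D.d, (G θ * D.mult θ ^ e.1) • A e θ =
      (α e, b e, D.packet H e) := by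
    intro e
    have h1 := (ContinuousLinearMap.fst ℂ ℂ (ℂ × EdgeL2)).integral_comp_comm (hint e)
    have h2 := ((ContinuousLinearMap.fst ℂ ℂ EdgeL2).comp
      (ContinuousLinearMap.snd ℂ ℂ (ℂ × EdgeL2))).integral_comp_comm (hint e)
    have h3 := ((ContinuousLinearMap.snd ℂ ℂ EdgeL2).comp
      (ContinuousLinearMap.snd ℂ ℂ (ℂ × EdgeL2))).integral_comp_comm (hint e)
    have h4 := inclL.integral_comp_comm ((D.continuous_integrand H e).integrableOn_Icc
      (a := D.c) (b := D.d) (μ := volume))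
    refine Prod.ext h1.symm (Prod.ext h2.symm (h3.symm.trans ?_))
    rw [packet_apply, edge, ← h4]
    congr 1
    funext θ
    change (G θ * D.mult θ ^ e.1) • ((L θ : ℂ) • inclL (D.V e.2 θ)) =
      inclL ((H θ * D.mult θ ^ e.1) • D.V e.2 θ)
    rw [map_smul, hGH, smul_smul]
    congr 1
    ring
  have hedge : ∀ e, edgeSol hq 0 (α e, b e, D.packet H e) = D.edge G e := by
    intro e
    rw [← hdata, edge, ← ContinuousLinearMap.integral_comp_comm _ (hint e)]
    congr 1
    funext θ
    rw [map_smul, ← hV0]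
  have hedge' : ∀ e, edgeSol' hq 0 (α e, b e, D.packet H e) = ∫ θ in Set.Icc D.c D.d,
      (G θ * D.mult θ ^ e.1) • edgeSol' hq 0 (A e θ) := by
    intro e
    rw [← hdata, ← ContinuousLinearMap.integral_comp_comm _ (hint e)]
    congr 1
    funext θ
    rw [map_smul]
  have hc' : ∀ e, Continuous fun θ => (G θ * D.mult θ ^ e.1) • edgeSol' hq 0 (A e θ) := fun e =>
    (hm e).smul ((edgeSol' hq 0).continuous.comp (hAc e))
  have hext : ∀ t : ℝ, Continuous fun u : EdgeC => ext u t := fun t =>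
    (evalL (Set.projIcc 0 1 zero_le_one t)).continuous
  have key := Kirchhoff.integral (N := N) (a := a) (k := k) (measurableSet_Icc (a := D.c) (b := D.d))
    (u := fun θ e t => ext ((G θ * D.mult θ ^ e.1) • D.V e.2 θ) t)
    (u' := fun θ e t => ext ((G θ * D.mult θ ^ e.1) • edgeSol' hq 0 (A e θ)) t)
    (fun e t => ((hext t).comp (hc' e)).integrableOn_Icc) (fun θ hθ => by
      have h := (hK θ hθ).const_mul (G θ)
      have h1 : (fun (e : Edge) t => ext ((G θ * D.mult θ ^ e.1) • D.V e.2 θ) t) = fun e t =>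
          G θ * ext (edgeSol hq (L θ) (D.mult θ ^ e.1 * s e.2 θ, D.mult θ ^ e.1 * β e.2 θ, 0)) t := by
        funext e t
        rw [smul_data, map_smul, ← hV, ← ext_smul, smul_smul]
      have h2 : (fun (e : Edge) t => ext ((G θ * D.mult θ ^ e.1) • edgeSol' hq 0 (A e θ)) t) =
          fun e t => G θ *
            ext (edgeSol' hq (L θ) (D.mult θ ^ e.1 * s e.2 θ, D.mult θ ^ e.1 * β e.2 θ, 0)) t := by
        funext e t
        rw [smul_data, map_smul, hV0', ← ext_smul, smul_smul]
      rw [h1, h2]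
      exact h)
  obtain ⟨f, hf, hrel⟩ := HRel_of_edgeSol (N := N) (a := a) (k := k) hq 0 (D.summable_coeff G hs)
    (D.summable_coeff G hβ) (D.packet H) (by
      have h1 : (fun e => ext (edgeSol hq 0 (α e, b e, D.packet H e))) = fun (e : Edge) t =>
          ∫ θ in Set.Icc D.c D.d, ext ((G θ * D.mult θ ^ e.1) • D.V e.2 θ) t := by
        funext e t
        rw [hedge, edge, ext_integral (D.continuous_integrand G e)]
      have h2 : (fun e => ext (edgeSol' hq 0 (α e, b e, D.packet H e))) = fun (e : Edge) t =>
          ∫ θ in Set.Icc D.c D.d, ext ((G θ * D.mult θ ^ e.1) • edgeSol' hq 0 (A e θ)) t := by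
        funext e t
        rw [hedge', ext_integral (hc' e)]
      change Kirchhoff N a k (fun e => ext (edgeSol hq 0 (α e, b e, D.packet H e)))
        (fun e => ext (edgeSol' hq 0 (α e, b e, D.packet H e)))
      rw [h1, h2]
      exact key)
  have hfG : f = D.packet G := by
    apply lp.ext
    funext e
    rw [hf, packet_apply]
    exact congrArg inclL (hedge e)
  rw [zero_smul, add_zero, hfG] at hrel
  exact hrel

end BlochFamily

theorem ne_zero_of_ext_zero {u : EdgeC} (hu : ext u 0 ≠ 0) : inclL u ≠ 0 := by
  intro h
  have h1 : ext u =ᵐ[edgeMeasure] 0 := by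
    refine (inclL_ae u).symm.trans ?_
    rw [h]
    exact Lp.coeFn_zero ℂ 2 edgeMeasure
  exact hu (Measure.eqOn_Icc_of_ae_eq volume (by norm_num) h1 (continuous_ext u).continuousOn
    continuousOn_const zero_mem_Icc)

/-- The first Bloch equation is trivial for the vector `(P, 1 + κ τ)`; the second is then the
multiplier equation for `τ`. -/
theorem bloch_equations (hq : MemLp q 2 edgeMeasure) (hc : cK N a k ≠ 0) {lam : ℂ} {θ : ℝ}
    (hw : wK q N a k lam = Real.cos θ) {τ : ℂ}
    (hτ : τ = (starRingEnd ℂ) (half N k) * Complex.exp (θ * Complex.I)) :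
    (τ + (starRingEnd ℂ) (kap N a k)) * (1 + kap N a k * τ) =
      bigQ q lam * τ * bigP q lam := by
  have h1 : half N k * τ ^ 2 + (starRingEnd ℂ) (half N k) = 2 * wK q N a k lam * τ := by
    have h2 : Complex.exp (θ * Complex.I) * Complex.exp (-θ * Complex.I) = 1 := by
      rw [← Complex.exp_add]
      simp
    have h3 := half_mul_conj N k
    rw [hw, hτ, Complex.ofReal_cos, Complex.cos]
    linear_combination (starRingEnd ℂ) (half N k) * Complex.exp (θ * Complex.I) ^ 2 * h3 -
      (starRingEnd ℂ) (half N k) * h2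
  have h4 := (root_iff hq hc lam τ).2 h1
  linear_combination h4

theorem exists_packet (hq : MemLp q 2 edgeMeasure) (hc : cK N a k ≠ 0) {x₀ r : ℝ}
    (hr : r ∈ Set.Ioo (-1 : ℝ) 1) (h0 : wK q N a k x₀ = r) {ε : ℝ} (hε : 0 < ε) :
    ∃ ψ : L2Graph, ∃ μ : Measure ℝ, IsSpectralMeasure (opH q N a k) ψ μ ∧ μ ≪ volume ∧
      μ (Set.Ioo (x₀ - ε) (x₀ + ε)) ≠ 0 := by
  obtain ⟨c, d, L, hc0, hcd, hdπ, hL, hLε, hLw, hLc⟩ :=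
    (bandFunction_wK hq hc).exists_parametrization hr h0 hε
  have hne : ∀ θ, phi1 q (L θ) ≠ 0 ∧ bigP q (L θ) ≠ 0 := fun θ => by
    obtain ⟨y, hy, hyw⟩ := hLw θ
    exact phi1_ne_zero_and_bigP_ne_zero hq hc hy hyw
  have hLC : Continuous fun θ => (L θ : ℂ) := Complex.continuous_ofReal.comp hL
  set τ : ℝ → ℂ := fun θ => (starRingEnd ℂ) (half N k) * Complex.exp (θ * Complex.I) with hτ
  have hτc : Continuous τ := by fun_prop
  -- A kernel vector that is continuous in `θ`; it never vanishes because `P ≠ 0` on the open band.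
  set X : ℝ → ℂ := fun θ => bigP q (L θ) with hX
  set Y : ℝ → ℂ := fun θ => 1 + kap N a k * τ θ with hY
  have h1c : Continuous fun θ => theta1 q (L θ) := (differentiable_theta1 hq).continuous.comp hLC
  have h2c : Continuous fun θ => phi1 q (L θ) := (differentiable_phi1 hq).continuous.comp hLC
  have h3c : Continuous fun θ => phi1' q (L θ) := (differentiable_phi1' hq).continuous.comp hLC
  have hXc : Continuous X := (continuous_const.mul h3c).add h1c
  have hYc : Continuous Y := continuous_const.add (continuous_const.mul hτc)
  set s : Fin 3 → ℝ → ℂ := fun j θ => ![X θ, Y θ, τ θ * X θ] j with hs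
  set β : Fin 3 → ℝ → ℂ := fun j θ => blochSlope q N a k (L θ) (τ θ) (X θ) (Y θ) j with hβ
  have hsc : ∀ j, Continuous (s j) := by
    intro j
    fin_cases j
    · exact hXc
    · exact hYc
    · exact hτc.mul hXc
  have hβc : ∀ j, Continuous (β j) := by
    intro j
    have h4 : Continuous fun θ => (![Y θ, (starRingEnd ℂ) (om a) * (τ θ * X θ),
        (starRingEnd ℂ) (om a * sPow N k) * Y θ] : Fin 3 → ℂ) j := by
      fin_cases j
      · exact hYc
      · exact continuous_const.mul (hτc.mul hXc)
      · exact continuous_const.mul hYc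
    exact (h4.sub ((hsc j).mul h1c)).div h2c fun θ => (hne θ).1
  have hVc : ∀ j, Continuous fun θ => edgeSol hq (L θ) (s j θ, β j θ, 0) := by
    intro j
    have h5 : ∀ θ, edgeSol hq (L θ) (s j θ, β j θ, 0) =
        s j θ • edgeSol hq (L θ) (1, 0, 0) + β j θ • edgeSol hq (L θ) (0, 1, 0) := by
      intro θ
      rw [← map_smul, ← map_smul, ← map_add]
      simp
    simp only [h5]
    exact ((hsc j).smul ((differentiable_edgeSol hq 1 0 0).continuous.comp hLC)).add
      ((hβc j).smul ((differentiable_edgeSol hq 0 1 0).continuous.comp hLC))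
  let D : BlochFamily :=
    { c := c, d := d, σ := (starRingEnd ℂ) (half N k)
      V := fun j => ⟨fun θ => edgeSol hq (L θ) (s j θ, β j θ, 0), hVc j⟩
      c_nonneg := hc0.le, c_lt_d := hcd, d_le := by linarith [Real.pi_pos]
      norm_σ := by rw [RCLike.norm_conj, norm_half] }
  have hK : ∀ θ ∈ Set.Icc D.c D.d, Kirchhoff N a k
      (fun e => ext (edgeSol hq (L θ) (D.mult θ ^ e.1 * s e.2 θ, D.mult θ ^ e.1 * β e.2 θ, 0)))
      (fun e => ext (edgeSol' hq (L θ)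
        (D.mult θ ^ e.1 * s e.2 θ, D.mult θ ^ e.1 * β e.2 θ, 0))) := fun θ hθ =>
    (isGraphSolution_bloch hq (hne θ).1 (D.mult_ne_zero θ) (mul_comm _ _)
      (bloch_equations hq hc (hLc θ hθ) rfl)).kirchhoff
  -- The profile on the edge with `j = 0` starts with the value `P ≠ 0`, so it is not the zero
  -- function.
  have hpos : ∀ θ ∈ Set.Icc D.c D.d, 0 < D.density θ := by
    intro θ _
    refine mul_pos Real.two_pi_pos (Finset.sum_pos' (fun _ _ => sq_nonneg _)
      ⟨0, Finset.mem_univ _, ?_⟩)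
    have h6 : inclL (D.V 0 θ) ≠ 0 := by
      refine ne_zero_of_ext_zero ?_
      change ext (edgeSol hq (L θ) (s 0 θ, β 0 θ, 0)) 0 ≠ 0
      rw [edgeSol_zero]
      exact (hne θ).2
    exact pow_pos (norm_pos_iff.2 h6) 2
  refine ⟨D.packet 1, D.spectralMeasure L,
    D.isSpectralMeasure hL fun G H hGH => D.HRel_packet hq hL hsc hβc (fun _ _ => rfl) hK hGH,
    D.spectralMeasure_ac hL fun S hS =>
      (bandFunction_wK hq hc).volume_preimage_eq_zero hc0 hdπ hLc hS,
    D.spectralMeasure_ne_zero hL measurableSet_Ioo (fun θ => ?_) hpos⟩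
  have := abs_lt.1 (hLε θ)
  exact ⟨by linarith, by linarith⟩

end

section

variable {q : ℝ → ℝ} {N : ℕ} {a : ℝ} {k : ℤ}

/-! ### The spectrum of `H_k` -/

theorem wK_ne_of_notMem_bands (hq : MemLp q 2 edgeMeasure) (hc : cK N a k ≠ 0) {lam : ℂ}
    (h : lam ∉ bands q N a k) : ∀ x ∈ Set.Icc (-1 : ℝ) 1, wK q N a k lam ≠ x := by
  by_cases hl : lam.im = 0
  · intro x hx hw
    exact h ⟨hl, x, hx, hw⟩
  · exact wK_ne_of_im hq hc hl

theorem isClosed_bands (hq : MemLp q 2 edgeMeasure) : IsClosed (bands q N a k) := by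
  have h1 : bands q N a k = Complex.im ⁻¹' {0} ∩
      wK q N a k ⁻¹' ((fun x : ℝ => (x : ℂ)) '' Set.Icc (-1 : ℝ) 1) := by
    ext lam
    constructor
    · rintro ⟨h, r, hr, hw⟩
      exact ⟨h, r, hr, hw.symm⟩
    · rintro ⟨h, r, hr, hw⟩
      exact ⟨h, r, hr, hw.symm⟩
  rw [h1]
  exact (isClosed_singleton.preimage Complex.continuous_im).inter
    (((isCompact_Icc.image Complex.continuous_ofReal).isClosed).preimage
      (differentiable_wK hq).continuous)

/-- Off the closed set `bands` a punctured real neighbourhood is free of bands and of Dirichlet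
points, hence lies in the resolvent set. At a point of `bands`, possibly an edge, `exists_near`
supplies open band points arbitrarily close, and a packet there charges every interval around the
original point. -/
theorem acSpectrum_opH (hq : MemLp q 2 edgeMeasure) (hc : cK N a k ≠ 0) :
    acSpectrum (opH q N a k) = bands q N a k := by
  have hsa := isSelfAdj_opH (N := N) (a := a) (k := k) hq hc
  apply Set.Subset.antisymm
  · intro lam hlam
    by_contra hb
    by_cases hl : lam.im = 0
    · obtain ⟨x, rfl⟩ : ∃ x : ℝ, (x : ℂ) = lam := ⟨lam.re, Complex.ext rfl hl.symm⟩
      refine hlam (inResolventOn_acSubspace_of_punctured hsa ?_)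
      have h1 : Filter.Tendsto (fun y : ℝ => (y : ℂ)) (𝓝[≠] x) (𝓝[≠] (x : ℂ)) :=
        Complex.continuous_ofReal.continuousAt.continuousWithinAt.tendsto_nhdsWithin
          fun y hy h => hy (Complex.ofReal_injective h)
      have h2 : ∀ᶠ z in 𝓝[≠] (x : ℂ), z ∉ bands q N a k :=
        nhdsWithin_le_nhds ((isClosed_bands hq).isOpen_compl.eventually_mem hb)
      filter_upwards [h1.eventually (eventually_phi1_ne_zero hq x), h1.eventually h2] with y h3 h4
      exact inResolventOn_opH hq hc h3 (wK_ne_of_notMem_bands hq hc h4)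
    · exact hlam (inResolventOn_acSubspace_of_im hsa hl)
  · rintro lam ⟨hl, r, hr, hw⟩ hres
    obtain ⟨x, rfl⟩ : ∃ x : ℝ, (x : ℂ) = lam := ⟨lam.re, Complex.ext rfl hl.symm⟩
    obtain ⟨δ, hδ, h0⟩ := exists_measure_Ioo_eq_zero_ac hsa hres
    obtain ⟨y, hy, s, hs, hys⟩ := (bandFunction_wK hq hc).exists_near hr hw (half_pos hδ)
    obtain ⟨ψ, μ, hμ, hac, hne⟩ := exists_packet hq hc hs hys (half_pos hδ)
    have hy' := abs_lt.1 hy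
    exact hne (measure_mono_null (Set.Ioo_subset_Ioo (by linarith) (by linarith))
      (h0 ψ ⟨μ, hμ, hac⟩ μ hμ))

theorem opSpectrum_opH (hq : MemLp q 2 edgeMeasure) (hc : cK N a k ≠ 0) :
    opSpectrum (opH q N a k) = infSpectrum (opH q N a k) ∪ acSpectrum (opH q N a k) := by
  have hsa := isSelfAdj_opH (N := N) (a := a) (k := k) hq hc
  apply Set.Subset.antisymm
  · intro lam hlam
    by_contra hn
    rw [Set.mem_union, infSpectrum_opH hq hc, acSpectrum_opH hq hc, mem_dirichletSpectrum_iff hq,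
      not_or] at hn
    exact hlam (inResolventOn_opH hq hc hn.1 (wK_ne_of_notMem_bands hq hc hn.2))
  · refine Set.union_subset (infSpectrum_subset_opSpectrum _) fun lam hlam hres => ?_
    by_cases hl : lam.im = 0
    · obtain ⟨x, rfl⟩ : ∃ x : ℝ, (x : ℂ) = lam := ⟨lam.re, Complex.ext rfl hl.symm⟩
      exact hlam (inResolventOn_acSubspace_of_univ hsa hres)
    · exact hlam (inResolventOn_acSubspace_of_im hsa hl)

end

end ZigzagGraph

end

theorem theorem1p4 (q : ℝ → ℝ) (hq : MemLp q 2 edgeMeasure)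
    (N : ℕ) (hN : 1 ≤ N) (a : ℝ) (k : ℤ) (hc : cK N a k ≠ 0) :
    -- i) the Lyapunov functions built from the eigenvalues of the monodromy matrix
    (∀ lam : ℂ, lam ∉ dirichletSpectrum q →
      (∃ Θ Θ' Φ Φ' : Edge → ℝ → ℂ,
        IsFundamentalPair q N a k lam Θ Θ' Φ Φ') ∧
      ∀ Θ Θ' Φ Φ' : Edge → ℝ → ℂ,
        IsFundamentalPair q N a k lam Θ Θ' Φ Φ' →
        ∀ τp τm : ℂ, (monodromy Θ Θ' Φ Φ').charpoly.roots = {τp, τm} →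
          τp ≠ 0 ∧ τm ≠ 0 ∧
          ∃ r : ℂ, r ^ 2 = RK q N a k lam ∧
            (τp + 1 / τp) / 2 = TK q N a k lam + r ∧
            (τm + 1 / τm) / 2 = TK q N a k lam - r) ∧
    -- ii) the spectrum
    opSpectrum (opH q N a k) =
      infSpectrum (opH q N a k) ∪
        acSpectrum (opH q N a k) ∧
    infSpectrum (opH q N a k) = dirichletSpectrum q ∧
    acSpectrum (opH q N a k) =
      {lam : ℂ | lam.im = 0 ∧ ∃ z ∈ lyapunovValues q N a k lam,
        ∃ x ∈ Set.Icc (-1 : ℝ) 1, z = (x : ℂ)} ∧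
    acSpectrum (opH q N a k) =
      {lam : ℂ | lam.im = 0 ∧ ∀ z ∈ lyapunovValues q N a k lam,
        ∃ x ∈ Set.Icc (-1 : ℝ) 1, z = (x : ℂ)} ∧
    -- iii) no critical points inside the bands
    (∀ lam : ℝ, ¬ IsBranchPoint q N a k (lam : ℂ) →
      ∀ f : ℂ → ℂ, IsLyapunovBranchAt q N a k f (lam : ℂ) →
        (∃ x ∈ Set.Ioo (-1 : ℝ) 1, f (lam : ℂ) = (x : ℂ)) → deriv f (lam : ℂ) ≠ 0) := by
  refine ⟨fun lam hlam => ?_, opSpectrum_opH hq hc, infSpectrum_opH hq hc, ?_, ?_,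
    fun lam _ f hf hx => deriv_lyapunov_ne_zero hq hc lam f hf hx⟩
  · have hph : phi1 q lam ≠ 0 := fun h => hlam ((mem_dirichletSpectrum_iff hq lam).2 h)
    exact ⟨exists_isFundamentalPair hq hc hph, fun Θ Θ' Φ Φ' h τp τm hτ =>
      lyapunov_of_monodromy hq hc hph h hτ⟩
  · rw [acSpectrum_opH hq hc]
    exact (bands_eq hq hc).1
  · rw [acSpectrum_opH hq hc]
    exact (bands_eq hq hc).2
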